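/- A parity game with an even number $d$ of priorities consists of a finite directed graph $(V,E)$, $E\subseteq V\times V$, in which every vertex has an outgoing edge, a partition $V=V_E\uplus V_A$ of the vertices into those controlled by Eve and those controlled by Adam, and a priority $c(v)\in\{1,\dots,d\}$ for every $v\in V$. A token is placed on an initial vertex $v_0$ and moved forever along edges, the player who controls the current vertex choosing the next edge; a strategy of a player chooses the next edge as a function of the path followed so far. Eve wins from $v_0$ if she has a strategy such that, against every strategy of Adam, the largest priority appearing infinitely often in the resulting play is even. Solving parity games means deciding, given a parity game and an initial vertex $v_0$, whether Eve wins from $v_0$. **Theorem.** There exists an algorithm solving parity games which, on games with $n\ge 2$ vertices, $m$ edges and $d$ priorities ($d$ even), runs in time $$O\left(m\,n\,\log n\,\log d\cdot\binom{\lceil\log n\rceil+d/2-1}{\lceil\log n\rceil}\right),$$ where $\log$ is the logarithm in base $2$ and the implied constant is absolute. Here the algorithm is a single program for a random access machine with addition, (truncated) subtraction, comparison and indirect addressing; time is measured by logarithmic cost (an instruction costs one plus the binary lengths of the numbers and addresses it operates on); and the input consists of $n$, $d$, $m$, $v_0$, the owner and the priority of each vertex, and the list of the edges in arbitrary order. (For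 $n=1$ the algorithm is also correct, but the displayed bound is $0$ and no bound is claimed.) -/

import Mathlib

/-! ### Parity games -/

/-- A parity game with priorities in `{1, …, d}`: a directed graph without dead ends, the set of
vertices controlled by Eve (the remaining vertices are controlled by Adam), and a priority for
every vertex. -/
structure ParityGame (V : Type) (d : ℕ) where
  edges : Finset (V × V)
  eve : Finset V
  prio : V → ℕ
  one_le_prio : ∀ v, 1 ≤ prio v
  prio_le : ∀ v, prio v ≤ d
  exists_edge : ∀ v, ∃ w, (v, w) ∈ edges

namespace ParityGame

variable {V : Type} {d : ℕ}

/-- A strategy. The path followed so far is given by the list of the vertices visited before the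
current one (oldest first) and by the current vertex; the strategy answers with the target of an
edge leaving the current vertex. Only its answers at the vertices of its owner matter. -/
structure Strategy (G : ParityGame V d) where
  move : List V → V → V
  legal : ∀ path v, (v, move path v) ∈ G.edges

/-- The situation after `i` moves from `v₀` when Eve plays `σ` and Adam plays `τ`: the vertices
visited previously, and the current vertex. -/
def situation [DecidableEq V] (G : ParityGame V d) (v₀ : V) (σ τ : G.Strategy) : ℕ → List V × V
  | 0 => ([], v₀)
  | i + 1 =>
    let s := G.situation v₀ σ τ i
    (s.1 ++ [s.2], if s.2 ∈ G.eve then σ.move s.1 s.2 else τ.move s.1 s.2)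

/-- The play from `v₀` consistent with the strategies `σ` of Eve and `τ` of Adam. -/
def play [DecidableEq V] (G : ParityGame V d) (v₀ : V) (σ τ : G.Strategy) (i : ℕ) : V :=
  (G.situation v₀ σ τ i).2

/-- The parity objective: the largest priority appearing infinitely often is even. -/
def Parity (G : ParityGame V d) (π : ℕ → V) : Prop :=
  ∃ p, IsGreatest {q | ∃ᶠ i in Filter.atTop, G.prio (π i) = q} p ∧ Even p

/-- Eve has a winning strategy from `v₀`. -/
def EveWins [DecidableEq V] (G : ParityGame V d) (v₀ : V) : Prop :=
  ∃ σ : G.Strategy, ∀ τ : G.Strategy, G.Parity (G.play v₀ σ τ)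

/-- The input word for a game on the vertices `0, …, n - 1` whose edges are listed by `es`:
the number of vertices, the number of priorities, the number of edges and the initial vertex;
then for every vertex its owner (`1` for Eve, `0` for Adam) and its priority;
then for every edge its source and its target. -/
def encode {n d : ℕ} (G : ParityGame (Fin n) d) (es : List (Fin n × Fin n)) (v₀ : Fin n) :
    List ℕ :=
  [n, d, es.length, v₀.val] ++
    (List.finRange n).flatMap (fun v => [if v ∈ G.eve then 1 else 0, G.prio v]) ++
    es.flatMap (fun e => [e.1.val, e.2.val])

end ParityGame

/-! ### Random access machines with logarithmic cost -/

namespace RAM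

/-- A machine has registers (a program mentions finitely many of them) and a memory, all of whose
cells hold natural numbers. -/
structure State where
  reg : ℕ → ℕ
  mem : ℕ → ℕ

/-- Elementary instructions; register operands are given by their names. -/
inductive Instr where
  /-- `r := k` -/
  | const (r k : ℕ)
  /-- `r := a + b` -/
  | add (r a b : ℕ)
  /-- `r := a - b`, and `0` when this is negative -/
  | sub (r a b : ℕ)
  /-- `r := mem[a]` -/
  | load (r a : ℕ)
  /-- `mem[a] := b` -/
  | store (a b : ℕ)

/-- The effect of an instruction. -/
def Instr.run : Instr → State → State
  | .const r k, s => { s with reg := Function.update s.reg r k }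
  | .add r a b, s => { s with reg := Function.update s.reg r (s.reg a + s.reg b) }
  | .sub r a b, s => { s with reg := Function.update s.reg r (s.reg a - s.reg b) }
  | .load r a, s => { s with reg := Function.update s.reg r (s.mem (s.reg a)) }
  | .store a b, s => { s with mem := Function.update s.mem (s.reg a) (s.reg b) }

/-- The logarithmic cost of an instruction: one, plus the binary lengths of the numbers and memory
addresses it operates on (`Nat.size x` is the number of binary digits of `x`). -/
def Instr.cost : Instr → State → ℕ
  | .const _ k, _ => 1 + Nat.size k
  | .add _ a b, s => 1 + Nat.size (s.reg a) + Nat.size (s.reg b)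
  | .sub _ a b, s => 1 + Nat.size (s.reg a) + Nat.size (s.reg b)
  | .load _ a, s => 1 + Nat.size (s.reg a) + Nat.size (s.mem (s.reg a))
  | .store a b, s => 1 + Nat.size (s.reg a) + Nat.size (s.reg b)

/-- Programs. The control flow is structured; conditional jumps implement it with a constant
overhead. -/
inductive Program where
  | instr (i : Instr)
  /-- first `P`, then `Q` -/
  | seq (P Q : Program)
  /-- if `a < b` then `P` else `Q` -/
  | branch (a b : ℕ) (P Q : Program)
  /-- while `a < b` do `P` -/
  | loop (a b : ℕ) (P : Program)

/-- The cost of testing whether `a < b`. -/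
def testCost (a b : ℕ) (s : State) : ℕ := 1 + Nat.size (s.reg a) + Nat.size (s.reg b)

/-- `Exec P s t s'`: started in `s`, the program `P` halts in `s'` after time `t`. -/
inductive Exec : Program → State → ℕ → State → Prop
  | instr (i : Instr) (s : State) : Exec (.instr i) s (i.cost s) (i.run s)
  | seq {P Q : Program} {s s' s'' : State} {t t' : ℕ} :
      Exec P s t s' → Exec Q s' t' s'' → Exec (.seq P Q) s (t + t') s''
  | branch_true {a b : ℕ} {P Q : Program} {s s' : State} {t : ℕ} :
      s.reg a < s.reg b → Exec P s t s' → Exec (.branch a b P Q) s (testCost a b s + t) s'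
  | branch_false {a b : ℕ} {P Q : Program} {s s' : State} {t : ℕ} :
      ¬ s.reg a < s.reg b → Exec Q s t s' → Exec (.branch a b P Q) s (testCost a b s + t) s'
  | loop_done {a b : ℕ} {P : Program} {s : State} :
      ¬ s.reg a < s.reg b → Exec (.loop a b P) s (testCost a b s) s
  | loop_step {a b : ℕ} {P : Program} {s s' s'' : State} {t t' : ℕ} :
      s.reg a < s.reg b → Exec P s t s' → Exec (.loop a b P) s' t' s'' →
      Exec (.loop a b P) s (testCost a b s + t + t') s''

/-- The initial state on an input word: the word is written in the first memory cells, and all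
other cells and all registers hold `0`. -/
def init (w : List ℕ) : State where
  reg := fun _ => 0
  mem := fun i => w.getD i 0

end RAM

/-!
# Solving parity games by value iteration over a universal tree

Let `k = ⌊log₂ n⌋` and `h = d / 2`.

*The tree.* The leaves of an ordered tree of height `h` are stored from left to right as the
sequence `sepSeq k h`, which records for every leaf at which level its path leaves that of its
predecessor. The sequence follows the recursion "a tree for half of the tuples, a tree of smaller
height, another tree for half of the tuples". It has at most `2 ^ (k + 1) * (k + h - 1).choose k`
leaves (`length_sepSeq_le`), and every family of fewer than `2 ^ (k + 1)` tuples of ordinals can be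
mapped to its leaves such that all truncations of the lexicographic order are preserved
(`exists_embedding`).

*From winning strategies to progress measures.* Let `σ` be a winning strategy of Eve. For odd `q`,
the relation "the path `y` extends the path `x` by a segment whose largest priority is `q`" is
well-founded on the paths consistent with `σ`, since an infinite chain would converge to a play lost
by Eve. The ranks in these relations form a tuple for every path, and the lexicographically least
tuple of the paths ending in `v` defines a progress measure (`ParityGame.EveWins.exists_measure`).
Embedding the values of this measure into the tree gives a stable assignment of positions in the
sequence of leaves to the vertices (`ParityGame.EveWins.exists_isSolution`). Conversely, Eve wins
from every vertex to which a stable assignment gives a position other than the top element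
(`ParityGame.IsSolution.eveWins`).

*The iteration.* Starting from the least positions, a vertex which violates its condition is lifted
to the next admissible position as long as possible. The positions stay below every stable
assignment (`ParityGame.IsSolution.next_le`), thus the iteration ends with the least one. A queue
holds the vertices which may need a lift, and for every vertex the number of valid outgoing edges is
maintained, so that a lift of `v` takes time proportional to the number of edges incident to `v`
plus the number of positions skipped. Summing over all vertices and positions, the number of loop
iterations is `O(m * N)`, where `N` is the number of leaves (`Imp.Input.wp_solve`).

*The machine.* The algorithm is written in a small language with variables, arrays and loops, for
which there are Hoare-style rules for weakest preconditions (`Imp.Wp`); only loop iterations are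
counted. The compiler to the random access machine interleaves the arrays behind the input word, and
the cost of the compiled program is at most a constant times the number of iterations times the
number of digits of the largest number involved (`Imp.Run.reaches_compile`). These numbers are
polynomial in `n`, `d` and `N`, and `N ≤ 2 * n * h ^ k`, hence they have `O(log n * log d)` digits
(`ParityGame.size_valueBound_le`).
-/

/-! ### The leaves of a universal tree -/

/-- The leaves of a universal tree of height `h` for fewer than `2 ^ (k + 1)` tuples, from left to
right. Each leaf is represented by a number telling where its path leaves the path of the previous
leaf: two neighbouring leaves differ in a component `j` with `c < 2 * (j + 1)` if and only if the
number of the right one exceeds `c`. The first leaf has no left neighbour and gets the number `s`.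
The three parts are the leaves below, at and above a pivot of the topmost component, which is chosen
such that the outer parts need to accommodate at most half of the tuples. -/
def sepSeq : ℕ → ℕ → ℕ → List ℕ
  | 0, _, s => [s]
  | _ + 1, 0, s => [s]
  | k + 1, h + 1, s =>
    sepSeq k (h + 1) s ++ (sepSeq (k + 1) h (2 * (h + 1)) ++ sepSeq k (h + 1) (2 * (h + 1)))
termination_by k h => k + h

theorem length_sepSeq_pos (k h s : ℕ) : 0 < (sepSeq k h s).length := by
  fun_induction sepSeq k h s <;> simp_all

theorem sepSeq_getD_zero (k h s : ℕ) : (sepSeq k h s).getD 0 0 = s := by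
  fun_induction sepSeq k h s with
  | case1 => simp
  | case2 => simp
  | case3 k h s ih1 ih2 ih3 =>
    rw [List.getD_append _ _ _ _ (length_sepSeq_pos _ _ _), ih1]

theorem sepSeq_mem_le (k h s x : ℕ) (hx : x ∈ sepSeq k h s) : x = s ∨ x ≤ 2 * h := by
  fun_induction sepSeq k h s with
  | case1 => simp_all
  | case2 => simp_all
  | case3 k h s ih1 ih2 ih3 =>
    simp only [List.mem_append] at hx
    grind

theorem sepSeq_getD_le (k h s r : ℕ) (hr : 0 < r) : (sepSeq k h s).getD r 0 ≤ 2 * h := by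
  fun_induction sepSeq k h s generalizing r with
  | case1 => rw [List.getD_eq_default _ _ (by simp; omega)]; exact Nat.zero_le _
  | case2 => rw [List.getD_eq_default _ _ (by simp; omega)]
  | case3 k h s ih1 ih2 ih3 =>
    rcases lt_or_ge r (sepSeq k (h + 1) s).length with h1 | h1
    · rw [List.getD_append _ _ _ _ h1]; exact ih1 r hr
    · rw [List.getD_append_right _ _ _ _ h1]
      rw [List.getD_eq_getElem?_getD]
      rcases hc : (sepSeq (k + 1) h (2 * (h + 1)) ++ sepSeq k (h + 1) (2 * (h + 1)))[r -
        (sepSeq k (h + 1) s).length]? with _ | x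
      · simp
      · have := List.mem_of_getElem? hc
        simp only [List.mem_append] at this
        simp only [Option.getD_some]
        rcases this with h2 | h2 <;> rcases sepSeq_mem_le _ _ _ _ h2 with h3 | h3 <;> omega

theorem length_sepSeq_one (k s : ℕ) : (sepSeq k 1 s).length + 1 = 2 ^ (k + 1) := by
  induction k generalizing s with
  | zero => simp [sepSeq]
  | succ k ih =>
    have h0 := ih s
    have h1 := ih 2
    simp only [sepSeq, List.length_append, List.length_singleton]
    rw [pow_succ]; simp at *; omega

/-- By Pascal's rule, the recursion for the number of leaves is that of the bound. -/
theorem length_sepSeq_le (k h s : ℕ) :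
    (sepSeq k (h + 1) s).length ≤ 2 ^ (k + 1) * (k + h).choose k := by
  induction h generalizing k s with
  | zero =>
    have := length_sepSeq_one k s
    simp only [zero_add, add_zero, Nat.choose_self, mul_one]; omega
  | succ h ih =>
    induction k generalizing s with
    | zero => simp [sepSeq]
    | succ k ih2 =>
      have e : (k + 1 + (h + 1)).choose (k + 1) =
          (k + (h + 1)).choose k + (k + 1 + h).choose (k + 1) := by
        rw [show k + 1 + (h + 1) = (k + (h + 1)) + 1 by ring, Nat.choose_succ_succ,
          show k + (h + 1) = k + 1 + h by ring]
      rw [sepSeq, e]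
      simp only [List.length_append]
      have a1 := ih2 s
      have a2 := ih2 (2 * (h + 1 + 1))
      have a3 := ih (k + 1) (2 * (h + 1 + 1))
      have : 2 ^ (k + 1 + 1) = 2 * 2 ^ (k + 1) := by ring
      calc _ ≤ 2 ^ (k + 1) * (k + (h + 1)).choose k + (2 ^ (k + 1 + 1) * (k + 1 + h).choose (k + 1)
            + 2 ^ (k + 1) * (k + (h + 1)).choose k) := by omega
        _ = _ := by rw [this]; ring

/-! ### Universality of the tree -/

/-- Some boundary `r` of level `c`, that is, some position with `c < L r`, lies to the right of `x`
and not to the right of `y`. For the leaves of a universal tree this says that `x` is smaller than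
`y` when only the components `j` with `c < 2 * (j + 1)` are compared. -/
def Separated (L : ℕ → ℕ) (c x y : ℕ) : Prop := ∃ r, x < r ∧ r ≤ y ∧ c < L r

/-- The lexicographic order of the tuples `(μ a (h - 1), …, μ a 0)`, the first entry being the most
significant one, truncated to the components `j` with `c < 2 * (j + 1)`. Component `j` belongs to
the odd priority `2 * j + 1`, hence the components which matter at a vertex of priority `c` are
those of the odd priorities not smaller than `c`. -/
def TupleLt {A : Type*} (μ : A → ℕ → Ordinal.{0}) (h c : ℕ) (a b : A) : Prop :=
  ∃ j < h, c < 2 * (j + 1) ∧ μ a j < μ b j ∧ ∀ i, j < i → i < h → μ a i = μ b i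

theorem separated_append_left {l l' : List ℕ} {c x y : ℕ} (hy : y < l.length) :
    Separated (fun r => (l ++ l').getD r 0) c x y ↔ Separated (fun r => l.getD r 0) c x y := by
  refine exists_congr fun r => and_congr_right fun _ => and_congr_right fun h => ?_
  simp only
  rw [List.getD_append _ _ _ _ (by omega)]

theorem separated_append_right {l l' : List ℕ} {c x y : ℕ} :
    Separated (fun r => (l ++ l').getD r 0) c (l.length + x) (l.length + y) ↔
      Separated (fun r => l'.getD r 0) c x y := by
  constructor
  · rintro ⟨r, h1, h2, h3⟩
    simp only at h3
    rw [List.getD_append_right _ _ _ _ (by omega)] at h3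
    exact ⟨r - l.length, by omega, by omega, h3⟩
  · rintro ⟨r, h1, h2, h3⟩
    refine ⟨l.length + r, by omega, by omega, ?_⟩
    simp only
    rw [List.getD_append_right _ _ _ _ (by omega)]
    simpa using h3

theorem separated_append_cross {l l' : List ℕ} {c x y : ℕ} (hx : x < l.length)
    (h : c < l'.getD 0 0) :
    Separated (fun r => (l ++ l').getD r 0) c x (l.length + y) := by
  refine ⟨l.length, hx, by omega, ?_⟩
  simp only
  rw [List.getD_append_right _ _ _ _ le_rfl]
  simpa using h

theorem tupleLt_iff_of_last_lt {A : Type*} {μ : A → ℕ → Ordinal.{0}} {h c : ℕ} {a b : A}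
    (hlt : μ a h < μ b h) : TupleLt μ (h + 1) c a b ↔ c < 2 * (h + 1) := by
  constructor
  · rintro ⟨j, hj, hc, -, -⟩; omega
  · intro hc; exact ⟨h, by omega, hc, hlt, by intros; omega⟩

theorem not_tupleLt_of_last_gt {A : Type*} {μ : A → ℕ → Ordinal.{0}} {h c : ℕ} {a b : A}
    (hlt : μ b h < μ a h) : ¬ TupleLt μ (h + 1) c a b := by
  rintro ⟨j, hj, hc, h1, h2⟩
  rcases (Nat.lt_succ_iff_lt_or_eq.1 hj) with h3 | rfl
  · exact absurd (h2 h h3 (by omega)) hlt.ne'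
  · exact absurd h1 hlt.not_gt

theorem tupleLt_iff_of_last_eq {A : Type*} {μ : A → ℕ → Ordinal.{0}} {h c : ℕ} {a b : A}
    (he : μ a h = μ b h) : TupleLt μ (h + 1) c a b ↔ TupleLt μ h c a b := by
  constructor
  · rintro ⟨j, hj, hc, h1, h2⟩
    rcases (Nat.lt_succ_iff_lt_or_eq.1 hj) with h3 | rfl
    · exact ⟨j, h3, hc, h1, fun i hi hi' => h2 i hi (by omega)⟩
    · exact absurd he h1.ne
  · rintro ⟨j, hj, hc, h1, h2⟩
    refine ⟨j, by omega, hc, h1, fun i hi hi' => ?_⟩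
    rcases (Nat.lt_succ_iff_lt_or_eq.1 hi') with h3 | rfl
    · exact h2 i hi h3
    · exact he

/-- The `K`-th smallest value of `g` on `X`, counted with multiplicity. -/
theorem exists_pivot {A : Type*} (X : Finset A) (g : A → Ordinal.{0}) (K : ℕ)
    (h : K ≤ X.card) (hK : 0 < K) :
    ∃ c, (X.filter (fun a => g a < c)).card < K ∧
      (X.filter (fun a => c < g a)).card ≤ X.card - K := by
  classical
  let P : Set Ordinal.{0} := {c | K ≤ (X.filter (fun a => g a ≤ c)).card}
  have hne : P.Nonempty := by
    refine ⟨X.sup g, ?_⟩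
    have : X.filter (fun a => g a ≤ X.sup g) = X :=
      Finset.filter_true_of_mem fun a ha => Finset.le_sup ha
    simpa [P, this] using h
  have hmem : sInf P ∈ P := csInf_mem hne
  refine ⟨sInf P, ?_, ?_⟩
  · by_contra hcon
    push Not at hcon
    have hne' : (X.filter (fun a => g a < sInf P)).Nonempty := by
      rw [← Finset.card_pos]; omega
    obtain ⟨a, ha, hmax⟩ := Finset.exists_max_image _ g hne'
    have hin : g a ∈ P := by
      refine hcon.trans (Finset.card_le_card fun b hb => ?_)
      have := hmax b hb
      simp only [Finset.mem_filter] at hb ⊢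
      exact ⟨hb.1, this⟩
    exact absurd (csInf_le' hin) (not_le.2 (Finset.mem_filter.1 ha).2)
  · have := Finset.card_filter_add_card_filter_not (s := X) (fun a => g a ≤ sInf P)
    simp only [not_le] at this
    have h2 : K ≤ (X.filter (fun a => g a ≤ sInf P)).card := hmem
    omega

/-- Universality: fewer than `2 ^ (k + 1)` tuples of ordinals can be mapped to the leaves of
`sepSeq k h s` in such a way that all truncations of the lexicographic order are preserved and
reflected. -/
theorem exists_embedding {A : Type*} (μ : A → ℕ → Ordinal.{0}) (k h s : ℕ) (X : Finset A)
    (hX : X.card < 2 ^ (k + 1)) :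
    ∃ φ : A → ℕ, (∀ a ∈ X, φ a < (sepSeq k h s).length) ∧ ∀ a ∈ X, ∀ b ∈ X, ∀ c,
      (Separated (fun r => (sepSeq k h s).getD r 0) c (φ a) (φ b) ↔ TupleLt μ h c a b) := by
  classical
  fun_induction sepSeq k h s generalizing X with
  | case1 h s =>
    refine ⟨fun _ => 0, by simp, fun a ha b hb c => ?_⟩
    have : a = b := Finset.card_le_one.1 (by simp at hX; omega) a ha b hb
    subst this
    constructor
    · rintro ⟨r, h1, h2, -⟩; omega
    · rintro ⟨j, -, -, h1, -⟩; exact absurd h1 (lt_irrefl _)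
  | case2 k s =>
    refine ⟨fun _ => 0, by simp, fun a ha b hb c => ?_⟩
    constructor
    · rintro ⟨r, h1, h2, -⟩; simp only at h1 h2; omega
    · rintro ⟨j, h1, -⟩; omega
  | case3 k h s ih1 ih2 ih3 =>
    -- a pivot of the topmost component, leaving at most half of the tuples on either side
    obtain ⟨c₀, hlo, hhi⟩ : ∃ c₀, (X.filter (fun a => μ a h < c₀)).card < 2 ^ (k + 1) ∧
        (X.filter (fun a => c₀ < μ a h)).card < 2 ^ (k + 1) := by
      rcases lt_or_ge X.card (2 ^ (k + 1)) with hc | hc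
      · exact ⟨0, (Finset.card_filter_le _ _).trans_lt hc, (Finset.card_filter_le _ _).trans_lt hc⟩
      · obtain ⟨c₀, h1, h2⟩ := exists_pivot X (fun a => μ a h) _ hc (by positivity)
        refine ⟨c₀, h1, h2.trans_lt ?_⟩
        rw [pow_succ] at hX; omega
    obtain ⟨φ₁, b₁, e₁⟩ := ih1 _ hlo
    obtain ⟨φ₂, b₂, e₂⟩ := ih2 (X.filter (fun a => μ a h = c₀))
      ((Finset.card_filter_le _ _).trans_lt hX)
    obtain ⟨φ₃, b₃, e₃⟩ := ih3 _ hhi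
    set l₁ := sepSeq k (h + 1) s with hl₁
    set l₂ := sepSeq (k + 1) h (2 * (h + 1)) with hl₂
    set l₃ := sepSeq k (h + 1) (2 * (h + 1)) with hl₃
    have z₂ : l₂.getD 0 0 = 2 * (h + 1) := sepSeq_getD_zero _ _ _
    have z₃ : l₃.getD 0 0 = 2 * (h + 1) := sepSeq_getD_zero _ _ _
    have z₂₃ : (l₂ ++ l₃).getD 0 0 = 2 * (h + 1) := by
      rw [List.getD_append _ _ _ _ (length_sepSeq_pos _ _ _), z₂]
    have hle : ∀ r, 0 < r → (l₁ ++ (l₂ ++ l₃)).getD r 0 ≤ 2 * (h + 1) := by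
      intro r hr
      have := sepSeq_getD_le (k + 1) (h + 1) s r hr
      rwa [sepSeq] at this
    have hno : ∀ c x y, 2 * (h + 1) ≤ c →
        ¬ Separated (fun r => (l₁ ++ (l₂ ++ l₃)).getD r 0) c x y := by
      rintro c x y hc ⟨r, h1, h2, h3⟩
      have := hle r (by omega)
      simp only at h3
      omega
    have hgt : ∀ c x y, y ≤ x → ¬ Separated (fun r => (l₁ ++ (l₂ ++ l₃)).getD r 0) c x y := by
      rintro c x y hc ⟨r, h1, h2, h3⟩
      omega
    refine ⟨fun a => if μ a h < c₀ then φ₁ a else if μ a h = c₀ then l₁.length + φ₂ a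
      else l₁.length + (l₂.length + φ₃ a), fun a ha => ?_, fun a ha b hb c => ?_⟩
    · rcases lt_trichotomy (μ a h) c₀ with h1 | h1 | h1
      · have := b₁ a (by simp [ha, h1]); simp [h1]; omega
      · have := b₂ a (by simp [ha, h1]); simp [h1]; omega
      · have := b₃ a (by simp [ha, h1]); simp [h1.not_gt, h1.ne']; omega
    · rcases lt_trichotomy (μ a h) c₀ with h1 | h1 | h1 <;>
        rcases lt_trichotomy (μ b h) c₀ with h2 | h2 | h2
      · have := b₁ b (by simp [hb, h2])
        simp only [h1, h2, if_true]
        rw [separated_append_left this]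
        exact e₁ a (by simp [ha, h1]) b (by simp [hb, h2]) c
      · have := b₁ a (by simp [ha, h1])
        simp only [h1, h2, if_true, lt_irrefl, if_false]
        rw [tupleLt_iff_of_last_lt (h2 ▸ h1)]
        exact ⟨fun hs => by by_contra hc; exact hno _ _ _ (by omega) hs,
          fun hc => separated_append_cross this (by omega)⟩
      · have := b₁ a (by simp [ha, h1])
        simp only [h1, if_true, h2.not_gt, h2.ne', if_false]
        rw [tupleLt_iff_of_last_lt (h1.trans h2)]
        exact ⟨fun hs => by by_contra hc; exact hno _ _ _ (by omega) hs,
          fun hc => separated_append_cross this (by omega)⟩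
      · have := b₁ b (by simp [hb, h2])
        simp only [h1, h2, if_true, lt_irrefl, if_false]
        exact iff_of_false (hgt _ _ _ (by omega)) (not_tupleLt_of_last_gt (h1 ▸ h2))
      · simp only [h1, h2, if_true, lt_irrefl, if_false]
        have := b₂ b (by simp [hb, h2])
        rw [separated_append_right, separated_append_left this,
          tupleLt_iff_of_last_eq (h1.trans h2.symm)]
        exact e₂ a (by simp [ha, h1]) b (by simp [hb, h2]) c
      · simp only [h1, lt_irrefl, if_true, h2.not_gt, h2.ne', if_false]
        have := b₂ a (by simp [ha, h1])
        rw [tupleLt_iff_of_last_lt (h1 ▸ h2), separated_append_right]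
        refine ⟨fun hs => ?_, fun hc => separated_append_cross this (by omega)⟩
        by_contra hc
        exact hno c _ _ (by omega) (separated_append_right.2 hs)
      · have := b₁ b (by simp [hb, h2])
        simp only [h1.not_gt, h1.ne', h2, if_true, if_false]
        exact iff_of_false (hgt _ _ _ (by omega)) (not_tupleLt_of_last_gt (h2.trans h1))
      · have := b₂ b (by simp [hb, h2])
        simp only [h1.not_gt, h1.ne', h2, if_true, lt_irrefl, if_false]
        exact iff_of_false (hgt _ _ _ (by omega)) (not_tupleLt_of_last_gt (h2 ▸ h1))
      · simp only [h1.not_gt, h1.ne', h2.not_gt, h2.ne', if_false]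
        rw [separated_append_right, separated_append_right]
        exact e₃ a (by simp [ha, h1]) b (by simp [hb, h2]) c

/-! ### Truncated lexicographic orders -/

theorem exists_last_ne {β : Type*} {f g : ℕ → β} {j h : ℕ} (hne : ∃ i, j ≤ i ∧ i < h ∧ f i ≠ g i) :
    ∃ i, j ≤ i ∧ i < h ∧ f i ≠ g i ∧ ∀ i', i < i' → i' < h → f i' = g i' := by
  induction h with
  | zero => obtain ⟨i, -, h, -⟩ := hne; omega
  | succ h ih =>
    by_cases hh : j ≤ h ∧ f h ≠ g h
    · exact ⟨h, hh.1, by omega, hh.2, by intros; omega⟩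
    · obtain ⟨i, h1, h2, h3⟩ := hne
      have : i ≠ h := by rintro rfl; exact hh ⟨h1, h3⟩
      obtain ⟨i, h1, h2, h3, h4⟩ := ih ⟨i, h1, by omega, h3⟩
      refine ⟨i, h1, by omega, h3, fun i' hi hi' => ?_⟩
      rcases Nat.lt_succ_iff_lt_or_eq.1 hi' with h5 | rfl
      · exact h4 i' hi h5
      · by_contra hc
        exact hh ⟨by omega, hc⟩

section Lex
variable {A : Type*} {μ : A → ℕ → Ordinal.{0}} {h c : ℕ}

/-- The negation of a truncated lexicographic order is transitive. -/
theorem TupleLt.or_of_lt {x z : A} (hxz : TupleLt μ h c x z) (y : A) :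
    TupleLt μ h c x y ∨ TupleLt μ h c y z := by
  obtain ⟨j, hj, hc, hlt, heq⟩ := hxz
  by_cases hne : ∃ i, j ≤ i ∧ i < h ∧ μ x i ≠ μ y i
  · obtain ⟨i, h1, h2, h3, h4⟩ := exists_last_ne hne
    rcases lt_or_gt_of_ne h3 with h5 | h5
    · exact Or.inl ⟨i, h2, by omega, h5, h4⟩
    · refine Or.inr ⟨i, h2, by omega, ?_, fun i' hi hi' => ?_⟩
      · rcases h1.lt_or_eq with h6 | rfl
        · rwa [← heq i h6 h2]
        · exact h5.trans hlt
      · rw [← h4 i' hi hi', heq i' (by omega) hi']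
  · push Not at hne
    refine Or.inr ⟨j, hj, hc, ?_, fun i' hi hi' => ?_⟩
    · rwa [← hne j le_rfl hj]
    · rw [← hne i' hi.le hi', heq i' hi hi']

theorem TupleLt.anti {c' : ℕ} {x y : A} (hc : c' ≤ c) (hlt : TupleLt μ h c x y) :
    TupleLt μ h c' x y := by
  obtain ⟨j, h1, h2, h3⟩ := hlt
  exact ⟨j, h1, by omega, h3⟩

theorem not_tupleLt_of_le {x y : A} (hle : ∀ j < h, c < 2 * (j + 1) → μ y j ≤ μ x j) :
    ¬ TupleLt μ h c x y := by
  rintro ⟨j, h1, h2, h3, -⟩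
  exact absurd h3 (hle j h1 h2).not_gt

theorem tupleLt_of_le_of_lt {x y : A} (hle : ∀ j < h, c < 2 * (j + 1) → μ x j ≤ μ y j)
    (hlt : ∃ j < h, c < 2 * (j + 1) ∧ μ x j < μ y j) : TupleLt μ h c x y := by
  obtain ⟨j, h1, h2, h3⟩ := hlt
  obtain ⟨i, h4, h5, h6, h7⟩ := exists_last_ne ⟨j, le_rfl, h1, h3.ne⟩
  exact ⟨i, h5, by omega, (hle i h5 (by omega)).lt_of_ne h6, h7⟩

variable (μ h) in
theorem wellFounded_tupleLt : WellFounded (TupleLt μ h 0) := by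
  have := Pi.Lex.wellFounded (ι := Fin h) (α := fun _ => Ordinal.{0}) (· > ·)
    (s := fun _ => (· < ·)) (fun _ => wellFounded_lt)
  refine Subrelation.wf ?_ (InvImage.wf (fun a (i : Fin h) => μ a i) this)
  rintro a b ⟨j, hj, -, h1, h2⟩
  exact ⟨⟨j, hj⟩, fun i hi => h2 i hi i.2, h1⟩

end Lex

/-! ### Progress measures from winning strategies -/

namespace ParityGame

variable {V : Type} {d : ℕ} [DecidableEq V] (G : ParityGame V d) (v₀ : V) (σ : G.Strategy)

/-- The path consisting of the first `n` moves of `π` starts in `v₀`, follows the edges, and is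
consistent with the strategy `σ` of Eve. -/
def Consistent (π : ℕ → V) (n : ℕ) : Prop :=
  π 0 = v₀ ∧ ∀ i < n, (π i, π (i + 1)) ∈ G.edges ∧
    (π i ∈ G.eve → π (i + 1) = σ.move ((List.range i).map π) (π i))

/-- A path is encoded by a sequence of vertices together with the number of its moves; the rest of
the sequence is irrelevant. The path `y` extends `x` properly, is consistent with `σ`, and the
largest priority of the vertices left by the additional moves is `q`. -/
def Extends (q : ℕ) (y x : (ℕ → V) × ℕ) : Prop :=
  x.2 < y.2 ∧ (∀ i ≤ x.2, y.1 i = x.1 i) ∧ G.Consistent v₀ σ y.1 y.2 ∧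
    (∀ i, x.2 ≤ i → i < y.2 → G.prio (y.1 i) ≤ q) ∧ ∃ i, x.2 ≤ i ∧ i < y.2 ∧ G.prio (y.1 i) = q

variable {G v₀ σ}

/-- An infinite path all of whose initial segments are consistent with `σ` is a play against some
strategy of Adam. -/
theorem exists_play_eq {π : ℕ → V} (hπ : ∀ n, G.Consistent v₀ σ π n) :
    ∃ τ : G.Strategy, G.play v₀ σ τ = π := by
  choose f hf using G.exists_edge
  let τ : G.Strategy :=
    { move := fun path v => if v = π path.length then π (path.length + 1) else f v
      legal := by
        intro path v
        split_ifs with h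
        · rw [h]; exact ((hπ (path.length + 1)).2 _ (Nat.lt_succ_self _)).1
        · exact hf v }
  have key : ∀ i, G.situation v₀ σ τ i = ((List.range i).map π, π i) := by
    intro i
    induction i with
    | zero => simp [situation, (hπ 0).1]
    | succ i ih =>
      simp only [situation, ih, List.range_succ, List.map_append, List.map_singleton, Prod.mk.injEq,
        true_and]
      split_ifs with h
      · exact (((hπ (i + 1)).2 i (Nat.lt_succ_self _)).2 h).symm
      · simp [τ]
  exact ⟨τ, funext fun i => by simp [play, key]⟩

/-- An infinite chain of extensions would converge to a play consistent with the winning strategy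
`σ` in which the largest priority appearing infinitely often is the odd number `q`. -/
theorem wellFounded_extends (hσ : ∀ τ : G.Strategy, G.Parity (G.play v₀ σ τ)) {q : ℕ}
    (hq : Odd q) : WellFounded (G.Extends v₀ σ q) := by
  rw [wellFounded_iff_isEmpty_descending_chain]
  refine ⟨fun ⟨f, hf⟩ => ?_⟩
  have hlen : ∀ n, n ≤ (f n).2 := by
    intro n
    induction n with
    | zero => exact Nat.zero_le _
    | succ n ih => have := (hf n).1; omega
  have hmono : ∀ n k, (f n).2 ≤ (f (n + k)).2 ∧ ∀ i ≤ (f n).2, (f (n + k)).1 i = (f n).1 i := by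
    intro n k
    induction k with
    | zero => simp
    | succ k ih =>
      have h1 := hf (n + k)
      refine ⟨ih.1.trans h1.1.le, fun i hi => ?_⟩
      rw [← ih.2 i hi]
      exact h1.2.1 i (hi.trans ih.1)
  -- the limit of the chain; the path `f n` has at least `n` moves
  set π : ℕ → V := fun i => (f i).1 i with hπ
  have hag : ∀ n, ∀ i ≤ (f n).2, π i = (f n).1 i := by
    intro n i hi
    rcases le_total i n with h | h
    · obtain ⟨k, rfl⟩ := Nat.exists_eq_add_of_le h
      exact ((hmono i k).2 i (hlen i)).symm
    · obtain ⟨k, rfl⟩ := Nat.exists_eq_add_of_le h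
      exact (hmono n k).2 _ hi
  have hcons : ∀ n, G.Consistent v₀ σ π n := by
    intro n
    have h1 := (hf n).2.2.1
    have h2 := hlen (n + 1)
    refine ⟨(hag (n + 1) 0 (Nat.zero_le _)).trans h1.1, fun i hi => ?_⟩
    have h3 := h1.2 i (by omega)
    have h4 : (List.range i).map π = (List.range i).map (f (n + 1)).1 := by
      refine List.map_congr_left fun j hj => hag _ _ ?_
      have := List.mem_range.1 hj; omega
    rw [hag (n + 1) i (by omega), hag (n + 1) (i + 1) (by omega), h4]
    exact h3
  obtain ⟨τ, hτ⟩ := exists_play_eq hcons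
  obtain ⟨p, ⟨hp, hmax⟩, hev⟩ := hσ τ
  rw [hτ] at hp hmax
  have hle : ∀ i, (f 0).2 ≤ i → G.prio (π i) ≤ q := by
    intro i hi
    have : ∃ n, (f n).2 ≤ i ∧ i < (f (n + 1)).2 := by
      have hex : ∃ n, i < (f (n + 1)).2 := ⟨i, by have := hlen (i + 1); omega⟩
      classical
      refine ⟨Nat.find hex, ?_, Nat.find_spec hex⟩
      rcases hn : Nat.find hex with _ | k
      · exact hi
      · exact not_lt.1 (Nat.find_min hex (m := k) (by omega))
    obtain ⟨n, h1, h2⟩ := this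
    rw [hag (n + 1) i h2.le]
    exact (hf n).2.2.2.1 i h1 h2
  have hfreq : ∃ᶠ i in Filter.atTop, G.prio (π i) = q := by
    rw [Filter.frequently_atTop]
    intro a
    obtain ⟨i, h1, h2, h3⟩ := (hf a).2.2.2.2
    exact ⟨i, (hlen a).trans h1, by rw [hag (a + 1) i h2.le]; exact h3⟩
  have h1 : q ≤ p := hmax hfreq
  have h2 : p ≤ q := by
    obtain ⟨i, h3, h4⟩ := Filter.frequently_atTop.1 hp (f 0).2
    rw [← h4]; exact hle i h3
  have : p = q := le_antisymm h2 h1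
  subst this
  exact (Nat.not_even_iff_odd.2 hq) hev

/-- The condition which a progress measure `μ` imposes on an edge from `v` to `w`: in the order
truncated at the priority of `v`, the measure does not increase, and it decreases if that priority
is odd. -/
def Descends (G : ParityGame V d) (μ : V → ℕ → Ordinal.{0}) (h : ℕ) (v w : V) : Prop :=
  (Odd (G.prio v) → TupleLt μ h (G.prio v) w v) ∧ (Even (G.prio v) → ¬ TupleLt μ h (G.prio v) v w)

/-- If Eve wins from `v₀`, there is a progress measure on a set `R` of vertices containing `v₀`
which Eve need not leave. Every path consistent with the winning strategy is measured by its ranks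
in the relations `Extends`, one for each odd priority, and a vertex by the least tuple of the paths
ending in it. -/
theorem EveWins.exists_measure {h : ℕ} (hd : d = 2 * h) (hwin : G.EveWins v₀) :
    ∃ (R : Set V) (μ : V → ℕ → Ordinal.{0}), v₀ ∈ R ∧ ∀ v ∈ R,
      (v ∈ G.eve → ∃ w, (v, w) ∈ G.edges ∧ w ∈ R ∧ G.Descends μ h v w) ∧
      (v ∉ G.eve → ∀ w, (v, w) ∈ G.edges → w ∈ R ∧ G.Descends μ h v w) := by
  obtain ⟨σ, hσ⟩ := hwin
  have wf : ∀ j, IsWellFounded _ (G.Extends v₀ σ (2 * j + 1)) := fun j =>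
    ⟨wellFounded_extends hσ (odd_two_mul_add_one j)⟩
  let ν : (ℕ → V) × ℕ → ℕ → Ordinal.{0} := fun x j =>
    IsWellFounded.rank (G.Extends v₀ σ (2 * j + 1)) x
  -- the path `x` followed by a move to `w`
  let ext : (ℕ → V) × ℕ → V → (ℕ → V) × ℕ := fun x w =>
    (fun i => if i ≤ x.2 then x.1 i else w, x.2 + 1)
  -- the paths ending in `v`
  let S : V → Set ((ℕ → V) × ℕ) := fun v => {x | G.Consistent v₀ σ x.1 x.2 ∧ x.1 x.2 = v}
  have hext : ∀ v w, ∀ x ∈ S v, (v, w) ∈ G.edges →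
      (v ∈ G.eve → w = σ.move ((List.range x.2).map x.1) v) → ext x w ∈ S w := by
    rintro v w ⟨π, n⟩ ⟨⟨h0, h1⟩, rfl⟩ he hσw
    refine ⟨⟨by simpa [ext] using h0, fun i hi => ?_⟩, by simp [ext]⟩
    simp only [ext] at hi ⊢
    have hmap : (List.range i).map (fun i => if i ≤ n then π i else w) = (List.range i).map π := by
      refine List.map_congr_left fun j hj => if_pos ?_
      have := List.mem_range.1 hj; omega
    rw [hmap, if_pos (by omega)]
    rcases Nat.lt_succ_iff_lt_or_eq.1 hi with h2 | rfl
    · rw [if_pos (by omega)]; exact h1 i h2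
    · rw [if_neg (by omega)]; exact ⟨he, hσw⟩
  -- A path extending `ext x w` extends `x`, with the same largest priority if this is at least that
  -- of the vertex left; hence the rank of `ext x w` is at most that of `x`.
  have hle : ∀ v w, ∀ x ∈ S v, ext x w ∈ S w → ∀ j, G.prio v < 2 * (j + 1) →
      ν (ext x w) j ≤ ν x j := by
    rintro v w ⟨π, n⟩ ⟨hx, rfl⟩ hy j hj
    simp only [ν]
    rw [IsWellFounded.rank_eq]
    refine Ordinal.iSup_le fun ⟨y, hy'⟩ => Order.succ_le_of_lt (IsWellFounded.rank_lt_of_rel ?_)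
    obtain ⟨h1, h2, h3, h4, h5⟩ := hy'
    simp only [ext] at h1 h2 h4 h5
    refine ⟨by simp only; omega, fun i hi => ?_, h3, fun i hi hi' => ?_, ?_⟩
    · simp only at hi
      rw [h2 i (by omega), if_pos hi]
    · simp only at hi
      rcases hi.lt_or_eq with h6 | rfl
      · exact h4 i h6 hi'
      · rw [h2 n (by omega), if_pos le_rfl]
        simp only at hj
        omega
    · obtain ⟨i, h6, h7⟩ := h5
      exact ⟨i, by simp only; omega, h7⟩
  -- If the vertex left has the priority `2 * j + 1`, then `ext x w` itself is such an extension.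
  have hlt : ∀ v w, ∀ x ∈ S v, ext x w ∈ S w → ∀ j, G.prio v = 2 * j + 1 →
      ν (ext x w) j < ν x j := by
    rintro v w ⟨π, n⟩ ⟨hx, rfl⟩ hy j hj
    refine IsWellFounded.rank_lt_of_rel ⟨by simp [ext], fun i hi => if_pos hi, hy.1,
      fun i hi hi' => ?_, n, le_rfl, by simp [ext], by simpa [ext] using hj⟩
    simp only [ext] at hi hi' ⊢
    have : i = n := by omega
    subst this
    simp only at hj
    simp [hj]
  classical
  -- A least tuple in the full lexicographic order is also least in all truncated orders.
  have hmin : ∀ v, (S v).Nonempty → ∃ x ∈ S v, ∀ y ∈ S v, ¬ TupleLt ν h 0 y x := fun v hv =>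
    ⟨_, (wellFounded_tupleLt ν h).min_mem _ hv,
      fun y hy => (wellFounded_tupleLt ν h).not_lt_min _ hy⟩
  choose! b hbS hbmin using hmin
  refine ⟨{v | (S v).Nonempty}, fun v => ν (b v), ⟨(fun _ => v₀, 0), ⟨rfl, by simp⟩, rfl⟩,
    fun v hv => ?_⟩
  have hx := hbS v hv
  have step : ∀ w, ext (b v) w ∈ S w → (S w).Nonempty ∧ G.Descends (fun v => ν (b v)) h v w := by
    intro w hw
    refine ⟨⟨_, hw⟩, fun hodd => ?_, fun _ hcon => ?_⟩
    · obtain ⟨j, hj⟩ := hodd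
      have h1 : TupleLt ν h (G.prio v) (ext (b v) w) (b v) :=
        tupleLt_of_le_of_lt (fun j _ hj => hle v w _ hx hw j hj)
          ⟨j, by have := G.prio_le v; omega, by omega, hlt v w _ hx hw j hj⟩
      rcases h1.or_of_lt (b w) with h2 | h2
      · exact absurd (h2.anti (Nat.zero_le _)) (hbmin w ⟨_, hw⟩ _ hw)
      · exact h2
    · have h1 : TupleLt ν h (G.prio v) (b v) (b w) := hcon
      rcases h1.or_of_lt (ext (b v) w) with h2 | h2
      · exact not_tupleLt_of_le (fun j _ hj => hle v w _ hx hw j hj) h2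
      · exact absurd (h2.anti (Nat.zero_le _)) (hbmin w ⟨_, hw⟩ _ hw)
  refine ⟨fun he => ?_, fun he w hw => ?_⟩
  · have hleg := σ.legal ((List.range (b v).2).map (b v).1) v
    exact ⟨_, hleg, step _ (hext v _ _ hx hleg fun _ => rfl)⟩
  · exact step w (hext v w _ hx hw fun h => absurd h he)

end ParityGame

/-! ### Stable assignments of positions -/

/-- The pair of positions which the value iteration keeps for a vertex of priority `p`, where a
position `r` is called a boundary if `p < L r`. For odd `p`, both are the same boundary. For even
`p` they are consecutive boundaries, enclosing the leaves which agree up to level `p`, except for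
the initial pair of zeros. An edge from `v` to `w` is valid if `lo w < hi v`: if the priority `p` of
`v` is even, this permits `w` to have a leaf in the same block of level `p` as `v`, if `p` is odd it
demands an earlier one. -/
structure IsBlock (L : ℕ → ℕ) (p lo hi : ℕ) : Prop where
  lt_lo : p < L lo
  lt_hi : p < L hi
  eq_of_odd : Odd p → lo = hi
  lt_or_eq_of_even : Even p → lo < hi ∨ lo = 0 ∧ hi = 0
  not_lt_of_even : Even p → ∀ r, lo < r → r < hi → ¬ p < L r

theorem IsBlock.lo_le_lo {L : ℕ → ℕ} {p lo hi lo' hi' : ℕ} (h : IsBlock L p lo hi)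
    (h' : IsBlock L p lo' hi') (hle : hi ≤ hi') : lo ≤ lo' := by
  rcases Nat.even_or_odd p with hp | hp
  · by_contra! hlt
    rcases h.lt_or_eq_of_even hp with h1 | h1
    · exact h'.not_lt_of_even hp lo hlt (by omega) h.lt_lo
    · omega
  · have h1 := h.eq_of_odd hp
    have h2 := h'.eq_of_odd hp
    omega

theorem findGreatest_le_findGreatest {P : ℕ → Prop} [DecidablePred P] {y y' : ℕ} (h0 : P 0)
    (h : ∀ r, y < r → r ≤ y' → ¬ P r) : Nat.findGreatest P y' ≤ Nat.findGreatest P y := by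
  have h1 : P (Nat.findGreatest P y') := Nat.findGreatest_spec (Nat.zero_le _) h0
  refine Nat.le_findGreatest ?_ h1
  by_contra! hlt
  exact h _ hlt (Nat.findGreatest_le _) h1

namespace ParityGame

variable {V : Type} {d : ℕ} (G : ParityGame V d)

/-- The vertex `u` has not reached the top position `N + 1` and violates its condition: for a vertex
of Eve, that some edge leaving it is valid, for a vertex of Adam, that all these edges are valid. -/
def NeedsLift (N : ℕ) (lo hi : V → ℕ) (u : V) : Prop :=
  hi u ≤ N ∧ (u ∈ G.eve → ∀ w, (u, w) ∈ G.edges → hi u ≤ lo w) ∧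
    (u ∉ G.eve → ∃ w, (u, w) ∈ G.edges ∧ hi u ≤ lo w)

/-- A stable assignment of positions: no vertex needs a lift. The position `N + 1` is the top
element, meaning that Eve gives the vertex up. -/
structure IsSolution (L : ℕ → ℕ) (N : ℕ) (lo hi : V → ℕ) : Prop where
  isBlock : ∀ u, IsBlock L (G.prio u) (lo u) (hi u)
  hi_le : ∀ u, hi u ≤ N + 1
  not_needsLift : ∀ u, ¬ G.NeedsLift N lo hi u

variable {G} {L : ℕ → ℕ} {N : ℕ} {lo hi : V → ℕ}

/-- If the pairs `lo`, `hi` are below a solution and `u` needs a lift, then they remain below it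
when `hi u` is increased to the next boundary. -/
theorem IsSolution.next_le {lo' hi' : V → ℕ} (hs : G.IsSolution L N lo' hi')
    (hb : ∀ u, IsBlock L (G.prio u) (lo u) (hi u)) (hle : ∀ u, hi u ≤ hi' u) {u : V}
    (hu : G.NeedsLift N lo hi u) {z : ℕ} (hz : ∀ r, hi u < r → r < z → ¬ G.prio u < L r) :
    z ≤ hi' u := by
  rcases (hle u).lt_or_eq with h1 | h1
  · by_contra! h2
    exact hz _ h1 h2 (hs.isBlock u).lt_hi
  · have hlo : ∀ w, lo w ≤ lo' w := fun w => (hb w).lo_le_lo (hs.isBlock w) (hle w)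
    refine absurd ⟨h1 ▸ hu.1, fun h w hw => ?_, fun h => ?_⟩ (hs.not_needsLift u)
    · exact h1 ▸ (hu.2.1 h w hw).trans (hlo w)
    · obtain ⟨w, hw, h2⟩ := hu.2.2 h
      exact ⟨w, hw, h1 ▸ h2.trans (hlo w)⟩

theorem exists_isGreatest_frequently [Finite V] (G : ParityGame V d) (π : ℕ → V) :
    ∃ p, IsGreatest {q | ∃ᶠ i in Filter.atTop, G.prio (π i) = q} p := by
  have hbdd : BddAbove {q | ∃ᶠ i in Filter.atTop, G.prio (π i) = q} :=
    ⟨d, fun q hq => by obtain ⟨i, rfl⟩ := hq.exists; exact G.prio_le _⟩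
  have hne : {q | ∃ᶠ i in Filter.atTop, G.prio (π i) = q}.Nonempty := by
    by_contra hcon
    rw [Set.not_nonempty_iff_eq_empty, Set.eq_empty_iff_forall_notMem] at hcon
    have h1 : ∀ q ∈ Set.Iic d, ∀ᶠ i in Filter.atTop, G.prio (π i) ≠ q := fun q _ =>
      Filter.not_frequently.1 (hcon q)
    obtain ⟨i, hi⟩ := ((Filter.eventually_all_finite (Set.finite_Iic d)).2 h1).exists
    exact hi _ (G.prio_le _) rfl
  exact ⟨_, Nat.sSup_mem hne hbdd, fun q hq => le_csSup hbdd hq⟩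

/-- Eve wins by always choosing a valid edge. If the largest priority `p` appearing infinitely often
were odd, then from some time on the largest boundary of level `p` not to the right of the current
position would never increase, and decrease at every visit of a vertex of priority `p`. -/
theorem IsSolution.eveWins [Finite V] [DecidableEq V] (hs : G.IsSolution L N lo hi)
    (hL0 : d < L 0) (hLN : d < L N) {v₀ : V} (hv₀ : hi v₀ ≤ N) : G.EveWins v₀ := by
  have hex : ∀ u, ∃ w, (u, w) ∈ G.edges ∧ (u ∈ G.eve → hi u ≤ N → lo w < hi u) := by
    intro u
    by_cases h : u ∈ G.eve ∧ hi u ≤ N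
    · by_contra! hcon
      exact hs.not_needsLift u ⟨h.2, fun _ w hw => (hcon w hw).2.2, fun h' => absurd h.1 h'⟩
    · obtain ⟨w, hw⟩ := G.exists_edge u
      exact ⟨w, hw, fun h1 h2 => absurd ⟨h1, h2⟩ h⟩
  choose f hfe hf using hex
  refine ⟨⟨fun _ v => f v, fun _ v => hfe v⟩, fun τ => ?_⟩
  set π := G.play v₀ ⟨fun _ v => f v, fun _ v => hfe v⟩ τ with hπ
  have hstep : ∀ i, hi (π i) ≤ N → lo (π (i + 1)) < hi (π i) := by
    intro i hi'
    simp only [hπ, play, situation] at hi' ⊢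
    split_ifs with h
    · exact hf _ h hi'
    · by_contra! hcon
      exact hs.not_needsLift _ ⟨hi', fun h' => absurd h' h, fun _ => ⟨_, τ.legal _ _, hcon⟩⟩
  have hN : ∀ i, hi (π i) ≤ N := by
    intro i
    induction i with
    | zero => exact hv₀
    | succ i ih =>
      by_contra! hcon
      have h1 : hi (π (i + 1)) = N + 1 := le_antisymm (hs.hi_le _) hcon
      have h2 := hstep i ih
      have hb := hs.isBlock (π (i + 1))
      rcases Nat.even_or_odd (G.prio (π (i + 1))) with hp | hp
      · exact hb.not_lt_of_even hp N (by omega) (by omega) ((G.prio_le _).trans_lt hLN)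
      · have := hb.eq_of_odd hp
        omega
  obtain ⟨p, hp, hmax⟩ := G.exists_isGreatest_frequently π
  refine ⟨p, ⟨hp, hmax⟩, ?_⟩
  by_contra hodd
  rw [Nat.not_even_iff_odd] at hodd
  have hpd : p ≤ d := by obtain ⟨i, rfl⟩ := hp.exists; exact G.prio_le _
  obtain ⟨a, ha⟩ : ∃ a, ∀ i ≥ a, G.prio (π i) ≤ p := by
    have h1 : ∀ q ∈ Set.Ioc p d, ∀ᶠ i in Filter.atTop, G.prio (π i) ≠ q := fun q hq =>
      Filter.not_frequently.1 fun h => absurd (hmax h) (not_le.2 hq.1)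
    obtain ⟨a, ha⟩ := Filter.eventually_atTop.1
      ((Filter.eventually_all_finite (Set.finite_Ioc p d)).2 h1)
    refine ⟨a, fun i hi => ?_⟩
    by_contra! hcon
    exact ha i hi _ ⟨hcon, G.prio_le _⟩ rfl
  -- the largest boundary of level `p` not to the right of the position `lo (π i)`
  let g : ℕ → ℕ := fun i => Nat.findGreatest (fun r => p < L r) (lo (π i))
  have hp0 : p < L 0 := hpd.trans_lt hL0
  have hle : ∀ i ≥ a, g (i + 1) ≤ g i := by
    intro i hia
    refine findGreatest_le_findGreatest hp0 fun r h1 h2 h3 => ?_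
    have hb := hs.isBlock (π i)
    have h4 := hstep i (hN i)
    have h5 := ha i hia
    rcases Nat.even_or_odd (G.prio (π i)) with hpar | hpar
    · exact hb.not_lt_of_even hpar r h1 (by omega) (by omega)
    · have := hb.eq_of_odd hpar
      omega
  have hlt : ∀ i, G.prio (π i) = p → g (i + 1) < g i := by
    intro i hip
    have hb := hs.isBlock (π i)
    have h1 := hb.eq_of_odd (hip ▸ hodd)
    have h2 : lo (π i) ≤ g i := Nat.le_findGreatest le_rfl (hip ▸ hb.lt_lo)
    have h3 : g (i + 1) ≤ lo (π (i + 1)) := Nat.findGreatest_le _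
    have h4 := hstep i (hN i)
    omega
  -- Past a minimum of `g` no further vertex of priority `p` can be visited.
  obtain ⟨i₀, hi₀, hmin⟩ : ∃ i₀ ≥ a, ∀ i ≥ a, g i₀ ≤ g i := by
    have hne : (Set.Ici a).Nonempty := ⟨a, Set.self_mem_Ici⟩
    exact ⟨Function.argminOn g (Set.Ici a) hne, Function.argminOn_mem g _ hne,
      fun i hi => Function.argminOn_le g _ hi⟩
  obtain ⟨i, hi1, hi2⟩ := Filter.frequently_atTop.1 hp i₀
  have hconst : ∀ k, g (i₀ + k) ≤ g i₀ := by
    intro k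
    induction k with
    | zero => simp
    | succ k ih => have := hle (i₀ + k) (by omega); rw [← add_assoc]; omega
  obtain ⟨k, rfl⟩ := Nat.exists_eq_add_of_le hi1
  have h1 := hlt _ hi2
  have h2 := hconst k
  have h3 := hmin (i₀ + k + 1) (by omega)
  omega

/-- The numbers of the leaves, followed by two sentinels: position `leaves k d` is the end of the
last block, and `leaves k d + 1` is the top element. -/
def separators (k d : ℕ) (r : ℕ) : ℕ :=
  (sepSeq k (d / 2) (d + 2) ++ [d + 2, d + 2]).getD r 0

/-- The number of leaves of the universal tree. -/
def leaves (k d : ℕ) : ℕ := (sepSeq k (d / 2) (d + 2)).length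

theorem separators_zero (k d : ℕ) : separators k d 0 = d + 2 := by
  rw [separators, List.getD_append _ _ _ _ (length_sepSeq_pos _ _ _), sepSeq_getD_zero]

theorem separators_leaves (k d : ℕ) : separators k d (leaves k d) = d + 2 := by
  rw [separators, leaves, List.getD_append_right _ _ _ _ le_rfl]; simp

theorem separators_leaves_add_one (k d : ℕ) : separators k d (leaves k d + 1) = d + 2 := by
  rw [separators, leaves, List.getD_append_right _ _ _ _ (by omega)]; simp

/-- If Eve wins from `v₀`, some solution does not assign the top element to `v₀`. A vertex measured
by the leaf `x` gets the block around `x` if its priority is even, and the last boundary not to the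
right of `x` if its priority is odd. -/
theorem EveWins.exists_isSolution [Fintype V] [DecidableEq V] {v₀ : V} (hd : Even d)
    (hwin : G.EveWins v₀) {k : ℕ} (hk : Fintype.card V < 2 ^ (k + 1)) :
    ∃ lo hi : V → ℕ, G.IsSolution (separators k d) (leaves k d) lo hi ∧ hi v₀ ≤ leaves k d := by
  classical
  obtain ⟨R, μ, hv₀, hR⟩ := hwin.exists_measure (h := d / 2) (by
    obtain ⟨e, rfl⟩ := hd; omega)
  obtain ⟨φ, hφ, hemb⟩ := exists_embedding μ k (d / 2) (d + 2) (Finset.univ.filter (· ∈ R))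
    ((Finset.card_filter_le _ _).trans_lt hk)
  simp only [Finset.mem_filter, Finset.mem_univ, true_and] at hφ hemb
  replace hemb : ∀ a ∈ R, ∀ b ∈ R, ∀ c,
      (Separated (separators k d) c (φ a) (φ b) ↔ TupleLt μ (d / 2) c a b) := by
    intro a ha b hb c
    rw [← hemb a ha b hb c]
    exact separated_append_left (hφ b hb)
  set L := separators k d with hL
  set N := leaves k d with hN
  have L0 : L 0 = d + 2 := separators_zero k d
  have LN : L N = d + 2 := separators_leaves k d
  have LN1 : L (N + 1) = d + 2 := separators_leaves_add_one k d
  have hex : ∀ v, ∃ lo hi, IsBlock L (G.prio v) lo hi ∧ hi ≤ N + 1 ∧ (v ∉ R → hi = N + 1) ∧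
      (v ∈ R → lo ≤ φ v ∧ hi ≤ N ∧ (Even (G.prio v) → φ v < hi) ∧
        (Odd (G.prio v) → ∀ r ≤ φ v, G.prio v < L r → r ≤ hi)) := by
    intro v
    have hc := G.prio_le v
    by_cases hv : v ∈ R
    · have hφv : φ v < N := hφ v hv
      have hlo : G.prio v < L (Nat.findGreatest (fun r => G.prio v < L r) (φ v)) :=
        Nat.findGreatest_spec (P := fun r => G.prio v < L r) (Nat.zero_le _) (by omega)
      have hle : Nat.findGreatest (fun r => G.prio v < L r) (φ v) ≤ φ v := Nat.findGreatest_le _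
      rcases Nat.even_or_odd (G.prio v) with hp | hp
      · have hnext : ∃ r, φ v < r ∧ G.prio v < L r := ⟨N, hφv, by omega⟩
        have h1 := Nat.find_spec hnext
        have h2 : Nat.find hnext ≤ N := Nat.find_min' hnext ⟨hφv, by omega⟩
        refine ⟨_, Nat.find hnext, ⟨hlo, h1.2, fun h => absurd hp (Nat.not_even_iff_odd.2 h),
          fun _ => Or.inl (by omega), fun _ r h3 h4 h5 => ?_⟩, by omega, fun h => absurd hv h,
          fun _ => ⟨hle, h2, fun _ => h1.1, fun h => absurd hp (Nat.not_even_iff_odd.2 h)⟩⟩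
        rcases le_or_gt r (φ v) with h6 | h6
        · exact absurd (Nat.le_findGreatest (P := fun r => G.prio v < L r) h6 h5) (by omega)
        · exact Nat.find_min hnext h4 ⟨h6, h5⟩
      · exact ⟨_, _, ⟨hlo, hlo, fun _ => rfl, fun h => absurd h (Nat.not_even_iff_odd.2 hp),
          fun h => absurd h (Nat.not_even_iff_odd.2 hp)⟩, by omega, fun h => absurd hv h,
          fun _ => ⟨hle, by omega, fun h => absurd h (Nat.not_even_iff_odd.2 hp),
          fun _ r h1 h2 => Nat.le_findGreatest h1 h2⟩⟩
    · rcases Nat.even_or_odd (G.prio v) with hp | hp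
      · exact ⟨N, N + 1, ⟨by omega, by omega, fun h => absurd hp (Nat.not_even_iff_odd.2 h),
          fun _ => Or.inl (by omega), fun _ r h3 h4 => by omega⟩, le_rfl, fun _ => rfl,
          fun h => absurd h hv⟩
      · exact ⟨N + 1, N + 1, ⟨by omega, by omega, fun _ => rfl,
          fun h => absurd h (Nat.not_even_iff_odd.2 hp),
          fun h => absurd h (Nat.not_even_iff_odd.2 hp)⟩, le_rfl, fun _ => rfl,
          fun h => absurd h hv⟩
  choose lo hi hblock hhi htop hin using hex
  have hvalid : ∀ v ∈ R, ∀ w ∈ R, G.Descends μ (d / 2) v w → lo w < hi v := by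
    intro v hv w hw hdesc
    have h1 := hin v hv
    have h2 := (hin w hw).1
    rcases Nat.even_or_odd (G.prio v) with hp | hp
    · have h3 := hdesc.2 hp
      rw [← hemb v hv w hw] at h3
      by_contra! hcon
      exact h3 ⟨hi v, h1.2.2.1 hp, by omega, (hblock v).lt_hi⟩
    · have h3 := hdesc.1 hp
      rw [← hemb w hw v hv] at h3
      obtain ⟨r, h4, h5, h6⟩ := h3
      have := h1.2.2.2 hp r h5 h6
      omega
  refine ⟨lo, hi, ⟨hblock, hhi, fun u hu => ?_⟩, (hin v₀ hv₀).2.1⟩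
  have huR : u ∈ R := by
    by_contra h
    have := htop u h
    have := hu.1
    omega
  by_cases hue : u ∈ G.eve
  · obtain ⟨w, hw, hwR, hdesc⟩ := (hR u huR).1 hue
    have := hu.2.1 hue w hw
    have := hvalid u huR w hwR hdesc
    omega
  · obtain ⟨w, hw, hle⟩ := hu.2.2 hue
    obtain ⟨hwR, hdesc⟩ := (hR u huR).2 hue w hw
    have := hvalid u huR w hwR hdesc
    omega

end ParityGame

/-! ### A structured programming language -/

namespace Imp

/-- The variables of the algorithm. -/
inductive Var where
  | out | pos | lim | pow | log | sp | itemK | itemH | itemS | leaves | head | tail | vert | old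
  | new | prio | edge | src | tgt
  deriving DecidableEq

/-- The arrays of the algorithm. Their entries are `0` initially. -/
inductive Arr where
  | even | stackK | stackH | stackS | sep | base | deg | thr | adj | queue | hi | lo | flag | cnt
  deriving DecidableEq

/-- The variable `v` is kept in register `2 * v.code`; in particular `out` in register `0`. -/
def Var.code : Var → ℕ
  | out => 0 | pos => 1 | lim => 2 | pow => 3 | log => 4 | sp => 5 | itemK => 6 | itemH => 7
  | itemS => 8 | leaves => 9 | head => 10 | tail => 11 | vert => 12 | old => 13 | new => 14
  | prio => 15 | edge => 16 | src => 17 | tgt => 18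

/-- The arrays are interleaved in the memory; this is the offset of an array. -/
def Arr.code : Arr → ℕ
  | even => 0 | stackK => 1 | stackH => 2 | stackS => 3 | sep => 4 | base => 5 | deg => 6
  | thr => 7 | adj => 8 | queue => 9 | hi => 10 | lo => 11 | flag => 12 | cnt => 13

theorem Var.code_injective : Function.Injective Var.code := by
  intro a b h; cases a <;> cases b <;> first | rfl | (exact absurd h (by decide))

theorem Arr.code_injective : Function.Injective Arr.code := by
  intro a b h; cases a <;> cases b <;> first | rfl | (exact absurd h (by decide))

theorem Arr.code_lt (j : Arr) : j.code < 16 := by cases j <;> decide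

/-- Expressions, evaluating to natural numbers. The subtraction is truncated, `arr j a` is an array
entry, and `inp a` is a cell of the input word. -/
inductive Expr where
  | var (v : Var)
  | lit (k : ℕ)
  | add (a b : Expr)
  | sub (a b : Expr)
  | arr (j : Arr) (a : Expr)
  | inp (a : Expr)

instance : Coe Var Expr := ⟨Expr.var⟩
instance : CoeFun Arr (fun _ => Expr → Expr) := ⟨Expr.arr⟩
instance (k : ℕ) : OfNat Expr k := ⟨Expr.lit k⟩
instance : Add Expr := ⟨Expr.add⟩
instance : Sub Expr := ⟨Expr.sub⟩

/-- Commands of a small structured language. The conditions of `ite a b P Q` and `while a b P` are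
`a < b`. -/
inductive Cmd where
  | skip
  | set (v : Var) (a : Expr)
  | store (j : Arr) (a b : Expr)
  | seq (P Q : Cmd)
  | ite (a b : Expr) (P Q : Cmd)
  | while (a b : Expr) (P : Cmd)

/-- Sequential composition. -/
def Cmd.block : List Cmd → Cmd
  | [] => skip
  | P :: l => seq P (block l)

/-- A state of an execution; `time` is the number of loop iterations carried out so far. -/
structure State where
  reg : Var → ℕ
  arr : Arr → ℕ → ℕ
  time : ℕ

namespace State

/-- Assign a value to a variable. -/
def setReg (s : State) (v : Var) (x : ℕ) : State := { s with reg := Function.update s.reg v x }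

/-- Assign a value to an array entry. -/
def setArr (s : State) (j : Arr) (i x : ℕ) : State :=
  { s with arr := Function.update s.arr j (Function.update (s.arr j) i x) }

/-- Count a loop iteration. -/
def tick (s : State) : State := { s with time := s.time + 1 }

variable (s : State) (v v' : Var) (j j' : Arr) (i x : ℕ)

@[simp] theorem setReg_reg : (s.setReg v x).reg v' = if v' = v then x else s.reg v' := by
  simp [setReg, Function.update_apply]
@[simp] theorem setReg_arr : (s.setReg v x).arr = s.arr := rfl
@[simp] theorem setReg_time : (s.setReg v x).time = s.time := rfl
@[simp] theorem setArr_reg : (s.setArr j i x).reg = s.reg := rfl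
@[simp] theorem setArr_arr : (s.setArr j i x).arr j' =
    if j' = j then Function.update (s.arr j) i x else s.arr j' := by
  simp only [setArr, Function.update_apply]
@[simp] theorem setArr_time : (s.setArr j i x).time = s.time := rfl
@[simp] theorem tick_reg : s.tick.reg = s.reg := rfl
@[simp] theorem tick_arr : s.tick.arr = s.arr := rfl
@[simp] theorem tick_time : s.tick.time = s.time + 1 := rfl

end State

/-- What remains fixed during an execution: the input word, its length, and a strict upper bound for
all numbers that may occur. -/
structure Context where
  bound : ℕ
  len : ℕ
  inp : ℕ → ℕ
  len_le : len ≤ bound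
  inp_lt : ∀ a < len, inp a < bound

variable (K : Context)

namespace Expr

/-- The value of an expression. -/
def eval (s : State) : Expr → ℕ
  | var v => s.reg v
  | lit k => k
  | add a b => a.eval s + b.eval s
  | sub a b => a.eval s - b.eval s
  | arr j a => s.arr j (a.eval s)
  | inp a => K.inp (a.eval s)

/-- The evaluation of an expression stays below the bound and within the input word. Entries of
arrays and variables need no condition, as only values of legal expressions are assigned to them. -/
def Ok (s : State) : Expr → Prop
  | var _ => True
  | lit k => k < K.bound
  | add a b => a.Ok s ∧ b.Ok s ∧ a.eval K s + b.eval K s < K.bound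
  | sub a b => a.Ok s ∧ b.Ok s
  | arr _ a => a.Ok s
  | inp a => a.Ok s ∧ a.eval K s < K.len

variable (s : State) (a b : Expr) (j : Arr) (v : Var)

@[simp] theorem eval_var : eval K s (v : Expr) = s.reg v := rfl
@[simp] theorem eval_zero : eval K s (0 : Expr) = 0 := rfl
@[simp] theorem eval_one : eval K s (1 : Expr) = 1 := rfl
@[simp] theorem eval_two : eval K s (2 : Expr) = 2 := rfl
@[simp] theorem eval_three : eval K s (3 : Expr) = 3 := rfl
@[simp] theorem eval_four : eval K s (4 : Expr) = 4 := rfl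
@[simp] theorem eval_five : eval K s (5 : Expr) = 5 := rfl
@[simp] theorem eval_add : eval K s (a + b) = a.eval K s + b.eval K s := rfl
@[simp] theorem eval_sub : eval K s (a - b) = a.eval K s - b.eval K s := rfl
@[simp] theorem eval_arr : eval K s (j a) = s.arr j (a.eval K s) := rfl
@[simp] theorem eval_inp : eval K s (inp a) = K.inp (a.eval K s) := rfl
@[simp] theorem ok_var : Ok K s (v : Expr) ↔ True := Iff.rfl
@[simp] theorem ok_zero : Ok K s (0 : Expr) ↔ 0 < K.bound := Iff.rfl
@[simp] theorem ok_one : Ok K s (1 : Expr) ↔ 1 < K.bound := Iff.rfl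
@[simp] theorem ok_two : Ok K s (2 : Expr) ↔ 2 < K.bound := Iff.rfl
@[simp] theorem ok_three : Ok K s (3 : Expr) ↔ 3 < K.bound := Iff.rfl
@[simp] theorem ok_four : Ok K s (4 : Expr) ↔ 4 < K.bound := Iff.rfl
@[simp] theorem ok_five : Ok K s (5 : Expr) ↔ 5 < K.bound := Iff.rfl
@[simp] theorem ok_add : Ok K s (a + b) ↔
    a.Ok K s ∧ b.Ok K s ∧ a.eval K s + b.eval K s < K.bound := Iff.rfl
@[simp] theorem ok_sub : Ok K s (a - b) ↔ a.Ok K s ∧ b.Ok K s := Iff.rfl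
@[simp] theorem ok_arr : Ok K s (j a) ↔ a.Ok K s := Iff.rfl
@[simp] theorem ok_inp : Ok K s (inp a) ↔ a.Ok K s ∧ a.eval K s < K.len := Iff.rfl

end Expr

/-- `Run K P s s'`: started in `s`, the command `P` halts in `s'`, and all expressions evaluated on
the way are legal. -/
inductive Run : Cmd → State → State → Prop
  | skip (s : State) : Run .skip s s
  | set {v : Var} {a : Expr} {s : State} (ha : a.Ok K s) :
      Run (.set v a) s (s.setReg v (a.eval K s))
  | store {j : Arr} {a b : Expr} {s : State} (ha : a.Ok K s) (hb : b.Ok K s) :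
      Run (.store j a b) s (s.setArr j (a.eval K s) (b.eval K s))
  | seq {P Q : Cmd} {s s' s'' : State} : Run P s s' → Run Q s' s'' → Run (.seq P Q) s s''
  | ite_true {a b : Expr} {P Q : Cmd} {s s' : State} (ha : a.Ok K s) (hb : b.Ok K s) :
      a.eval K s < b.eval K s → Run P s s' → Run (.ite a b P Q) s s'
  | ite_false {a b : Expr} {P Q : Cmd} {s s' : State} (ha : a.Ok K s) (hb : b.Ok K s) :
      ¬ a.eval K s < b.eval K s → Run Q s s' → Run (.ite a b P Q) s s'
  | while_done {a b : Expr} {P : Cmd} {s : State} (ha : a.Ok K s) (hb : b.Ok K s) :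
      ¬ a.eval K s < b.eval K s → Run (.while a b P) s s
  | while_step {a b : Expr} {P : Cmd} {s s' s'' : State} (ha : a.Ok K s) (hb : b.Ok K s) :
      a.eval K s < b.eval K s → Run P s.tick s' → Run (.while a b P) s' s'' →
      Run (.while a b P) s s''

/-- The command `P`, started in `s`, halts legally in a state satisfying `Q`. -/
def Wp (P : Cmd) (Q : State → Prop) (s : State) : Prop := ∃ s', Run K P s s' ∧ Q s'

namespace Cmd

/-- Whether a command contains an assignment to a variable. -/
def writes : Cmd → Var → Bool
  | skip, _ => false
  | set v _, v' => v' = v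
  | store _ _ _, _ => false
  | seq P Q, v' => P.writes v' || Q.writes v'
  | ite _ _ P Q, v' => P.writes v' || Q.writes v'
  | .while _ _ P, v' => P.writes v'

/-- Whether a command contains an assignment to an entry of an array. -/
def stores : Cmd → Arr → Bool
  | skip, _ => false
  | set _ _, _ => false
  | store j _ _, j' => j' = j
  | seq P Q, v' => P.stores v' || Q.stores v'
  | ite _ _ P Q, v' => P.stores v' || Q.stores v'
  | .while _ _ P, v' => P.stores v'

end Cmd

/-- The states agree in everything which `P` does not assign to. -/
structure Agree (P : Cmd) (s s' : State) : Prop where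
  reg : ∀ {v}, P.writes v = false → s'.reg v = s.reg v
  arr : ∀ {j}, P.stores j = false → s'.arr j = s.arr j

variable {K}

theorem Agree.refl (P : Cmd) (s : State) : Agree P s s := ⟨fun _ => rfl, fun _ => rfl⟩

theorem Agree.trans {P : Cmd} {s s' s'' : State} (h : Agree P s s') (h' : Agree P s' s'') :
    Agree P s s'' :=
  ⟨fun hv => (h'.reg hv).trans (h.reg hv), fun hv => (h'.arr hv).trans (h.arr hv)⟩

theorem Run.agree {P : Cmd} {s s' : State} (h : Run K P s s') : Agree P s s' := by
  induction h with
  | skip => exact Agree.refl _ _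
  | set => constructor <;> simp +contextual [Cmd.writes]
  | store => constructor <;> simp +contextual [Cmd.stores]
  | seq _ _ ih1 ih2 | while_step _ _ _ _ _ ih1 ih2 =>
    constructor <;> simp +contextual [Cmd.writes, Cmd.stores, ih1.reg, ih2.reg, ih1.arr, ih2.arr]
  | ite_true _ _ _ _ ih | ite_false _ _ _ _ ih =>
    constructor <;> simp +contextual [Cmd.writes, Cmd.stores, ih.reg, ih.arr]
  | while_done => exact Agree.refl _ _

theorem Run.time_le {P : Cmd} {s s' : State} (h : Run K P s s') : s.time ≤ s'.time := by
  induction h with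
  | skip | set | store | while_done => exact le_rfl
  | seq _ _ ih1 ih2 => exact ih1.trans ih2
  | while_step _ _ _ _ _ ih1 ih2 => simp only [State.tick_time] at ih1; omega
  | ite_true _ _ _ _ ih | ite_false _ _ _ _ ih => exact ih

theorem Wp.mono {P : Cmd} {Q Q' : State → Prop} {s : State} (h : Wp K P Q s)
    (hQ : ∀ s', Agree P s s' → Q s' → Q' s') : Wp K P Q' s := by
  obtain ⟨s', h1, h2⟩ := h
  exact ⟨s', h1, hQ s' h1.agree h2⟩

@[simp] theorem wp_skip {Q : State → Prop} {s : State} : Wp K .skip Q s ↔ Q s := by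
  constructor
  · rintro ⟨s', h, hQ⟩; cases h; exact hQ
  · exact fun h => ⟨s, .skip s, h⟩

@[simp] theorem wp_set {v : Var} {a : Expr} {Q : State → Prop} {s : State} :
    Wp K (.set v a) Q s ↔ a.Ok K s ∧ Q (s.setReg v (a.eval K s)) := by
  constructor
  · rintro ⟨s', h, hQ⟩; cases h with | set ha => exact ⟨ha, hQ⟩
  · exact fun h => ⟨_, .set h.1, h.2⟩

@[simp] theorem wp_store {j : Arr} {a b : Expr} {Q : State → Prop} {s : State} :
    Wp K (.store j a b) Q s ↔
      a.Ok K s ∧ b.Ok K s ∧ Q (s.setArr j (a.eval K s) (b.eval K s)) := by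
  constructor
  · rintro ⟨s', h, hQ⟩; cases h with | store ha hb => exact ⟨ha, hb, hQ⟩
  · exact fun h => ⟨_, .store h.1 h.2.1, h.2.2⟩

@[simp] theorem wp_seq {P P' : Cmd} {Q : State → Prop} :
    Wp K (.seq P P') Q = Wp K P (Wp K P' Q) := by
  refine funext fun s => propext ⟨?_, ?_⟩
  · rintro ⟨s', h, hQ⟩; cases h with | seq h1 h2 => exact ⟨_, h1, _, h2, hQ⟩
  · rintro ⟨s', h1, s'', h2, hQ⟩; exact ⟨_, .seq h1 h2, hQ⟩

@[simp] theorem wp_block_nil {Q : State → Prop} : Wp K (.block []) Q = Q :=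
  funext fun _ => propext wp_skip

@[simp] theorem wp_block_cons {P : Cmd} {l : List Cmd} {Q : State → Prop} :
    Wp K (.block (P :: l)) Q = Wp K P (Wp K (.block l) Q) := wp_seq

@[simp] theorem wp_ite {a b : Expr} {P P' : Cmd} {Q : State → Prop} {s : State} :
    Wp K (.ite a b P P') Q s ↔ a.Ok K s ∧ b.Ok K s ∧
      (a.eval K s < b.eval K s → Wp K P Q s) ∧ (¬ a.eval K s < b.eval K s → Wp K P' Q s) := by
  constructor
  · rintro ⟨s', h, hQ⟩
    cases h with
    | ite_true ha hb hlt h => exact ⟨ha, hb, fun _ => ⟨_, h, hQ⟩, fun h => absurd hlt h⟩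
    | ite_false ha hb hlt h => exact ⟨ha, hb, fun h => absurd h hlt, fun _ => ⟨_, h, hQ⟩⟩
  · rintro ⟨ha, hb, h1, h2⟩
    by_cases hlt : a.eval K s < b.eval K s
    · obtain ⟨s', h, hQ⟩ := h1 hlt
      exact ⟨s', .ite_true ha hb hlt h, hQ⟩
    · obtain ⟨s', h, hQ⟩ := h2 hlt
      exact ⟨s', .ite_false ha hb hlt h, hQ⟩

/-- The rule for loops. Since every iteration is counted in the state, an invariant which bounds the
time also yields termination. -/
theorem wp_while {a b : Expr} {P : Cmd} {Q : State → Prop} {s : State} (I : State → Prop) (T : ℕ)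
    (h0 : I s) (hT : ∀ s', I s' → s'.time ≤ T)
    (hok : ∀ s', Agree P s s' → I s' → a.Ok K s' ∧ b.Ok K s')
    (step : ∀ s', Agree P s s' → I s' → a.eval K s' < b.eval K s' → Wp K P I s'.tick)
    (done : ∀ s', Agree P s s' → I s' → ¬ a.eval K s' < b.eval K s' → Q s') :
    Wp K (.while a b P) Q s := by
  suffices H : ∀ n s', Agree P s s' → I s' → T - s'.time = n → Wp K (.while a b P) Q s' from
    H _ s (Agree.refl _ _) h0 rfl
  intro n
  induction n using Nat.strong_induction_on with
  | _ n ih =>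
    rintro s' hag hI rfl
    obtain ⟨ha, hb⟩ := hok s' hag hI
    by_cases hlt : a.eval K s' < b.eval K s'
    · obtain ⟨s1, h1, hI1⟩ := step s' hag hI hlt
      have h2 := h1.time_le
      simp only [State.tick_time] at h2
      have h3 := hT _ hI1
      have hag' : Agree P s' s1 := ⟨fun h => h1.agree.reg h, fun h => h1.agree.arr h⟩
      obtain ⟨s2, h4, h5⟩ := ih (T - s1.time) (by omega) s1 (hag.trans hag') hI1 rfl
      exact ⟨s2, .while_step ha hb hlt h1 h4, h5⟩
    · exact ⟨s', .while_done ha hb hlt, done s' hag hI hlt⟩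

/-! ### Compilation to machine code -/

/-- The registers for intermediate results. They have odd numbers, and register `1` is reserved for
the length of the input word. -/
def temp (i : ℕ) : ℕ := 2 * i + 3

/-- Replaces the index `x` in the register `temp i` by the address `K.len + 16 * x + j.code` of an
entry of the array `j`. -/
def addressCode (j : Arr) (i : ℕ) : RAM.Program :=
  let dbl := RAM.Program.instr (.add (temp i) (temp i) (temp i))
  .seq dbl (.seq dbl (.seq dbl (.seq dbl (.seq (.instr (.add (temp i) (temp i) 1))
    (.seq (.instr (.const (temp (i + 1)) j.code))
      (.instr (.add (temp i) (temp i) (temp (i + 1)))))))))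

/-- Machine code which evaluates an expression into the register `temp i`, without changing the
registers `temp i'` for `i' < i`. -/
def Expr.compile : Expr → ℕ → RAM.Program
  | var v, i => .seq (.instr (.const (temp i) 0)) (.instr (.add (temp i) (temp i) (2 * v.code)))
  | lit k, i => .instr (.const (temp i) k)
  | add a b, i => .seq (a.compile i) (.seq (b.compile (i + 1))
      (.instr (.add (temp i) (temp i) (temp (i + 1)))))
  | sub a b, i => .seq (a.compile i) (.seq (b.compile (i + 1))
      (.instr (.sub (temp i) (temp i) (temp (i + 1)))))
  | arr j a, i => .seq (a.compile i) (.seq (addressCode j i) (.instr (.load (temp i) (temp i))))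
  | inp a, i => .seq (a.compile i) (.instr (.load (temp i) (temp i)))

/-- The number of machine instructions of a compiled expression. -/
def Expr.size : Expr → ℕ
  | var _ => 2
  | lit _ => 1
  | add a b => a.size + b.size + 1
  | sub a b => a.size + b.size + 1
  | arr _ a => a.size + 8
  | inp a => a.size + 1

/-- Machine code evaluating two expressions in order to compare them. -/
def compilePair (a b : Expr) : RAM.Program := .seq (a.compile 0) (b.compile 1)

/-- Machine code for a command. -/
def Cmd.compile : Cmd → RAM.Program
  | skip => .instr (.const (temp 0) 0)
  | set v a => .seq (a.compile 0) (.seq (.instr (.const (2 * v.code) 0))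
      (.instr (.add (2 * v.code) (2 * v.code) (temp 0))))
  | store j a b => .seq (a.compile 0) (.seq (addressCode j 0) (.seq (b.compile 1)
      (.instr (.store (temp 0) (temp 1)))))
  | seq P Q => .seq P.compile Q.compile
  | ite a b P Q => .seq (compilePair a b) (.branch (temp 0) (temp 1) P.compile Q.compile)
  | .while a b P => .seq (compilePair a b)
      (.loop (temp 0) (temp 1) (.seq P.compile (compilePair a b)))

/-- The number of machine instructions of a compiled command. The condition of a loop is counted
once, although its code occurs both before the loop and at the end of its body. -/
def Cmd.size : Cmd → ℕ
  | skip => 1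
  | set _ a => a.size + 2
  | store _ a b => a.size + b.size + 8
  | seq P Q => P.size + Q.size
  | ite a b P Q => a.size + b.size + 1 + P.size + Q.size
  | .while a b P => a.size + b.size + 1 + P.size

variable (K) in
/-- The machine state `σ` represents the state `s`. -/
structure Sim (s : State) (σ : RAM.State) : Prop where
  reg : ∀ v : Var, σ.reg (2 * v.code) = s.reg v
  base : σ.reg 1 = K.len
  arr : ∀ (j : Arr) i, σ.mem (K.len + 16 * i + j.code) = s.arr j i
  inp : ∀ a < K.len, σ.mem a = K.inp a
  reg_lt : ∀ v, s.reg v < K.bound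
  arr_lt : ∀ j i, s.arr j i < K.bound

theorem Sim.of_temp {s : State} {σ σ' : RAM.State} (h : Sim K s σ) (hm : σ'.mem = σ.mem)
    (hr : ∀ r, (∀ i, r ≠ temp i) → σ'.reg r = σ.reg r) : Sim K s σ' where
  reg v := by rw [hr _ (by intro i; simp only [temp]; omega)]; exact h.reg v
  base := by rw [hr _ (by intro i; simp only [temp]; omega)]; exact h.base
  arr := by rw [hm]; exact h.arr
  inp := by rw [hm]; exact h.inp
  reg_lt := h.reg_lt
  arr_lt := h.arr_lt

variable (K) in
/-- A bound for the cost of a single machine instruction. Addresses may exceed `K.bound` by a factor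
of less than `32`. -/
def Context.unit : ℕ := 11 + 2 * Nat.size K.bound

theorem size_le_of_lt {x : ℕ} (h : x < 32 * K.bound) : Nat.size x ≤ Nat.size K.bound + 5 := by
  rw [Nat.size_le, pow_add]
  have := Nat.lt_size_self K.bound
  omega

/-- Started in `σ`, the machine code `P` halts within time `T` in a state satisfying `R`. -/
def Reaches (P : RAM.Program) (T : ℕ) (R : RAM.State → Prop) (σ : RAM.State) : Prop :=
  ∃ t σ', RAM.Exec P σ t σ' ∧ t ≤ T ∧ R σ'

theorem Reaches.seq {P Q : RAM.Program} {T T' : ℕ} {R R' : RAM.State → Prop} {σ : RAM.State}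
    (h : Reaches P T R σ) (h' : ∀ σ', R σ' → Reaches Q T' R' σ') :
    Reaches (.seq P Q) (T + T') R' σ := by
  obtain ⟨t, σ', h1, h2, h3⟩ := h
  obtain ⟨t', σ'', h4, h5, h6⟩ := h' σ' h3
  exact ⟨_, _, .seq h1 h4, by omega, h6⟩

theorem reaches_instr {i : RAM.Instr} {R : RAM.State → Prop} {σ : RAM.State}
    (hc : i.cost σ ≤ K.unit) (h : R (i.run σ)) : Reaches (.instr i) K.unit R σ :=
  ⟨_, _, .instr i σ, hc, h⟩

theorem reaches_const {r k : ℕ} {R : RAM.State → Prop} {σ : RAM.State} (hk : k < 32 * K.bound)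
    (h : R { σ with reg := Function.update σ.reg r k }) :
    Reaches (.instr (.const r k)) K.unit R σ := by
  have := size_le_of_lt hk
  exact reaches_instr (by simp only [RAM.Instr.cost, Context.unit]; omega) h

theorem reaches_add {r a b : ℕ} {R : RAM.State → Prop} {σ : RAM.State}
    (ha : σ.reg a < 32 * K.bound) (hb : σ.reg b < 32 * K.bound)
    (h : R { σ with reg := Function.update σ.reg r (σ.reg a + σ.reg b) }) :
    Reaches (.instr (.add r a b)) K.unit R σ := by
  have := size_le_of_lt ha
  have := size_le_of_lt hb
  exact reaches_instr (by simp only [RAM.Instr.cost, Context.unit]; omega) h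

theorem reaches_sub {r a b : ℕ} {R : RAM.State → Prop} {σ : RAM.State}
    (ha : σ.reg a < 32 * K.bound) (hb : σ.reg b < 32 * K.bound)
    (h : R { σ with reg := Function.update σ.reg r (σ.reg a - σ.reg b) }) :
    Reaches (.instr (.sub r a b)) K.unit R σ := by
  have := size_le_of_lt ha
  have := size_le_of_lt hb
  exact reaches_instr (by simp only [RAM.Instr.cost, Context.unit]; omega) h

theorem reaches_load {r a : ℕ} {R : RAM.State → Prop} {σ : RAM.State}
    (ha : σ.reg a < 32 * K.bound) (hb : σ.mem (σ.reg a) < 32 * K.bound)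
    (h : R { σ with reg := Function.update σ.reg r (σ.mem (σ.reg a)) }) :
    Reaches (.instr (.load r a)) K.unit R σ := by
  have := size_le_of_lt ha
  have := size_le_of_lt hb
  exact reaches_instr (by simp only [RAM.Instr.cost, Context.unit]; omega) h

theorem reaches_store {a b : ℕ} {R : RAM.State → Prop} {σ : RAM.State}
    (ha : σ.reg a < 32 * K.bound) (hb : σ.reg b < 32 * K.bound)
    (h : R { σ with mem := Function.update σ.mem (σ.reg a) (σ.reg b) }) :
    Reaches (.instr (.store a b)) K.unit R σ := by
  have := size_le_of_lt ha
  have := size_le_of_lt hb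
  exact reaches_instr (by simp only [RAM.Instr.cost, Context.unit]; omega) h

theorem Expr.eval_lt {s : State} {σ : RAM.State} (hs : Sim K s σ) {a : Expr} (ha : a.Ok K s) :
    a.eval K s < K.bound := by
  induction a with
  | var v => exact hs.reg_lt v
  | lit k => exact ha
  | add a b => exact ha.2.2
  | sub a b iha ihb => exact (Nat.sub_le _ _).trans_lt (iha ha.1)
  | arr j a => exact hs.arr_lt _ _
  | inp a => exact K.inp_lt _ ha.2

/-- At most the registers `temp i'` with `i ≤ i'` have been changed. -/
structure TempStep (i : ℕ) (σ σ' : RAM.State) : Prop where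
  mem : σ'.mem = σ.mem
  reg : ∀ r, (∀ i' ≥ i, r ≠ temp i') → σ'.reg r = σ.reg r

theorem TempStep.trans {i i' : ℕ} {σ σ' σ'' : RAM.State} (h : TempStep i σ σ')
    (h' : TempStep i' σ' σ'') (hi : i ≤ i') : TempStep i σ σ'' :=
  ⟨h'.mem.trans h.mem, fun r hr => (h'.reg r fun j hj => hr j (hi.trans hj)).trans (h.reg r hr)⟩

theorem TempStep.sim {i : ℕ} {s : State} {σ σ' : RAM.State} (h : TempStep i σ σ')
    (hs : Sim K s σ) : Sim K s σ' :=
  hs.of_temp h.mem fun r hr => h.reg r fun i _ => hr i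

theorem TempStep.update {i i' : ℕ} (hi : i ≤ i') (σ : RAM.State) (x : ℕ) :
    TempStep i σ { σ with reg := Function.update σ.reg (temp i') x } :=
  ⟨rfl, fun _ hr => Function.update_of_ne (hr i' hi) _ _⟩

theorem TempStep.temp_lt {i i' : ℕ} {σ σ' : RAM.State} (h : TempStep i σ σ') (hi : i' < i) :
    σ'.reg (temp i') = σ.reg (temp i') :=
  h.reg _ fun j hj => by simp only [temp]; omega

theorem reaches_addressCode {s : State} {σ : RAM.State} (hs : Sim K s σ) (j : Arr) (i : ℕ) {x : ℕ}
    (hx : σ.reg (temp i) = x) (hlt : x < K.bound) :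
    Reaches (addressCode j i) (7 * K.unit)
      (fun σ' => TempStep i σ σ' ∧ σ'.reg (temp i) = K.len + 16 * x + j.code) σ := by
  have hl := K.len_le
  have hj := j.code_lt
  have h1 : ∀ i, (1 : ℕ) ≠ temp i := by intro i; simp only [temp]; omega
  have h2 : temp (i + 1) ≠ temp i := by simp only [temp]; omega
  have hb := hs.base
  subst hx
  have e : 7 * K.unit = K.unit + (K.unit + (K.unit + (K.unit + (K.unit + (K.unit + K.unit))))) := by
    ring
  rw [e]
  refine Reaches.seq (R := fun σ' => σ' =
    { σ with reg := Function.update σ.reg (temp i) (2 * σ.reg (temp i)) }) ?_ ?_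
  · exact reaches_add (by omega) (by omega) (by rw [two_mul])
  rintro _ rfl
  refine Reaches.seq (R := fun σ' => σ' =
    { σ with reg := Function.update σ.reg (temp i) (4 * σ.reg (temp i)) }) ?_ ?_
  · refine reaches_add ?_ ?_ ?_ <;> simp <;> first | omega | (congr 1; ring)
  rintro _ rfl
  refine Reaches.seq (R := fun σ' => σ' =
    { σ with reg := Function.update σ.reg (temp i) (8 * σ.reg (temp i)) }) ?_ ?_
  · refine reaches_add ?_ ?_ ?_ <;> simp <;> first | omega | (congr 1; ring)
  rintro _ rfl
  refine Reaches.seq (R := fun σ' => σ' =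
    { σ with reg := Function.update σ.reg (temp i) (16 * σ.reg (temp i)) }) ?_ ?_
  · refine reaches_add ?_ ?_ ?_ <;> simp <;> first | omega | (congr 1; ring)
  rintro _ rfl
  refine Reaches.seq (R := fun σ' => σ' =
    { σ with reg := Function.update σ.reg (temp i) (K.len + 16 * σ.reg (temp i)) }) ?_ ?_
  · refine reaches_add ?_ ?_ ?_ <;> simp [Function.update_of_ne (h1 i), hb] <;>
      first | omega | (congr 1; ring)
  rintro _ rfl
  refine Reaches.seq (R := fun σ' => σ' = { σ with
    reg := Function.update (Function.update σ.reg (temp i) (K.len + 16 * σ.reg (temp i)))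
      (temp (i + 1)) j.code }) ?_ ?_
  · exact reaches_const (by omega) rfl
  rintro _ rfl
  refine reaches_add ?_ ?_ ?_
  · simp only [Function.update_of_ne h2.symm, Function.update_self]; omega
  · simp only [Function.update_self]; omega
  · refine ⟨⟨rfl, fun r hr => ?_⟩, ?_⟩
    · have := hr i le_rfl
      have := hr (i + 1) (by omega)
      simp [Function.update_of_ne, *]
    · simp [Function.update_of_ne h2.symm]

theorem Expr.reaches_compile {s : State} (a : Expr) :
    ∀ {σ : RAM.State}, Sim K s σ → a.Ok K s → ∀ i, Reaches (a.compile i) (a.size * K.unit)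
      (fun σ' => TempStep i σ σ' ∧ σ'.reg (temp i) = a.eval K s) σ := by
  induction a with
  | var v =>
    intro σ hs _ i
    have h1 : 2 * v.code ≠ temp i := by simp only [temp]; omega
    have h2 := hs.reg v
    have h3 := hs.reg_lt v
    rw [size, two_mul]
    refine Reaches.seq (reaches_const (by omega) rfl) (R := fun σ' => σ' =
      { σ with reg := Function.update σ.reg (temp i) 0 }) ?_
    rintro _ rfl
    refine reaches_add ?_ ?_
      ⟨(TempStep.update le_rfl σ 0).trans (TempStep.update le_rfl _ _) le_rfl, ?_⟩
    · simp; omega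
    · simp only [Function.update_of_ne h1]; omega
    · simp [Function.update_of_ne h1, h2, eval]
  | lit k =>
    intro σ hs hk i
    simp only [Ok] at hk
    rw [size, one_mul]
    exact reaches_const (by omega) ⟨TempStep.update le_rfl σ k, by simp [eval]⟩
  | add a b iha ihb =>
    intro σ hs ⟨ha, hb, hab⟩ i
    rw [size, add_mul, add_mul, one_mul, add_assoc]
    refine (iha hs ha i).seq ?_
    rintro σ1 ⟨t1, e1⟩
    refine (ihb (t1.sim hs) hb (i + 1)).seq ?_
    rintro σ2 ⟨t2, e2⟩
    have e1' := (t2.temp_lt (Nat.lt_succ_self i)).trans e1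
    refine reaches_add (by omega) (by omega) ⟨(t1.trans t2 (by omega)).trans
      (TempStep.update le_rfl _ _) le_rfl, ?_⟩
    simp [e1', e2, eval]
  | sub a b iha ihb =>
    intro σ hs ⟨ha, hb⟩ i
    have := eval_lt hs ha
    have := eval_lt hs hb
    rw [size, add_mul, add_mul, one_mul, add_assoc]
    refine (iha hs ha i).seq ?_
    rintro σ1 ⟨t1, e1⟩
    refine (ihb (t1.sim hs) hb (i + 1)).seq ?_
    rintro σ2 ⟨t2, e2⟩
    have e1' := (t2.temp_lt (Nat.lt_succ_self i)).trans e1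
    refine reaches_sub (by omega) (by omega) ⟨(t1.trans t2 (by omega)).trans
      (TempStep.update le_rfl _ _) le_rfl, ?_⟩
    simp [e1', e2, eval]
  | arr j a iha =>
    intro σ hs ha i
    have hl : a.eval K s < K.bound := eval_lt hs ha
    have hj := j.code_lt
    have hK := K.len_le
    rw [size, add_mul, show 8 * K.unit = 7 * K.unit + K.unit by ring]
    refine (iha hs ha i).seq ?_
    rintro σ1 ⟨t1, e1⟩
    refine (reaches_addressCode (t1.sim hs) j i e1 hl).seq ?_
    rintro σ2 ⟨t2, e2⟩
    have t3 := t1.trans t2 le_rfl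
    have e3 := (t3.sim hs).arr j (a.eval K s)
    have h3 := hs.arr_lt j (a.eval K s)
    refine reaches_load (by omega) (by rw [e2, e3]; omega) ⟨t3.trans
      (TempStep.update le_rfl _ _) le_rfl, ?_⟩
    simp [e2, e3, eval]
  | inp a iha =>
    intro σ hs ⟨ha, hlen⟩ i
    have hl := eval_lt hs ha
    rw [size, add_mul, one_mul]
    refine (iha hs ha i).seq ?_
    rintro σ1 ⟨t1, e1⟩
    have e3 := (t1.sim hs).inp _ hlen
    have h3 := K.inp_lt _ hlen
    refine reaches_load (by omega) (by rw [e1, e3]; omega) ⟨t1.trans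
      (TempStep.update le_rfl _ _) le_rfl, ?_⟩
    simp [e1, e3, eval]

theorem reaches_compilePair {s : State} {σ : RAM.State} (hs : Sim K s σ) {a b : Expr}
    (ha : a.Ok K s) (hb : b.Ok K s) :
    Reaches (compilePair a b) ((a.size + b.size) * K.unit) (fun σ' => Sim K s σ' ∧
      σ'.reg (temp 0) = a.eval K s ∧ σ'.reg (temp 1) = b.eval K s) σ := by
  rw [add_mul]
  refine (a.reaches_compile hs ha 0).seq ?_
  rintro σ1 ⟨t1, e1⟩
  obtain ⟨t, σ2, h1, h2, t2, e2⟩ := b.reaches_compile (t1.sim hs) hb 1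
  exact ⟨t, σ2, h1, h2, t2.sim (t1.sim hs), (t2.temp_lt Nat.one_pos).trans e1, e2⟩

theorem testCost_le {s : State} {σ : RAM.State} (hs : Sim K s σ) {a b : Expr}
    (ha : a.Ok K s) (hb : b.Ok K s) (h0 : σ.reg (temp 0) = a.eval K s)
    (h1 : σ.reg (temp 1) = b.eval K s) : RAM.testCost (temp 0) (temp 1) σ ≤ K.unit := by
  have := Expr.eval_lt hs ha
  have := Expr.eval_lt hs hb
  have h2 : Nat.size (a.eval K s) ≤ Nat.size K.bound + 5 := size_le_of_lt (by omega)
  have h3 : Nat.size (b.eval K s) ≤ Nat.size K.bound + 5 := size_le_of_lt (by omega)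
  rw [RAM.testCost, h0, h1, Context.unit]
  omega

/-- The cost of an execution: between two loop iterations, every instruction of the code is executed
at most once. -/
theorem Run.reaches_compile {P : Cmd} {s s' : State} (h : Run K P s s') :
    ∀ {σ : RAM.State}, Sim K s σ → Reaches P.compile
      (P.size * (1 + (s'.time - s.time)) * K.unit) (Sim K s') σ := by
  induction h with
  | skip s =>
    intro σ hs
    simp only [Cmd.size, Nat.sub_self, add_zero, one_mul]
    have := (Nat.zero_le _).trans_lt (hs.reg_lt .out)
    exact reaches_const (by omega) ((TempStep.update le_rfl σ 0).sim hs)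
  | @set v a s ha =>
    intro σ hs
    simp only [Cmd.size, State.setReg_time, Nat.sub_self, add_zero, mul_one]
    have hl := Expr.eval_lt hs ha
    rw [add_mul, two_mul]
    refine (a.reaches_compile hs ha 0).seq ?_
    rintro σ1 ⟨t1, e1⟩
    have h1 : temp 0 ≠ 2 * v.code := by simp only [temp]; omega
    refine Reaches.seq (reaches_const (by omega) rfl) (R := fun σ' => σ' =
      { σ1 with reg := Function.update σ1.reg (2 * v.code) 0 }) ?_
    rintro _ rfl
    have hs1 := t1.sim hs
    refine reaches_add ?_ ?_ ⟨fun v' => ?_, ?_, hs1.arr, hs1.inp, fun v' => ?_, hs1.arr_lt⟩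
    · simp; omega
    · simp only [Function.update_of_ne h1]; omega
    · by_cases hv : v' = v
      · subst hv; simp [Function.update_of_ne h1, e1]
      · have : 2 * v'.code ≠ 2 * v.code := fun h => hv (Var.code_injective (by omega))
        simp [Function.update_of_ne this, hv, hs1.reg]
    · have : 1 ≠ 2 * v.code := by omega
      simp [Function.update_of_ne this, hs1.base]
    · simp only [State.setReg_reg]
      split_ifs
      · exact hl
      · exact hs.reg_lt _
  | @store j a b s ha hb =>
    intro σ hs
    simp only [Cmd.size, State.setArr_time, Nat.sub_self, add_zero, mul_one]
    have hl := Expr.eval_lt hs ha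
    have hl' := Expr.eval_lt hs hb
    have hj := j.code_lt
    have hK := K.len_le
    rw [show (a.size + b.size + 8) * K.unit =
      a.size * K.unit + (7 * K.unit + (b.size * K.unit + K.unit)) by ring]
    refine (a.reaches_compile hs ha 0).seq ?_
    rintro σ1 ⟨t1, e1⟩
    refine (reaches_addressCode (t1.sim hs) j 0 e1 hl).seq ?_
    rintro σ2 ⟨t2, e2⟩
    have t3 := t1.trans t2 le_rfl
    refine (b.reaches_compile (t3.sim hs) hb 1).seq ?_
    rintro σ3 ⟨t4, e4⟩
    have e5 := (t4.temp_lt Nat.one_pos).trans e2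
    have hs3 := (t3.trans t4 (Nat.zero_le _)).sim hs
    refine reaches_store (by omega) (by omega) ⟨hs3.reg, hs3.base, fun j' i => ?_, fun x hx => ?_,
      hs3.reg_lt, fun j' i => ?_⟩
    · simp only [e5, e4, State.setArr_arr]
      by_cases hji : j' = j ∧ i = a.eval K s
      · obtain ⟨rfl, rfl⟩ := hji; simp
      · have hne : K.len + 16 * i + j'.code ≠ K.len + 16 * a.eval K s + j.code := by
          intro h
          have := j'.code_lt
          exact hji ⟨Arr.code_injective (by omega), by omega⟩
        rw [Function.update_of_ne hne, hs3.arr]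
        split_ifs with h
        · subst h
          rw [Function.update_of_ne (fun h => hji ⟨rfl, h⟩)]
        · rfl
    · have : x ≠ K.len + 16 * a.eval K s + j.code := by omega
      simp only [e5, Function.update_of_ne this]
      exact hs3.inp x hx
    · rw [State.setArr_arr]
      split_ifs
      · rw [Function.update_apply]
        split_ifs
        · exact hl'
        · exact hs.arr_lt _ _
      · exact hs.arr_lt _ _
  | @seq P Q s s' s'' hP hQ ih1 ih2 =>
    intro σ hs
    obtain ⟨t, σ1, h1, h2, h3⟩ := ih1 hs
    obtain ⟨t', σ2, h4, h5, h6⟩ := ih2 h3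
    refine ⟨_, _, .seq h1 h4, ?_, h6⟩
    obtain ⟨x, hx⟩ := Nat.exists_eq_add_of_le hP.time_le
    obtain ⟨y, hy⟩ := Nat.exists_eq_add_of_le hQ.time_le
    have e1 : s'.time - s.time = x := by omega
    have e2 : s''.time - s'.time = y := by omega
    have e3 : s''.time - s.time = x + y := by omega
    rw [e1] at h2
    rw [e2] at h5
    rw [e3, Cmd.size]
    calc t + t' ≤ P.size * (1 + x) * K.unit + Q.size * (1 + y) * K.unit := by omega
      _ ≤ P.size * (1 + (x + y)) * K.unit + Q.size * (1 + (x + y)) * K.unit := by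
        gcongr <;> omega
      _ = _ := by ring
  | @ite_true a b P Q s s' ha hb hlt hP ih =>
    intro σ hs
    obtain ⟨t, σ1, h1, h2, hs1, e0, e1⟩ := reaches_compilePair hs ha hb
    obtain ⟨t', σ2, h4, h5, h6⟩ := ih hs1
    refine ⟨_, _, .seq h1 (.branch_true (by rw [e0, e1]; exact hlt) h4), ?_, h6⟩
    have h7 := testCost_le hs1 ha hb e0 e1
    rw [Cmd.size]
    calc _ ≤ (a.size + b.size) * 1 * K.unit + 1 * 1 * K.unit +
          P.size * (1 + (s'.time - s.time)) * K.unit := by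
            rw [mul_one, mul_one, one_mul]
            omega
      _ ≤ (a.size + b.size) * (1 + (s'.time - s.time)) * K.unit +
          1 * (1 + (s'.time - s.time)) * K.unit + P.size * (1 + (s'.time - s.time)) * K.unit +
          Q.size * (1 + (s'.time - s.time)) * K.unit := by
        refine le_trans ?_ (Nat.le_add_right _ _)
        gcongr <;> omega
      _ = _ := by ring
  | @ite_false a b P Q s s' ha hb hlt hP ih =>
    intro σ hs
    obtain ⟨t, σ1, h1, h2, hs1, e0, e1⟩ := reaches_compilePair hs ha hb
    obtain ⟨t', σ2, h4, h5, h6⟩ := ih hs1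
    refine ⟨_, _, .seq h1 (.branch_false (by rw [e0, e1]; exact hlt) h4), ?_, h6⟩
    have h7 := testCost_le hs1 ha hb e0 e1
    rw [Cmd.size]
    calc _ ≤ (a.size + b.size) * 1 * K.unit + 1 * 1 * K.unit +
          Q.size * (1 + (s'.time - s.time)) * K.unit := by
            rw [mul_one, mul_one, one_mul]
            omega
      _ ≤ (a.size + b.size) * (1 + (s'.time - s.time)) * K.unit +
          1 * (1 + (s'.time - s.time)) * K.unit + Q.size * (1 + (s'.time - s.time)) * K.unit +
          P.size * (1 + (s'.time - s.time)) * K.unit := by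
        refine le_trans ?_ (Nat.le_add_right _ _)
        gcongr <;> omega
      _ = _ := by ring
  | @while_done a b P s ha hb hlt =>
    intro σ hs
    obtain ⟨t, σ1, h1, h2, hs1, e0, e1⟩ := reaches_compilePair hs ha hb
    refine ⟨_, _, .seq h1 (.loop_done (by rw [e0, e1]; exact hlt)), ?_, hs1⟩
    have h7 := testCost_le hs1 ha hb e0 e1
    rw [Cmd.size, Nat.sub_self, add_zero, mul_one, add_mul, add_mul, one_mul]
    omega
  | @while_step a b P s s' s'' ha hb hlt hP hW ih1 ih2 =>
    intro σ hs
    obtain ⟨t, σ1, h1, h2, hs1, e0, e1⟩ := reaches_compilePair hs ha hb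
    obtain ⟨t', σ2, h4, h5, h6⟩ :=
      ih1 (σ := σ1) ⟨hs1.reg, hs1.base, hs1.arr, hs1.inp, hs1.reg_lt, hs1.arr_lt⟩
    obtain ⟨t'', σ3, h8, h9, h10⟩ := ih2 h6
    cases h8 with
    | @seq _ _ _ σ4 _ t₁ t₂ h11 h12 =>
      refine ⟨_, _, .seq h1 (.loop_step (by rw [e0, e1]; exact hlt) (.seq h4 h11) h12), ?_, h10⟩
      have h7 := testCost_le hs1 ha hb e0 e1
      obtain ⟨x, hx⟩ := Nat.exists_eq_add_of_le hP.time_le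
      obtain ⟨y, hy⟩ := Nat.exists_eq_add_of_le hW.time_le
      simp only [State.tick_time] at hx h5
      have e1 : s'.time - (s.time + 1) = x := by omega
      have e2 : s''.time - s'.time = y := by omega
      have e3 : s''.time - s.time = 1 + x + y := by omega
      rw [e1] at h5
      rw [e2] at h9
      rw [e3, Cmd.size]
      rw [Cmd.size] at h9
      calc _ ≤ (a.size + b.size) * 1 * K.unit + 1 * 1 * K.unit + P.size * (1 + x) * K.unit +
            (a.size + b.size + 1 + P.size) * (1 + y) * K.unit := by
            rw [mul_one, mul_one, one_mul]
            omega
        _ ≤ (a.size + b.size) * (1 + x) * K.unit + 1 * (1 + x) * K.unit +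
            P.size * (1 + x) * K.unit +
            (a.size + b.size + 1 + P.size) * (1 + y) * K.unit := by gcongr <;> omega
        _ = _ := by ring

end Imp

/-! ### Setting up the tables: parities, logarithm, separators -/

namespace Imp

open Cmd Var Arr

/-- The owner of a vertex. -/
def ownerOf (a : Expr) : Expr := .inp (4 + a + a)
/-- The priority of a vertex. -/
def prioOf (a : Expr) : Expr := .inp (5 + a + a)
/-- The source of an edge. -/
def sourceOf (a : Expr) : Expr := .inp (4 + .inp 0 + .inp 0 + a + a)
/-- The target of an edge. -/
def targetOf (a : Expr) : Expr := .inp (5 + .inp 0 + .inp 0 + a + a)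

/-- Sets `even p` to `1` if `p ≤ d` is even and to `0` if it is odd. -/
def parityTable : Cmd := block [
  store even 0 1,
  set pos 0,
  .while pos (.inp 1) (block [
    store even (pos + 1) (1 - even pos),
    set pos (pos + 1)])]

/-- Sets `log` to the binary logarithm of `n`, rounded down. -/
def computeLog : Cmd := block [
  set pow 1,
  set log 0,
  .while (pow + pow) (.inp 0 + 1) (block [
    set pow (pow + pow),
    set log (log + 1)])]

/-- Appends `itemS` to the sequence of separators generated so far. -/
def emit : Cmd := block [
  store sep leaves itemS,
  set leaves (leaves + 1)]

/-- Pushes a triple onto the stack. -/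
def push (a b c : Expr) : Cmd := block [
  store stackK sp a,
  store stackH sp b,
  store stackS sp c,
  set sp (sp + 1)]

/-- Pushes the three parts of `sepSeq itemK (itemH / 2) itemS`, the first one on top. -/
def expand : Cmd := block [
  push (itemK - 1) itemH itemH,
  push itemK (itemH - 2) itemH,
  push (itemK - 1) itemH itemS]

/-- Writes the separators into the array `sep`, and their number, not counting the two sentinels,
into `leaves`. The recursion of `sepSeq` is carried out with the help of a stack. On the stack, the
heights are doubled, since the machine has no instruction for halving `d`. -/
def generate : Cmd := block [
  store stackK 0 log,
  store stackH 0 (.inp 1),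
  store stackS 0 (.inp 1 + 2),
  set sp 1,
  set leaves 0,
  .while 0 sp (block [
    set sp (sp - 1),
    set itemK (stackK sp),
    set itemH (stackH sp),
    set itemS (stackS sp),
    ite 0 itemK (ite 0 itemH expand emit) emit]),
  store sep leaves (.inp 1 + 2),
  store sep (leaves + 1) (.inp 1 + 2)]

/-- The context describes a game with `n` vertices, `m` edges, `d` priorities and initial vertex
`v₀`; the bound is large enough for running the algorithm with a universal tree of `N` leaves. -/
structure Input (K : Context) (n d m v₀ : ℕ) (src tgt own pr : ℕ → ℕ) (N : ℕ) : Prop where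
  inp_zero : K.inp 0 = n
  inp_one : K.inp 1 = d
  inp_two : K.inp 2 = m
  inp_three : K.inp 3 = v₀
  inp_own : ∀ v < n, K.inp (4 + v + v) = own v
  inp_prio : ∀ v < n, K.inp (5 + v + v) = pr v
  inp_src : ∀ e < m, K.inp (4 + n + n + e + e) = src e
  inp_tgt : ∀ e < m, K.inp (5 + n + n + e + e) = tgt e
  len_eq : K.len = 4 + n + n + m + m
  start_lt : v₀ < n
  prio_le : ∀ v < n, pr v ≤ d
  src_lt : ∀ e < m, src e < n
  tgt_lt : ∀ e < m, tgt e < n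
  exists_edge : ∀ v < n, ∃ e < m, src e = v
  lt_bound : 16 < K.bound
  len_lt : 4 + n + n + m + m < K.bound
  prio_lt : d + 3 < K.bound
  leaves_lt : N + 4 < K.bound
  base_lt : n * (m + m) + m + m + 1 < K.bound
  queue_lt : n + (N + 1) * (m + m) + 1 < K.bound

variable {K : Context} {n d m v₀ N : ℕ} {src tgt own pr : ℕ → ℕ}

theorem Input.wp_parityTable (D : Input K n d m v₀ src tgt own pr N) {s : State} :
    Wp K parityTable (fun s' => s'.time ≤ s.time + d ∧
      ∀ p ≤ d, s'.arr even p = if Even p then 1 else 0) s := by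
  have h1 := D.lt_bound
  have h2 := D.prio_lt
  have h3 := D.len_eq
  have h4 := D.inp_one
  simp only [parityTable, wp_block_cons, wp_store, wp_set, wp_block_nil, Expr.ok_zero, Expr.ok_one,
    Expr.eval_zero, Expr.eval_one]
  refine ⟨by omega, by omega, by omega, ?_⟩
  refine wp_while (fun s' => s'.reg pos ≤ d ∧ s'.time = s.time + s'.reg pos ∧
    ∀ p ≤ s'.reg pos, s'.arr even p = if Even p then 1 else 0) (s.time + d) ?_ ?_ ?_ ?_ ?_
  · simp
  · rintro s' ⟨a1, a2, a3⟩; omega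
  · rintro s' - -
    simp; omega
  · rintro s' - ⟨a1, a2, a3⟩ hlt
    simp only [Expr.eval_var, Expr.eval_inp, Expr.eval_one, h4] at hlt
    simp
    refine ⟨by omega, by omega, by omega, by omega, by omega, fun p hp => ?_⟩
    rw [Function.update_apply]
    split_ifs with e1 e2 e2
    · rw [a3 _ le_rfl, if_neg]
      rw [e1] at e2; exact Nat.even_add_one.1 e2
    · rw [a3 _ le_rfl, if_pos]
      rw [e1] at e2; exact not_not.1 (mt Nat.even_add_one.2 e2)
    · rw [a3 _ (by omega), if_pos e2]
    · rw [a3 _ (by omega), if_neg e2]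
  · rintro s' - ⟨a1, a2, a3⟩ hlt
    simp only [Expr.eval_var, Expr.eval_inp, Expr.eval_one, h4] at hlt
    exact ⟨by omega, fun p hp => a3 p (by omega)⟩

theorem Input.wp_computeLog (D : Input K n d m v₀ src tgt own pr N) {s : State} :
    Wp K computeLog (fun s' => s'.time ≤ s.time + n ∧ 2 ^ s'.reg log ≤ n ∧
      n < 2 ^ (s'.reg log + 1)) s := by
  have h1 := D.lt_bound
  have h2 := D.start_lt
  have h3 := D.len_lt
  have h4 := D.inp_zero
  have h5 := D.len_eq
  simp only [computeLog, wp_block_cons, wp_set, wp_block_nil, Expr.ok_zero, Expr.ok_one,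
    Expr.eval_zero, Expr.eval_one]
  refine ⟨by omega, by omega, ?_⟩
  have hle : ∀ {s' : State}, (s'.reg pow = 2 ^ s'.reg log ∧ 2 ^ s'.reg log ≤ n ∧
    s'.time = s.time + s'.reg log) → s'.time ≤ s.time + n := by
    rintro s' ⟨a1, a2, a3⟩
    have := Nat.lt_two_pow_self (n := s'.reg log)
    omega
  refine wp_while (fun s' => s'.reg pow = 2 ^ s'.reg log ∧ 2 ^ s'.reg log ≤ n ∧
    s'.time = s.time + s'.reg log) (s.time + n) ?_ (fun _ => hle) ?_ ?_ ?_
  · simp; omega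
  · rintro s' - ⟨a1, a2, a3⟩
    simp; omega
  · rintro s' - ⟨a1, a2, a3⟩ hlt
    have := hle ⟨a1, a2, a3⟩
    simp [h4] at hlt
    simp [pow_succ]
    omega
  · rintro s' - ⟨a1, a2, a3⟩ hlt
    simp [h4] at hlt
    exact ⟨hle ⟨a1, a2, a3⟩, a2, by rw [pow_succ]; omega⟩

/-- The separators which are still to be generated, given the contents of the stack, the top being
the last entry of the list. -/
def pending (st : List (ℕ × ℕ × ℕ)) : List ℕ :=
  st.reverse.flatMap fun t => sepSeq t.1 t.2.1 t.2.2

@[simp] theorem pending_concat (st : List (ℕ × ℕ × ℕ)) (t : ℕ × ℕ × ℕ) :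
    pending (st ++ [t]) = sepSeq t.1 t.2.1 t.2.2 ++ pending st := by
  simp [pending]

theorem length_le_length_pending (st : List (ℕ × ℕ × ℕ)) : st.length ≤ (pending st).length := by
  induction st using List.reverseRecOn with
  | nil => simp
  | append_singleton st t ih =>
    have := length_sepSeq_pos t.1 t.2.1 t.2.2
    simp; omega

/-- The arrays representing the stack hold the given triples. -/
structure Stack (st : List (ℕ × ℕ × ℕ)) (s : State) : Prop where
  sp : s.reg sp = st.length
  stack : ∀ i t, st[i]? = some t →
    s.arr stackK i = t.1 ∧ s.arr stackH i = 2 * t.2.1 ∧ s.arr stackS i = t.2.2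

theorem Stack.congr {st : List (ℕ × ℕ × ℕ)} {s s' : State} (h : Stack st s)
    (hr : s'.reg .sp = s.reg .sp) (ha : s'.arr = s.arr) : Stack st s' :=
  ⟨hr.trans h.sp, by rw [ha]; exact h.stack⟩

theorem Stack.wp_push {st : List (ℕ × ℕ × ℕ)} {s : State} (hs : Stack st s) {a b c : Expr}
    {t : ℕ × ℕ × ℕ}
    (ha : ∀ s' : State, s'.reg = s.reg → a.Ok K s' ∧ a.eval K s' = t.1)
    (hb : ∀ s' : State, s'.reg = s.reg → b.Ok K s' ∧ b.eval K s' = 2 * t.2.1)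
    (hc : ∀ s' : State, s'.reg = s.reg → c.Ok K s' ∧ c.eval K s' = t.2.2)
    (hlt : st.length + 1 < K.bound) :
    Wp K (push a b c) (fun s' => Stack (st ++ [t]) s' ∧ s'.time = s.time) s := by
  simp only [push, wp_block_cons, wp_store, wp_set, wp_block_nil, Expr.ok_var, Expr.eval_var,
    Expr.ok_add, Expr.eval_add, State.setArr_reg, hs.sp, Expr.ok_one, Expr.eval_one, true_and]
  refine ⟨(ha _ rfl).1, (hb _ (by rfl)).1, (hc _ (by rfl)).1, ⟨by omega, hlt⟩, ⟨by simp, ?_⟩, rfl⟩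
  intro i t' hi
  rw [(ha _ rfl).2, (hb _ (by rfl)).2, (hc _ (by rfl)).2]
  simp only [State.setReg_arr, State.setArr_arr, reduceCtorEq, if_true, if_false,
    Function.update_apply]
  split_ifs with h
  · subst h
    simp at hi
    subst hi
    exact ⟨rfl, rfl, rfl⟩
  · refine hs.stack i t' ?_
    have := (List.getElem?_eq_some_iff.1 hi).1
    simp at this
    rwa [List.getElem?_append_left (by omega)] at hi

theorem Stack.wp_expand {st : List (ℕ × ℕ × ℕ)} {s : State} {k h x : ℕ} (hs : Stack st s)
    (hk : s.reg itemK = k + 1) (hh : s.reg itemH = 2 * (h + 1)) (hx : s.reg itemS = x)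
    (hlt : st.length + 3 < K.bound) :
    Wp K expand (fun s' => Stack (st ++ [(k, h + 1, 2 * (h + 1)), (k + 1, h, 2 * (h + 1)),
      (k, h + 1, x)]) s' ∧ s'.time = s.time) s := by
  simp only [expand, wp_block_cons, wp_block_nil]
  refine (hs.wp_push (K := K) (t := (k, h + 1, 2 * (h + 1))) ?_ ?_ ?_ (by omega)).mono ?_
  · intro s' hr; refine ⟨?_, by simp [hr, hk]⟩; simp; omega
  · intro s' hr; simp [hr, hh]
  · intro s' hr; simp [hr, hh]
  rintro s1 g1 ⟨hs1, t1⟩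
  have hk1 := (g1.reg (v := itemK) rfl).trans hk
  have hh1 := (g1.reg (v := itemH) rfl).trans hh
  have hx1 := (g1.reg (v := itemS) rfl).trans hx
  refine (hs1.wp_push (K := K) (t := (k + 1, h, 2 * (h + 1))) ?_ ?_ ?_ (by simp; omega)).mono ?_
  · intro s' hr; simp [hr, hk1]
  · intro s' hr; refine ⟨?_, by simp [hr, hh1]; omega⟩; simp; omega
  · intro s' hr; simp [hr, hh1]
  rintro s2 g2 ⟨hs2, t2⟩
  have hk2 := (g2.reg (v := itemK) rfl).trans hk1
  have hh2 := (g2.reg (v := itemH) rfl).trans hh1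
  have hx2 := (g2.reg (v := itemS) rfl).trans hx1
  refine (hs2.wp_push (K := K) (t := (k, h + 1, x)) ?_ ?_ ?_ (by simp; omega)).mono ?_
  · intro s' hr; refine ⟨?_, by simp [hr, hk2]⟩; simp; omega
  · intro s' hr; simp [hr, hh2]
  · intro s' hr; simp [hr, hx2]
  rintro s3 g3 ⟨hs3, t3⟩
  exact ⟨by simpa using hs3, by omega⟩

/-- The invariant of the loop of `generate`, where `out` has been generated so far. Expanding a
triple increases the size of the stack by two and does not change the number of pending separators;
hence the number of iterations is bounded as in the last field. -/
structure GenerateInv (full : List ℕ) (T : ℕ) (st : List (ℕ × ℕ × ℕ)) (out : List ℕ) (s : State) :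
    Prop where
  stack : Stack st s
  leaves : s.reg leaves = out.length
  full : out ++ pending st = full
  sep : ∀ r < out.length, s.arr sep r = out.getD r 0
  time : s.time + 2 * (pending st).length ≤ T + st.length

theorem GenerateInv.wp_emit {full : List ℕ} {T : ℕ} {st : List (ℕ × ℕ × ℕ)} {out : List ℕ}
    {s : State} {x : ℕ} (hst : Stack st s) (hle : s.reg .leaves = out.length)
    (hfull : out ++ x :: pending st = full) (hsep : ∀ r < out.length, s.arr .sep r = out.getD r 0)
    (htime : s.time + 2 * (pending st).length ≤ T + st.length) (hx : s.reg itemS = x)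
    (hK : full.length + 4 < K.bound) :
    Wp K emit (fun s' => ∃ st out, GenerateInv full T st out s') s := by
  have hlen := congrArg List.length hfull
  simp at hlen
  simp only [emit, wp_block_cons, wp_store, wp_set, wp_block_nil]
  refine ⟨by simp, by simp, by simp; omega, st, out ++ [x], ⟨?_, ?_⟩, ?_, ?_, ?_, ?_⟩
  · simpa using hst.sp
  · simpa using hst.stack
  · simpa using hle
  · simpa using hfull
  · intro r hr
    simp at hr
    simp only [Expr.eval_var, State.setReg_arr, State.setArr_arr, if_true, hle, hx,
      Function.update_apply]
    split_ifs with h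
    · subst h; simp
    · rw [List.getD_append _ _ _ _ (by omega)]; exact hsep r (by omega)
  · simpa using htime

theorem Input.wp_generate (D : Input K n d m v₀ src tgt own pr N) (hd : Even d) {s : State}
    (hN : ParityGame.leaves (s.reg log) d = N) :
    Wp K generate (fun s' => s'.time ≤ s.time + 2 * N ∧ s'.reg leaves = N ∧
      ∀ r ≤ N + 1, s'.arr sep r = ParityGame.separators (s.reg log) d r) s := by
  have h1 := D.lt_bound
  have h2 := D.leaves_lt
  have h3 := D.prio_lt
  have h4 := D.inp_one
  have h5 := D.len_eq
  obtain ⟨h, rfl⟩ := hd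
  rw [← two_mul] at *
  set full := sepSeq (s.reg log) h (2 * h + 2) with hfull
  have hlen : full.length = N := by rw [← hN, ParityGame.leaves]; simp [full]
  simp only [generate, wp_block_cons, wp_store, wp_set]
  refine ⟨by simp; omega, by simp, by simp; omega, by simp; omega, by simp; omega,
    by simp; omega, by simp; omega, by simp; omega, ?_⟩
  refine wp_while (fun s' => ∃ st out, GenerateInv full (s.time + 2 * N) st out s')
    (s.time + 2 * N) ?_ ?_ ?_ ?_ ?_
  · refine ⟨[(s.reg log, h, 2 * h + 2)], [], ⟨by simp, ?_⟩, by simp, by simp [pending, full],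
      by simp, ?_⟩
    · intro i t hi
      rcases i with _ | i
      · simp at hi; subst hi; simp [h4]
      · simp at hi
    · simp [pending, ← hfull]; omega
  · rintro s' ⟨st, out, inv⟩
    have := length_le_length_pending st
    have := inv.time
    omega
  · rintro s' - -
    simp; omega
  · rintro s' - ⟨st, out, inv⟩ hlt
    simp only [Expr.eval_zero, Expr.eval_var, inv.stack.sp] at hlt
    have hfl := congrArg List.length inv.full
    have hpl := length_le_length_pending st
    have htime := inv.time
    rcases st.eq_nil_or_concat with rfl | ⟨st, ⟨k, hh, x⟩, rfl⟩
    · simp at hlt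
    have htop := inv.stack.stack st.length (k, hh, x) (by simp)
    simp only [List.concat_eq_append] at *
    have hst : ∀ i t, st[i]? = some t →
        s'.arr stackK i = t.1 ∧ s'.arr stackH i = 2 * t.2.1 ∧ s'.arr stackS i = t.2.2 := by
      intro i t hi
      refine inv.stack.stack i t ?_
      rw [List.getElem?_append_left]
      · exact hi
      · exact (List.getElem?_eq_some_iff.1 hi).1
    have hsp := inv.stack.sp
    have hful := inv.full
    have hle := inv.leaves
    have hsep := inv.sep
    clear inv
    simp only [pending_concat, List.length_append, List.length_singleton] at hpl htime hfl hsp hful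
    simp only [wp_block_cons, wp_set, wp_ite, wp_block_nil, Expr.ok_sub, Expr.ok_var, Expr.ok_one,
      Expr.ok_arr, Expr.ok_zero, Expr.eval_var, Expr.eval_sub, Expr.eval_arr, Expr.eval_one,
      Expr.eval_zero, State.setReg_reg, State.setReg_arr, State.tick_reg, State.tick_arr, if_true,
      if_false, reduceCtorEq, hsp, Nat.add_sub_cancel, htop, true_and]
    refine ⟨by omega, by omega, ?_⟩
    set s1 := (((s'.tick.setReg .sp st.length).setReg itemK k).setReg itemH (2 * hh)).setReg itemS x
      with hs1
    have f1 : Stack st s1 := ⟨by simp [hs1], by simpa [hs1] using hst⟩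
    have f2 : s1.reg .leaves = out.length := by simp [hs1, hle]
    have f3 : s1.time = s'.time + 1 := rfl
    have f4 : s1.arr = s'.arr := rfl
    have f5 : s1.reg itemK = k := by simp [hs1]
    have f6 : s1.reg itemH = 2 * hh := by simp [hs1]
    have f7 : s1.reg itemS = x := by simp [hs1]
    rw [← f4] at hsep
    clear_value s1
    -- A leaf uses one iteration and removes one separator and one triple.
    have leaf : sepSeq k hh x = [x] →
        Wp K emit (fun s' => ∃ st out, GenerateInv full (s.time + 2 * N) st out s') s1 := by
      intro hleaf
      rw [hleaf] at htime hful hfl hpl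
      simp only [List.length_singleton] at htime
      exact GenerateInv.wp_emit f1 f2 hful hsep (by omega) f7 (by omega)
    refine ⟨fun c1 => ⟨by omega, fun c2 => ?_, fun c2 => leaf ?_⟩, fun c1 => leaf ?_⟩
    · obtain ⟨k, rfl⟩ := Nat.exists_eq_succ_of_ne_zero c1.ne'
      obtain ⟨hh, rfl⟩ := Nat.exists_eq_succ_of_ne_zero (n := hh) (by omega)
      simp only [Nat.succ_eq_add_one] at *
      rw [sepSeq] at hpl htime hful hfl
      simp only [List.length_append] at hpl htime hfl
      have b1 : st.length + 3 < K.bound := by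
        have := length_sepSeq_pos k (hh + 1) x
        have := length_le_length_pending st
        omega
      refine (f1.wp_expand f5 f6 f7 b1).mono ?_
      rintro s2 g2 ⟨i1, i2⟩
      refine ⟨_, out, i1, (g2.reg rfl).trans f2, ?_, ?_, ?_⟩
      · rw [← hful]; simp [pending]
      · rw [g2.arr rfl]; exact hsep
      · have : (pending (st ++ [(k, hh + 1, 2 * (hh + 1)), (k + 1, hh, 2 * (hh + 1)),
            (k, hh + 1, x)])).length = (sepSeq k (hh + 1) x).length +
            ((sepSeq (k + 1) hh (2 * (hh + 1))).length +
            (sepSeq k (hh + 1) (2 * (hh + 1))).length) + (pending st).length := by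
          simp [pending]; ring
        rw [this]
        simp
        omega
    · have : hh = 0 := by omega
      subst this
      obtain ⟨k, rfl⟩ := Nat.exists_eq_succ_of_ne_zero c1.ne'
      rw [sepSeq]
    · have : k = 0 := by omega
      subst this
      rw [sepSeq]
  · rintro s' - ⟨st, out, inv⟩ hlt
    simp only [Expr.eval_zero, Expr.eval_var, inv.stack.sp, not_lt, Nat.le_zero,
      List.length_eq_zero_iff] at hlt
    subst hlt
    have hful := inv.full
    simp only [pending, List.reverse_nil, List.flatMap_nil, List.append_nil] at hful
    have hle := inv.leaves
    have htime := inv.time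
    have hsep := inv.sep
    simp only [pending, List.reverse_nil, List.flatMap_nil, List.length_nil] at htime
    rw [hful, hlen] at hle
    rw [hful, hlen] at hsep
    simp only [wp_store, wp_block_nil, Expr.ok_var, Expr.eval_var, Expr.ok_add,
      Expr.ok_inp, Expr.ok_one, Expr.ok_two, Expr.eval_add, Expr.eval_inp, Expr.eval_one,
      Expr.eval_two, State.setArr_reg, State.setArr_time, State.setArr_arr, if_true, hle, h4,
      true_and]
    refine ⟨by omega, ⟨by omega, by omega⟩, by omega, by omega, fun r hr => ?_⟩
    rw [ParityGame.separators, Nat.mul_div_cancel_left _ two_pos, ← hfull]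
    simp only [Function.update_apply]
    split_ifs with e1 e2
    · rw [e1, List.getD_append_right _ _ _ _ (by omega), hlen, Nat.add_sub_cancel_left]; rfl
    · rw [e2, List.getD_append_right _ _ _ _ (by omega), hlen, Nat.sub_self]; rfl
    · rw [List.getD_append _ _ _ _ (by omega)]; exact hsep r (by omega)

end Imp

/-! ### Setting up the tables: incident edges and thresholds -/

namespace Imp

open Cmd Var Arr

/-- Reserves `2 * m` entries of the array `adj` for every vertex, and puts all vertices into the
queue. -/
def layout : Cmd := block [
  set tail 0,
  .while tail (.inp 0) (block [
    store base (tail + 1) (base tail + .inp 2 + .inp 2),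
    store queue tail tail,
    set tail (tail + 1)])]

/-- Collects, for every vertex, the edges incident to it and the threshold for being lifted. -/
def connect : Cmd := block [
  set edge 0,
  .while edge (.inp 2) (block [
    set src (sourceOf edge),
    set tgt (targetOf edge),
    store adj (base src + deg src) edge,
    store deg src (deg src + 1),
    store adj (base tgt + deg tgt) edge,
    store deg tgt (deg tgt + 1),
    ite 0 (ownerOf src) (store thr src 1) (store thr src (thr src + 1)),
    set edge (edge + 1)])]

/-- The number of incidences of the vertex `v` with the first `e` edges; loops count twice. -/
def incidences (src tgt : ℕ → ℕ) (e v : ℕ) : ℕ :=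
  ∑ x ∈ Finset.range e, ((if src x = v then 1 else 0) + (if tgt x = v then 1 else 0))

/-- The sum of the marks `f` of those among the first `e` edges which leave the vertex `v`. -/
def marked (src : ℕ → ℕ) (f : ℕ → ℕ) (e v : ℕ) : ℕ :=
  ∑ x ∈ Finset.range e, if src x = v then f x else 0

theorem incidences_le (src tgt : ℕ → ℕ) (e v : ℕ) : incidences src tgt e v ≤ e + e := by
  calc incidences src tgt e v ≤ ∑ x ∈ Finset.range e, 2 :=
        Finset.sum_le_sum fun x _ => by split_ifs <;> omega
    _ = e + e := by simp; omega

/-- The entries `v * w, …, v * w + deg v - 1` of `adj` list the edges related to the vertex `v`. -/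
def Incidence (n w : ℕ) (adj deg : ℕ → ℕ) (R : ℕ → ℕ → Prop) : Prop :=
  ∀ v < n, ∀ x, R v x ↔ ∃ i < deg v, adj (v * w + i) = x

theorem Incidence.insert {n w : ℕ} {adj deg : ℕ → ℕ} {R : ℕ → ℕ → Prop}
    (h : Incidence n w adj deg R) (hdeg : ∀ v < n, deg v < w) {v x : ℕ} (hv : v < n) :
    Incidence n w (Function.update adj (v * w + deg v) x) (Function.update deg v (deg v + 1))
      (fun u y => R u y ∨ u = v ∧ y = x) := by
  intro u hu y
  have hne : ∀ i < deg u, u * w + i ≠ v * w + deg v := by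
    intro i hi heq
    have h1 := hdeg u hu
    have h2 := hdeg v hv
    rcases lt_trichotomy u v with huv | rfl | huv
    · have := Nat.mul_le_mul_right w (Nat.succ_le_of_lt huv)
      rw [Nat.succ_mul] at this
      omega
    · omega
    · have := Nat.mul_le_mul_right w (Nat.succ_le_of_lt huv)
      rw [Nat.succ_mul] at this
      omega
  have hold : ∀ i < deg u, Function.update adj (v * w + deg v) x (u * w + i) = adj (u * w + i) :=
    fun i hi => Function.update_of_ne (hne i hi) _ _
  simp only [h u hu y]
  by_cases huv : u = v
  · subst huv
    simp only [Function.update_self, true_and]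
    constructor
    · rintro (⟨i, hi, rfl⟩ | rfl)
      · exact ⟨i, by omega, hold i hi⟩
      · exact ⟨deg u, by omega, by simp⟩
    · rintro ⟨i, hi, rfl⟩
      rcases Nat.lt_succ_iff_lt_or_eq.1 hi with h1 | rfl
      · exact Or.inl ⟨i, h1, (hold i h1).symm⟩
      · right; simp
  · simp only [Function.update_of_ne huv, huv, false_and, or_false]
    constructor
    · rintro ⟨i, hi, rfl⟩; exact ⟨i, hi, hold i hi⟩
    · rintro ⟨i, hi, rfl⟩; exact ⟨i, hi, (hold i hi).symm⟩

variable {K : Context} {n d m v₀ N : ℕ} {src tgt own pr : ℕ → ℕ}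

theorem Input.base_le (D : Input K n d m v₀ src tgt own pr N) {v : ℕ} (hv : v < n) :
    v * (m + m) + (m + m) + 1 < K.bound := by
  have h1 := D.base_lt
  have := Nat.mul_le_mul_right (m + m) (Nat.succ_le_of_lt hv)
  rw [Nat.succ_mul] at this
  omega

theorem Input.wp_layout (D : Input K n d m v₀ src tgt own pr N) {s : State}
    (h0 : s.arr base 0 = 0) :
    Wp K layout (fun s' => s'.time ≤ s.time + n ∧ s'.reg tail = n ∧
      (∀ v ≤ n, s'.arr base v = v * (m + m)) ∧ ∀ v < n, s'.arr queue v = v) s := by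
  have h1 := D.lt_bound
  have h2 := D.len_eq
  have h3 := D.inp_zero
  have h4 := D.inp_two
  have h5 := D.len_lt
  simp only [layout, wp_block_cons, wp_set, wp_block_nil]
  refine ⟨by simp; omega, ?_⟩
  refine wp_while (fun s' => s'.reg tail ≤ n ∧ s'.time = s.time + s'.reg tail ∧
    (∀ v ≤ s'.reg tail, s'.arr base v = v * (m + m)) ∧ ∀ v < s'.reg tail, s'.arr queue v = v)
    (s.time + n) ?_ ?_ ?_ ?_ ?_
  · simp [h0]
  · rintro s' ⟨a1, a2, -⟩; omega
  · rintro s' - -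
    simp; omega
  · rintro s' - ⟨a1, a2, a3, a4⟩ hlt
    simp only [Expr.eval_var, Expr.eval_inp, Expr.eval_zero, h3] at hlt
    have h6 := a3 _ le_rfl
    have h7 := D.base_le hlt
    simp [h6, h4]
    refine ⟨by omega, by omega, by omega, hlt, by omega, fun v hv => ?_, fun v hv => ?_⟩
    · rw [Function.update_apply]
      split_ifs with e
      · rw [e]; ring
      · exact a3 v (by omega)
    · rw [Function.update_apply]
      split_ifs with e
      · exact e.symm
      · exact a4 v (by omega)
  · rintro s' - ⟨a1, a2, a3, a4⟩ hlt
    simp only [Expr.eval_var, Expr.eval_inp, Expr.eval_zero, h3] at hlt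
    have : s'.reg tail = n := by omega
    rw [this] at a3 a4
    exact ⟨by omega, this, a3, a4⟩

/-- A vertex needs a lift if the number of valid edges leaving it is smaller than this threshold:
one for a vertex of Eve, the number of all edges leaving it for a vertex of Adam. Only the first `e`
edges are taken into account. -/
def threshold (src own : ℕ → ℕ) (e v : ℕ) : ℕ :=
  if 0 < own v then min 1 (marked src (fun _ => 1) e v) else marked src (fun _ => 1) e v

theorem marked_one_succ (src : ℕ → ℕ) (e v : ℕ) : marked src (fun _ => 1) (e + 1) v =
    marked src (fun _ => 1) e v + if src e = v then 1 else 0 := by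
  rw [marked, Finset.sum_range_succ, ← marked]

theorem threshold_le (src own : ℕ → ℕ) (e v : ℕ) : threshold src own e v ≤ e := by
  have h : marked src (fun _ => 1) e v ≤ ∑ x ∈ Finset.range e, 1 :=
    Finset.sum_le_sum fun x _ => by dsimp only; split_ifs <;> omega
  simp only [Finset.sum_const, Finset.card_range, smul_eq_mul, mul_one] at h
  rw [threshold]
  split_ifs <;> omega

theorem threshold_succ_self (src own : ℕ → ℕ) (e : ℕ) : threshold src own (e + 1) (src e) =
    if 0 < own (src e) then 1 else threshold src own e (src e) + 1 := by
  simp only [threshold, marked_one_succ, if_true]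
  split_ifs <;> omega

theorem threshold_succ_of_ne (src own : ℕ → ℕ) {e v : ℕ} (h : v ≠ src e) :
    threshold src own (e + 1) v = threshold src own e v := by
  simp only [threshold, marked_one_succ, if_neg h.symm, add_zero]

theorem Input.wp_connect (D : Input K n d m v₀ src tgt own pr N) {s : State}
    (hbase : ∀ v ≤ n, s.arr base v = v * (m + m)) (hdeg : ∀ v, s.arr deg v = 0)
    (hthr : ∀ v, s.arr thr v = 0) :
    Wp K connect (fun s' => s'.time ≤ s.time + m ∧
      (∀ v < n, s'.arr deg v = incidences src tgt m v) ∧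
      (∀ v < n, s'.arr thr v = threshold src own m v) ∧
      Incidence n (m + m) (s'.arr adj) (s'.arr deg) (fun v x => x < m ∧ (src x = v ∨ tgt x = v)))
      s := by
  have h1 := D.lt_bound
  have h2 := D.len_eq
  have h3 := D.inp_zero
  have h4 := D.inp_two
  have h5 := D.len_lt
  simp only [connect, wp_block_cons, wp_set, wp_block_nil]
  refine ⟨by simp; omega, ?_⟩
  refine wp_while (fun s' => s'.reg edge ≤ m ∧ s'.time = s.time + s'.reg edge ∧
    (∀ v < n, s'.arr deg v = incidences src tgt (s'.reg edge) v) ∧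
    (∀ v < n, s'.arr thr v = threshold src own (s'.reg edge) v) ∧
    Incidence n (m + m) (s'.arr adj) (s'.arr deg)
      (fun v x => x < s'.reg edge ∧ (src x = v ∨ tgt x = v))) (s.time + m) ?_ ?_ ?_ ?_ ?_
  · refine ⟨by simp, by simp, by simp [hdeg, incidences], by simp [hthr, threshold, marked], ?_⟩
    intro v _ x
    simp [hdeg]
  · rintro s' ⟨a1, a2, -⟩; omega
  · rintro s' - -
    simp; omega
  · rintro s' g ⟨a1, a2, a3, a4, a5⟩ hlt
    simp only [Expr.eval_var, Expr.eval_inp, Expr.eval_two, h4] at hlt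
    have hb := g.arr (j := base) rfl
    simp only [State.setReg_arr] at hb
    set e := s'.reg edge with he
    have hu := D.src_lt e hlt
    have hw := D.tgt_lt e hlt
    have bu := hbase _ hu.le
    have bw := hbase _ hw.le
    have du := incidences_le src tgt e (src e)
    have dw := incidences_le src tgt e (tgt e)
    have bu' := D.base_le hu
    have bw' := D.base_le hw
    have hsrc := D.inp_src e hlt
    have htgt := D.inp_tgt e hlt
    have how := D.inp_own _ hu
    have ha3u := a3 _ hu
    have ha3w := a3 _ hw
    have ha4u := a4 _ hu
    have hthr_le := threshold_le src own e (src e)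
    have hdlt : ∀ v < n, s'.arr deg v < m + m := by
      intro v hv
      have := incidences_le src tgt e v
      rw [a3 v hv]; omega
    have hinc := a5.insert hdlt hu (x := e)
    have hdlt' : ∀ v < n,
        Function.update (s'.arr deg) (src e) (s'.arr deg (src e) + 1) v < m + m := by
      intro v hv
      have := incidences_le src tgt e v
      rw [Function.update_apply]
      split_ifs with hc
      · rw [ha3u]; omega
      · rw [a3 v hv]; omega
    have hinc' := hinc.insert hdlt' hw (x := e)
    have hd1 := hdlt' _ hw
    have hd2 := hdlt _ hu
    simp only [wp_block_cons, wp_block_nil, wp_set, wp_store, wp_ite, sourceOf, targetOf, ownerOf,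
      Expr.ok_var, Expr.ok_add, Expr.ok_inp, Expr.ok_arr, Expr.ok_zero, Expr.ok_one, Expr.ok_four,
      Expr.ok_five, Expr.eval_var, Expr.eval_add, Expr.eval_inp, Expr.eval_arr, Expr.eval_zero,
      Expr.eval_one, Expr.eval_four, Expr.eval_five, State.setReg_reg, State.setReg_arr,
      State.setArr_reg, State.setArr_arr, State.tick_reg, State.tick_arr, reduceCtorEq, if_true,
      if_false, hsrc, htgt, ← he, h3, how, hb, bu, bw, true_and, State.setReg_time,
      State.setArr_time, State.tick_time]
    have hfinal : ∀ t : ℕ → ℕ, (∀ v < n, t v = threshold src own (e + 1) v) →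
        e + 1 ≤ m ∧ s'.time + 1 = s.time + (e + 1) ∧
        (∀ v < n, Function.update (Function.update (s'.arr deg) (src e) (s'.arr deg (src e) + 1))
          (tgt e) (Function.update (s'.arr deg) (src e) (s'.arr deg (src e) + 1) (tgt e) + 1) v =
            incidences src tgt (e + 1) v) ∧
        (∀ v < n, t v = threshold src own (e + 1) v) ∧
        Incidence n (m + m) (Function.update (Function.update (s'.arr adj)
          (src e * (m + m) + s'.arr deg (src e)) e) (tgt e * (m + m) +
            Function.update (s'.arr deg) (src e) (s'.arr deg (src e) + 1) (tgt e)) e)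
          (Function.update (Function.update (s'.arr deg) (src e) (s'.arr deg (src e) + 1))
          (tgt e) (Function.update (s'.arr deg) (src e) (s'.arr deg (src e) + 1) (tgt e) + 1))
          (fun v x => x < e + 1 ∧ (src x = v ∨ tgt x = v)) := by
      intro t ht
      refine ⟨by omega, by omega, fun v hv => ?_, ht, fun v hv x => ?_⟩
      · rw [incidences, Finset.sum_range_succ, ← incidences, ← a3 v hv]
        simp only [Function.update_apply]
        split_ifs <;> first | omega | (subst_vars; omega) | simp_all
      · rw [← hinc' v hv x]
        constructor
        · rintro ⟨hx, hv'⟩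
          rcases Nat.lt_succ_iff_lt_or_eq.1 hx with hx | rfl
          · exact Or.inl (Or.inl ⟨hx, hv'⟩)
          · rcases hv' with rfl | rfl
            · exact Or.inl (Or.inr ⟨rfl, rfl⟩)
            · exact Or.inr ⟨rfl, rfl⟩
        · rintro ((⟨hx, hv'⟩ | ⟨rfl, rfl⟩) | ⟨rfl, rfl⟩)
          · exact ⟨by omega, hv'⟩
          · exact ⟨by omega, Or.inl rfl⟩
          · exact ⟨by omega, Or.inr rfl⟩
    refine ⟨by omega, by omega, by omega, by omega, by omega, by omega, by omega, by omega,
      fun c => ⟨by omega, by omega, ?_⟩, fun c => ⟨by omega, by omega, ?_⟩⟩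
    · refine hfinal _ fun v hv => ?_
      rcases eq_or_ne v (src e) with rfl | hne
      · rw [Function.update_self, threshold_succ_self, if_pos c]
      · rw [Function.update_of_ne hne, threshold_succ_of_ne src own hne]; exact a4 v hv
    · refine hfinal _ fun v hv => ?_
      rcases eq_or_ne v (src e) with rfl | hne
      · rw [Function.update_self, threshold_succ_self, if_neg c, ha4u]
      · rw [Function.update_of_ne hne, threshold_succ_of_ne src own hne]; exact a4 v hv
  · rintro s' - ⟨a1, a2, a3, a4, a5⟩ hlt
    simp only [Expr.eval_var, Expr.eval_inp, Expr.eval_two, h4] at hlt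
    have : s'.reg edge = m := by omega
    rw [this] at a3 a4 a5
    exact ⟨by omega, a3, a4, a5⟩

end Imp

/-! ### The value iteration as a program -/

namespace Imp

open Cmd Var Arr

/-- Updates the validity of the edge at position `pos` of `adj`, adjusts the number of valid edges
leaving its source, and puts the source into the queue. -/
def recheck : Cmd := block [
  set edge (adj pos),
  set src (sourceOf edge),
  set tgt (targetOf edge),
  ite (lo tgt) (hi src)
    (block [store cnt src (cnt src + 1 - flag edge), store flag edge 1])
    (block [store cnt src (cnt src - flag edge), store flag edge 0]),
  store queue tail src,
  set tail (tail + 1),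
  set pos (pos + 1)]

/-- Moves the pair of `vert` to the next boundary, and rechecks all edges incident to `vert`. -/
def lift : Cmd := block [
  set prio (prioOf vert),
  set old (hi vert),
  set new (old + 1),
  .while (sep new) (prio + 1) (set new (new + 1)),
  store hi vert new,
  ite 0 (even prio) (store lo vert old) (store lo vert new),
  set pos (base vert),
  set lim (base vert + deg vert),
  .while pos lim recheck]

/-- The value iteration. All vertices which need a lift are in the queue. -/
def solve : Cmd := block [
  set head 0,
  .while head tail (block [
    set vert (queue head),
    set head (head + 1),
    ite (hi vert) (leaves + 1) (ite (cnt vert) (thr vert) lift skip) skip])]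

/-- Eve wins if and only if the initial vertex has not reached the top element. -/
def answer : Cmd := ite (hi (.inp 3)) (leaves + 1) (set out 1) (set out 0)

/-- Whether the edge `e` is valid, as a number. -/
def validBit (src tgt lo hi : ℕ → ℕ) (e : ℕ) : ℕ := if lo (tgt e) < hi (src e) then 1 else 0

theorem marked_update (src f : ℕ → ℕ) {m e : ℕ} (he : e < m) (x u : ℕ) :
    marked src (Function.update f e x) m u + (if src e = u then f e else 0) =
      marked src f m u + if src e = u then x else 0 := by
  have h := Finset.mem_range.2 he
  rw [marked, marked, ← Finset.add_sum_erase _ _ h, ← Finset.add_sum_erase _ (fun x =>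
    if src x = u then f x else 0) h]
  have : ∑ y ∈ (Finset.range m).erase e, (if src y = u then Function.update f e x y else 0) =
      ∑ y ∈ (Finset.range m).erase e, if src y = u then f y else 0 :=
    Finset.sum_congr rfl fun y hy => by rw [Function.update_of_ne (Finset.ne_of_mem_erase hy)]
  rw [this, Function.update_self]
  ring

theorem marked_le (src : ℕ → ℕ) {f : ℕ → ℕ} {m : ℕ} (hf : ∀ e < m, f e ≤ 1) (u : ℕ) :
    marked src f m u ≤ m := by
  calc marked src f m u ≤ ∑ x ∈ Finset.range m, 1 := Finset.sum_le_sum fun x hx => by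
        have := hf x (Finset.mem_range.1 hx)
        split_ifs <;> omega
    _ = m := by simp

theorem le_marked (src f : ℕ → ℕ) {m e : ℕ} (he : e < m) : f e ≤ marked src f m (src e) := by
  have := Finset.single_le_sum (f := fun x => if src x = src e then f x else 0)
    (fun _ _ => Nat.zero_le _) (Finset.mem_range.2 he)
  simpa [marked] using this

theorem marked_congr {src f g : ℕ → ℕ} {m u : ℕ} (h : ∀ e < m, src e = u → f e = g e) :
    marked src f m u = marked src g m u :=
  Finset.sum_congr rfl fun x hx => by
    split_ifs with hs
    · exact h x (Finset.mem_range.1 hx) hs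
    · rfl

variable {K : Context} {n d m v₀ N : ℕ} {src tgt own pr : ℕ → ℕ}

/-- The arrays which do not change any more once the value iteration has started. -/
structure Static (L : ℕ → ℕ) (n d m N : ℕ) (src tgt own : ℕ → ℕ) (s : State) : Prop where
  leaves : s.reg leaves = N
  sep : ∀ r ≤ N + 1, s.arr sep r = L r
  even : ∀ p ≤ d, s.arr even p = if Even p then 1 else 0
  base : ∀ v ≤ n, s.arr base v = v * (m + m)
  deg : ∀ v < n, s.arr deg v = incidences src tgt m v
  thr : ∀ v < n, s.arr thr v = threshold src own m v
  adj : Incidence n (m + m) (s.arr .adj) (s.arr .deg) (fun v x => x < m ∧ (src x = v ∨ tgt x = v))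

theorem Static.of_agree {L : ℕ → ℕ} {P : Cmd} {s s' : State} (h : Static L n d m N src tgt own s)
    (g : Agree P s s') (hP : P.writes .leaves = false ∧ P.stores .sep = false ∧
      P.stores .even = false ∧ P.stores .base = false ∧ P.stores .deg = false ∧
      P.stores .thr = false ∧ P.stores .adj = false) : Static L n d m N src tgt own s' := by
  obtain ⟨p1, p2, p3, p4, p5, p6, p7⟩ := hP
  exact ⟨by rw [g.reg p1]; exact h.leaves, by rw [g.arr p2]; exact h.sep,
    by rw [g.arr p3]; exact h.even, by rw [g.arr p4]; exact h.base, by rw [g.arr p5]; exact h.deg,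
    by rw [g.arr p6]; exact h.thr, by rw [g.arr p5, g.arr p7]; exact h.adj⟩

theorem Input.wp_recheck (D : Input K n d m v₀ src tgt own pr N) {s : State} {e b j : ℕ}
    (hadj : s.arr adj (b + j) = e) (he : e < m) (hpos : s.reg pos = b + j)
    (hflag : ∀ x < m, s.arr flag x ≤ 1)
    (hcnt : ∀ u < n, s.arr cnt u = marked src (s.arr flag) m u)
    (hb : b + j + 1 < K.bound) (hq : s.reg tail + 1 < K.bound) :
    Wp K recheck (fun s' => s'.time = s.time ∧ s'.reg pos = b + (j + 1) ∧
      s'.reg tail = s.reg tail + 1 ∧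
      s'.arr queue = Function.update (s.arr queue) (s.reg tail) (src e) ∧
      (∀ u < n, s'.arr cnt u = marked src (s'.arr flag) m u) ∧
      s'.arr flag = Function.update (s.arr flag) e (validBit src tgt (s.arr lo) (s.arr hi) e))
      s := by
  have h1 := D.lt_bound
  have h2 := D.len_eq
  have h3 := D.inp_zero
  have h5 := D.len_lt
  have hu := D.src_lt e he
  have hsrc := D.inp_src e he
  have htgt := D.inp_tgt e he
  have hc := hcnt _ hu
  have hm := marked_le src hflag (src e)
  have hle := le_marked src (s.arr flag) he
  have hfe := hflag e he
  simp only [recheck, wp_block_cons, wp_block_nil, wp_set, wp_store, wp_ite, sourceOf, targetOf,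
    Expr.ok_var, Expr.ok_add, Expr.ok_sub, Expr.ok_inp, Expr.ok_arr, Expr.ok_zero, Expr.ok_one,
    Expr.ok_four, Expr.ok_five, Expr.eval_var, Expr.eval_add, Expr.eval_sub, Expr.eval_inp,
    Expr.eval_arr, Expr.eval_zero, Expr.eval_one, Expr.eval_four, Expr.eval_five,
    State.setReg_reg, State.setReg_arr, State.setArr_reg, State.setArr_arr, reduceCtorEq, if_true,
    if_false, hsrc, htgt, h3, hpos, hadj, hc, true_and, and_true, State.setReg_time,
    State.setArr_time]
  refine ⟨by omega, by omega, fun hlt => ⟨by omega, by omega, by omega, by omega, rfl,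
    fun u hu => ?_, ?_⟩, fun hlt => ⟨by omega, by omega, by omega, rfl, fun u hu => ?_, ?_⟩⟩
  · have := marked_update src (s.arr flag) he 1 u
    have := hcnt u hu
    rw [Function.update_apply]
    split_ifs with h
    · subst h; simp only [if_true] at *; omega
    · rw [if_neg (Ne.symm h), if_neg (Ne.symm h)] at *; omega
  · rw [validBit, if_pos hlt]
  · have := marked_update src (s.arr flag) he 0 u
    have := hcnt u hu
    rw [Function.update_apply]
    split_ifs with h
    · subst h; simp only [if_true] at *; omega
    · rw [if_neg (Ne.symm h), if_neg (Ne.symm h)] at *; omega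
  · rw [validBit, if_neg hlt]

theorem Input.wp_recheckAll (D : Input K n d m v₀ src tgt own pr N) {L : ℕ → ℕ} {s : State}
    (hs : Static L n d m N src tgt own s) {v : ℕ} (hv : v < n)
    (hpos : s.reg pos = v * (m + m)) (hlim : s.reg lim = v * (m + m) + s.arr deg v)
    (hflag : ∀ x < m, s.arr flag x ≤ 1)
    (hcnt : ∀ u < n, s.arr cnt u = marked src (s.arr flag) m u)
    (hq : s.reg tail + s.arr deg v + 1 < K.bound) :
    Wp K (.while pos lim recheck) (fun s' => s'.time = s.time + s.arr deg v ∧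
      s'.reg tail = s.reg tail + s.arr deg v ∧
      (∀ i < s.reg tail, s'.arr queue i = s.arr queue i) ∧
      (∀ i < s.arr deg v, s'.arr queue (s.reg tail + i) = src (s.arr adj (v * (m + m) + i))) ∧
      (∀ u < n, s'.arr cnt u = marked src (s'.arr flag) m u) ∧
      (∀ e < m, s'.arr flag e = validBit src tgt (s.arr lo) (s.arr hi) e ∨
        s'.arr flag e = s.arr flag e ∧ ¬ (src e = v ∨ tgt e = v))) s := by
  have hbase := D.base_le hv
  have hdeg := incidences_le src tgt m v
  rw [← hs.deg v hv] at hdeg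
  set b := v * (m + m) with hb
  refine wp_while (fun s' => ∃ j ≤ s.arr deg v, s'.time = s.time + j ∧ s'.reg pos = b + j ∧
      s'.reg tail = s.reg tail + j ∧
      (∀ i < s.reg tail, s'.arr queue i = s.arr queue i) ∧
      (∀ i < j, s'.arr queue (s.reg tail + i) = src (s.arr adj (b + i))) ∧
      (∀ u < n, s'.arr cnt u = marked src (s'.arr flag) m u) ∧
      (∀ x < m, s'.arr flag x ≤ 1) ∧
      (∀ e < m, s'.arr flag e = validBit src tgt (s.arr lo) (s.arr hi) e ∨
        s'.arr flag e = s.arr flag e ∧ ∀ i < j, s.arr adj (b + i) ≠ e))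
      (s.time + s.arr deg v) ?_ ?_ ?_ ?_ ?_
  · exact ⟨0, Nat.zero_le _, rfl, hpos, rfl, fun _ _ => rfl,
      fun i hi => absurd hi (Nat.not_lt_zero i), hcnt, hflag,
      fun e _ => Or.inr ⟨rfl, fun i hi => absurd hi (Nat.not_lt_zero i)⟩⟩
  · rintro s' ⟨j, hj, ht, -⟩; omega
  · rintro s' - -; exact ⟨trivial, trivial⟩
  · rintro s' g ⟨j, hj, ht, a1, a2, a3, a4, a5, a6, a7⟩ hlt
    simp only [Expr.eval_var, a1, g.reg (v := lim) rfl, hlim] at hlt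
    have hjd : j < s.arr deg v := by omega
    have he : s.arr adj (b + j) < m := ((hs.adj v hv _).2 ⟨j, hjd, rfl⟩).1
    set e := s.arr adj (b + j) with hedef
    have hga := g.arr (j := adj) rfl
    have hgl := g.arr (j := lo) rfl
    have hgh := g.arr (j := hi) rfl
    refine (D.wp_recheck (s := s'.tick) (e := e) (b := b) (j := j) (by simp [hga, ← hedef]) he a1
      a6 a5 (by omega) (by simp [a2]; omega)).mono ?_
    rintro s2 - ⟨c1, c2, c3, c4, c5, c6⟩
    simp only [State.tick_time, State.tick_reg, State.tick_arr, hgl, hgh, a2] at c1 c3 c4 c6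
    refine ⟨j + 1, hjd, by omega, c2, by omega, fun i hi => ?_, fun i hi => ?_, c5, fun x hx => ?_,
      fun x hx => ?_⟩
    · rw [c4, Function.update_of_ne (by omega)]; exact a3 i hi
    · rcases Nat.lt_succ_iff_lt_or_eq.1 hi with h | rfl
      · rw [c4, Function.update_of_ne (by omega)]; exact a4 i h
      · rw [c4, Function.update_self]
    · rw [c6, Function.update_apply]
      split_ifs
      · rw [validBit]; split_ifs <;> omega
      · exact a6 x hx
    · rcases eq_or_ne x e with rfl | hne
      · left; rw [c6, Function.update_self]
      · rw [c6, Function.update_of_ne hne]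
        refine (a7 x hx).imp_right fun h => ⟨h.1, fun i hi => ?_⟩
        rcases Nat.lt_succ_iff_lt_or_eq.1 hi with h' | rfl
        · exact h.2 i h'
        · exact hne.symm
  · rintro s' g ⟨j, hj, ht, a1, a2, a3, a4, a5, a6, a7⟩ hlt
    simp only [Expr.eval_var, a1, g.reg (v := lim) rfl, hlim] at hlt
    have : j = s.arr deg v := by omega
    subst this
    refine ⟨ht, a2, a3, a4, a5, fun e he => (a7 e he).imp_right fun h => ⟨h.1, fun hinc => ?_⟩⟩
    obtain ⟨i, hi, heq⟩ := (hs.adj v hv e).1 ⟨he, hinc⟩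
    exact h.2 i hi heq

/-- The search for the next boundary. -/
theorem wp_scan {L : ℕ → ℕ} {s : State} (hsep : ∀ r ≤ N + 1, s.arr sep r = L r)
    (hL : s.reg prio < L (N + 1)) (hK : N + 4 < K.bound) (hp : s.reg prio + 1 < K.bound)
    (hold : s.reg old ≤ N) (hnew : s.reg new = s.reg old + 1) :
    Wp K (.while (sep new) (prio + 1) (set new (new + 1))) (fun s' =>
      s.reg old < s'.reg new ∧ s'.reg new ≤ N + 1 ∧ s'.time + s.reg old + 1 = s.time + s'.reg new ∧
      s.reg prio < L (s'.reg new) ∧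
      ∀ r, s.reg old < r → r < s'.reg new → ¬ s.reg prio < L r) s := by
  refine wp_while (fun s' => s.reg old < s'.reg new ∧ s'.reg new ≤ N + 1 ∧
    s'.time + s.reg old + 1 = s.time + s'.reg new ∧
    ∀ r, s.reg old < r → r < s'.reg new → ¬ s.reg prio < L r) (s.time + N + 1) ?_ ?_ ?_ ?_ ?_
  · exact ⟨by omega, by omega, by omega, fun r h1 h2 => by omega⟩
  · rintro s' ⟨a1, a2, a3, -⟩; omega
  · rintro s' g -
    have := g.reg (v := prio) rfl
    simp [this]; omega
  · rintro s' g ⟨a1, a2, a3, a4⟩ hlt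
    have h1 := g.reg (v := prio) rfl
    have h2 := g.arr (j := sep) rfl
    simp only [Expr.eval_arr, Expr.eval_var, Expr.eval_add, Expr.eval_one, h1, h2] at hlt
    rw [hsep _ a2] at hlt
    have hne : s'.reg new ≠ N + 1 := by
      intro h; rw [h] at hlt; omega
    simp
    refine ⟨by omega, by omega, by omega, by omega, fun r h3 h4 => ?_⟩
    rcases Nat.lt_succ_iff_lt_or_eq.1 (Nat.lt_succ_of_le h4) with h5 | rfl
    · have := a4 r h3 h5; omega
    · omega
  · rintro s' g ⟨a1, a2, a3, a4⟩ hlt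
    have h1 := g.reg (v := prio) rfl
    have h2 := g.arr (j := sep) rfl
    simp only [Expr.eval_arr, Expr.eval_var, Expr.eval_add, Expr.eval_one, h1, h2] at hlt
    rw [hsep _ a2] at hlt
    exact ⟨a1, a2, a3, by omega, a4⟩

end Imp

/-! ### Correctness and time of the value iteration -/

namespace Imp

open Cmd Var Arr

/-- The potential of the value iteration. A lift of `v` raises it by at least the number of
incidences of `v`, and it never exceeds `2 * m * (N + 1)`. -/
def work (src tgt : ℕ → ℕ) (n m : ℕ) (hi : ℕ → ℕ) : ℕ :=
  ∑ v ∈ Finset.range n, hi v * incidences src tgt m v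

theorem work_update (src tgt : ℕ → ℕ) {n : ℕ} (m : ℕ) (hi : ℕ → ℕ) {v : ℕ} (hv : v < n) (z : ℕ) :
    work src tgt n m (Function.update hi v z) + hi v * incidences src tgt m v =
      work src tgt n m hi + z * incidences src tgt m v := by
  have h := Finset.mem_range.2 hv
  rw [work, work, ← Finset.add_sum_erase _ _ h, ← Finset.add_sum_erase _ (fun u =>
    hi u * incidences src tgt m u) h]
  have : ∑ u ∈ (Finset.range n).erase v, Function.update hi v z u * incidences src tgt m u =
      ∑ u ∈ (Finset.range n).erase v, hi u * incidences src tgt m u :=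
    Finset.sum_congr rfl fun y hy => by rw [Function.update_of_ne (Finset.ne_of_mem_erase hy)]
  rw [this, Function.update_self]
  ring

variable {K : Context} {n d m v₀ N : ℕ} {src tgt own pr : ℕ → ℕ}

theorem Input.work_le (D : Input K n d m v₀ src tgt own pr N) {hi : ℕ → ℕ}
    (hhi : ∀ v < n, hi v ≤ N + 1) : work src tgt n m hi ≤ (N + 1) * (m + m) := by
  calc work src tgt n m hi ≤ ∑ v ∈ Finset.range n, (N + 1) * incidences src tgt m v :=
        Finset.sum_le_sum fun v hv => Nat.mul_le_mul_right _ (hhi v (Finset.mem_range.1 hv))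
    _ = (N + 1) * ∑ x ∈ Finset.range m, ∑ v ∈ Finset.range n,
          ((if src x = v then 1 else 0) + (if tgt x = v then 1 else 0)) := by
        rw [← Finset.mul_sum, Finset.sum_comm]; rfl
    _ = (N + 1) * (m + m) := by
        congr 1
        rw [Finset.sum_congr rfl (g := fun _ => 2)]
        · simp; omega
        · intro x hx
          have h1 := D.src_lt x (Finset.mem_range.1 hx)
          have h2 := D.tgt_lt x (Finset.mem_range.1 hx)
          rw [Finset.sum_add_distrib, Finset.sum_ite_eq, Finset.sum_ite_eq]
          simp [h1, h2]

/-- Lifting preserves the upper bound `Y` for the positions. This is the only property of a solution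
used in the analysis of the program. -/
def LiftBound (L : ℕ → ℕ) (n m N : ℕ) (src tgt own pr Y : ℕ → ℕ) : Prop :=
  ∀ lo hi : ℕ → ℕ, (∀ v < n, IsBlock L (pr v) (lo v) (hi v)) → (∀ v < n, hi v ≤ Y v) →
    ∀ v < n, hi v ≤ N → marked src (validBit src tgt lo hi) m v < threshold src own m v →
      ∀ z, (∀ r, hi v < r → r < z → ¬ pr v < L r) → z ≤ Y v

/-- The invariant of the value iteration, started at time `t₀`. All vertices which need a lift are
in the queue, except for those satisfying `E`, which is used for the vertex just taken from the
queue. The length of the queue and the time are bounded by means of the potential `work`. -/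
structure SolveInv (L : ℕ → ℕ) (n d m N : ℕ) (src tgt own pr Y : ℕ → ℕ) (t₀ : ℕ)
    (E : ℕ → Prop) (s : State) : Prop where
  static : Static L n d m N src tgt own s
  isBlock : ∀ v < n, IsBlock L (pr v) (s.arr lo v) (s.arr hi v)
  hi_le : ∀ v < n, s.arr hi v ≤ N + 1
  le_bound : ∀ v < n, s.arr hi v ≤ Y v
  flag : ∀ e < m, s.arr flag e = validBit src tgt (s.arr lo) (s.arr hi) e
  cnt : ∀ u < n, s.arr cnt u = marked src (s.arr .flag) m u
  head_le : s.reg head ≤ s.reg tail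
  queue_lt : ∀ i < s.reg tail, s.arr queue i < n
  covers : ∀ u < n, s.arr hi u ≤ N → s.arr .cnt u < threshold src own m u →
    E u ∨ ∃ i, s.reg head ≤ i ∧ i < s.reg tail ∧ s.arr queue i = u
  tail_le : s.reg tail ≤ n + work src tgt n m (s.arr hi)
  time : s.time ≤ t₀ + s.reg head + work src tgt n m (s.arr hi)

theorem validBit_le_one (src tgt lo hi : ℕ → ℕ) (e : ℕ) : validBit src tgt lo hi e ≤ 1 := by
  rw [validBit]; split_ifs <;> omega

theorem Input.incidences_pos (D : Input K n d m v₀ src tgt own pr N) {v : ℕ} (hv : v < n) :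
    0 < incidences src tgt m v := by
  obtain ⟨e, he, hev⟩ := D.exists_edge v hv
  have := Finset.single_le_sum (f := fun x => (if src x = v then 1 else 0) +
    (if tgt x = v then 1 else 0)) (fun _ _ => Nat.zero_le _) (Finset.mem_range.2 he)
  simp only [hev, if_true] at this
  rw [incidences]
  omega

/-- The second half of a lift: when the new pair of positions of `v` has been stored, rechecking the
edges incident to `v` restores the invariant. The time for finding the new position `z` and for the
rechecks is paid for by the increase of the potential. -/
theorem Input.wp_finishLift (D : Input K n d m v₀ src tgt own pr N) {L : ℕ → ℕ} {Y : ℕ → ℕ}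
    {t₀ v z : ℕ} {s s3 : State} (inv : SolveInv L n d m N src tgt own pr Y t₀ (· = v) s)
    (hv : v < n) (hz : s.arr hi v < z) (hzN : z ≤ N + 1) (hzY : z ≤ Y v) (hLz : pr v < L z)
    (hno : ∀ r, s.arr hi v < r → r < z → ¬ pr v < L r)
    (g : Agree lift s s3) (htime : s3.time + s.arr hi v + 1 = s.time + z)
    (hhead : s3.reg head = s.reg head) (htail : s3.reg tail = s.reg tail)
    (hqueue : s3.arr queue = s.arr queue) (hflag : s3.arr flag = s.arr flag)
    (hcnt : s3.arr cnt = s.arr cnt) (hvert : s3.reg vert = v)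
    (hhi : s3.arr hi = Function.update (s.arr hi) v z)
    (hlo : s3.arr lo = Function.update (s.arr lo) v (if Even (pr v) then s.arr hi v else z)) :
    Wp K (block [set pos (base vert), set lim (base vert + deg vert), .while pos lim recheck])
      (SolveInv L n d m N src tgt own pr Y t₀ (fun _ => False)) s3 := by
  have hst : Static L n d m N src tgt own s3 := inv.static.of_agree g (by decide)
  have hdeg := hst.deg v hv
  have hdpos := D.incidences_pos hv
  have hbase := hst.base v hv.le
  have hwork := work_update src tgt m (s.arr hi) hv z
  rw [← hhi] at hwork
  have hhile : ∀ u < n, s3.arr hi u ≤ N + 1 := by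
    intro u hu
    rw [hhi, Function.update_apply]
    split_ifs
    · exact hzN
    · exact inv.hi_le u hu
  have hworkle := D.work_le hhile
  have hqb := D.queue_lt
  have htl := inv.tail_le
  have hti := inv.time
  have hdle := incidences_le src tgt m v
  have hbb := D.base_le hv
  -- Since `v` has an incident edge, the positions skipped are paid for by the potential, too.
  have hmul : s.arr hi v * incidences src tgt m v + (z - s.arr hi v - 1) +
      incidences src tgt m v ≤ z * incidences src tgt m v := by
    obtain ⟨δ, rfl⟩ := Nat.exists_eq_add_of_lt hz
    have : s.arr hi v + δ + 1 - s.arr hi v - 1 = δ := by omega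
    rw [this]
    nlinarith
  simp only [wp_block_cons, wp_block_nil, wp_set, Expr.ok_arr, Expr.ok_var, Expr.ok_add,
    Expr.eval_arr, Expr.eval_var, Expr.eval_add, State.setReg_reg, State.setReg_arr, reduceCtorEq,
    if_false, hvert, hbase, hdeg, true_and]
  refine ⟨by omega, ?_⟩
  set s4 := (s3.setReg pos (v * (m + m))).setReg lim (v * (m + m) + incidences src tgt m v) with hs4
  have ha4 : s4.arr = s3.arr := rfl
  have hr4 : ∀ x, x ≠ pos → x ≠ lim → s4.reg x = s3.reg x := by
    intro x h1 h2; simp [hs4, h1, h2]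
  have ht4 : s4.time = s3.time := rfl
  have hst4 : Static L n d m N src tgt own s4 :=
    ⟨by rw [hr4 _ (by decide) (by decide)]; exact hst.leaves, hst.sep, hst.even, hst.base, hst.deg,
      hst.thr, hst.adj⟩
  refine (D.wp_recheckAll hst4 hv (by simp [hs4]) (by simp [hs4, hdeg]) ?_ ?_ ?_).mono ?_
  · intro x hx
    rw [ha4, hflag, inv.flag x hx]
    exact validBit_le_one _ _ _ _ _
  · intro u hu
    rw [ha4, hflag, hcnt]
    exact inv.cnt u hu
  · rw [hr4 _ (by decide) (by decide), htail, ha4, hdeg]; omega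
  rw [ha4, hdeg, hr4 _ (by decide) (by decide), ht4, htail, hqueue, hflag]
  rintro s5 g5 ⟨c1, c2, c3, c4, c5, c6⟩
  have e1 : s5.arr lo = s3.arr lo := g5.arr rfl
  have e2 : s5.arr hi = s3.arr hi := g5.arr rfl
  have e3 : s5.reg head = s.reg head :=
    (g5.reg rfl).trans ((hr4 _ (by decide) (by decide)).trans hhead)
  have hst5 : Static L n d m N src tgt own s5 := hst4.of_agree g5 (by decide)
  have hsame : ∀ e < m, ¬ (src e = v ∨ tgt e = v) →
      validBit src tgt (s3.arr lo) (s3.arr hi) e = s.arr flag e := by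
    intro e he hinc
    rw [inv.flag e he, validBit, validBit, hlo, hhi, Function.update_of_ne (fun h => hinc (.inr h)),
      Function.update_of_ne (fun h => hinc (.inl h))]
  have hflag5 : ∀ e < m, s5.arr flag e = validBit src tgt (s3.arr lo) (s3.arr hi) e := by
    intro e he
    rcases c6 e he with h | ⟨h1, h2⟩
    · exact h
    · rw [h1, hsame e he h2]
  refine ⟨hst5, fun u hu => ?_, ?_, fun u hu => ?_, ?_, c5, ?_, fun i hi => ?_,
    fun u hu h1 h2 => ?_, ?_, ?_⟩
  · rw [e1, e2, hlo, hhi]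
    rcases eq_or_ne u v with rfl | hne
    · rw [Function.update_self, Function.update_self]
      have hb := inv.isBlock u hu
      rcases Nat.even_or_odd (pr u) with hp | hp
      · rw [if_pos hp]
        exact ⟨hb.lt_hi, hLz, fun h => absurd hp (Nat.not_even_iff_odd.2 h), fun _ => Or.inl hz,
          fun _ => hno⟩
      · rw [if_neg (Nat.not_even_iff_odd.2 hp)]
        exact ⟨hLz, hLz, fun _ => rfl, fun h => absurd h (Nat.not_even_iff_odd.2 hp),
          fun h => absurd h (Nat.not_even_iff_odd.2 hp)⟩
    · rw [Function.update_of_ne hne, Function.update_of_ne hne]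
      exact inv.isBlock u hu
  · rw [e2]; exact hhile
  · rw [e2, hhi, Function.update_apply]
    split_ifs with h
    · rw [h]; exact hzY
    · exact inv.le_bound u hu
  · rw [e1, e2]; exact hflag5
  · rw [e3, c2]; have := inv.head_le; omega
  · rcases lt_or_ge i (s.reg tail) with h | h
    · rw [c3 i h]; exact inv.queue_lt i h
    · obtain ⟨j, rfl⟩ := Nat.exists_eq_add_of_le h
      rw [c2] at hi
      have hj : j < incidences src tgt m v := by omega
      rw [c4 j hj]
      exact D.src_lt _ ((hst.adj v hv _).2 ⟨j, by omega, rfl⟩).1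
  · right
    have hhl := inv.head_le
    -- The count of `u` has changed only if an edge leaving `u` is incident to `v`, and then `u` has
    -- been put into the queue.
    by_cases hex : ∃ e < m, src e = u ∧ (src e = v ∨ tgt e = v)
    · obtain ⟨e, he, rfl, hinc⟩ := hex
      obtain ⟨i, hi, hie⟩ := (hst.adj v hv e).1 ⟨he, hinc⟩
      rw [hdeg] at hi
      exact ⟨s.reg tail + i, by omega, by omega, by rw [c4 i hi, hie]⟩
    · push Not at hex
      have huv : u ≠ v := by
        rintro rfl
        obtain ⟨e, he, heu⟩ := D.exists_edge u hu
        exact (hex e he heu).1 heu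
      rw [e2, hhi, Function.update_of_ne huv] at h1
      have hc : s5.arr cnt u = s.arr cnt u := by
        rw [c5 u hu, inv.cnt u hu]
        refine marked_congr fun e he heu => ?_
        rw [hflag5 e he, hsame e he (not_or.2 (hex e he heu))]
      rw [hc] at h2
      rcases inv.covers u hu h1 h2 with h | ⟨i, h3, h4, h5⟩
      · exact absurd h huv
      · exact ⟨i, by omega, by omega, by rw [c3 i h4]; exact h5⟩
  · rw [c2, e2]; omega
  · rw [e3, e2]; omega

theorem Input.wp_lift (D : Input K n d m v₀ src tgt own pr N) {L : ℕ → ℕ} {Y : ℕ → ℕ}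
    {t₀ v : ℕ} (hY : LiftBound L n m N src tgt own pr Y) (hL : d < L (N + 1))
    {s : State} (inv : SolveInv L n d m N src tgt own pr Y t₀ (· = v) s)
    (hv : v < n) (hvert : s.reg vert = v) (hN : s.arr hi v ≤ N)
    (hneed : s.arr cnt v < threshold src own m v) :
    Wp K lift (SolveInv L n d m N src tgt own pr Y t₀ (fun _ => False)) s := by
  have h1 := D.lt_bound
  have h2 := D.len_eq
  have h5 := D.len_lt
  have h6 := D.leaves_lt
  have h7 := D.prio_lt
  have hpr := D.inp_prio v hv
  have hple := D.prio_le v hv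
  have key : ∀ z, (∀ r, s.arr hi v < r → r < z → ¬ pr v < L r) → z ≤ Y v := by
    refine hY (s.arr lo) (s.arr hi) inv.isBlock inv.le_bound v hv hN ?_
    rw [← marked_congr fun e he _ => inv.flag e he, ← inv.cnt v hv]
    exact hneed
  simp only [lift, wp_block_cons, wp_set, prioOf, Expr.ok_inp, Expr.ok_add, Expr.ok_five,
    Expr.ok_var, Expr.ok_arr, Expr.ok_one, Expr.eval_inp, Expr.eval_add, Expr.eval_five,
    Expr.eval_var, Expr.eval_arr, Expr.eval_one, State.setReg_reg, State.setReg_arr, reduceCtorEq,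
    if_true, if_false, hvert, hpr, true_and]
  refine ⟨by omega, by omega, ?_⟩
  set s1 := ((s.setReg prio (pr v)).setReg old (s.arr hi v)).setReg new (s.arr hi v + 1) with hs1
  have p1 : s1.reg prio = pr v := by simp [hs1]
  have p2 : s1.reg old = s.arr hi v := by simp [hs1]
  have p3 : s1.reg new = s.arr hi v + 1 := by simp [hs1]
  have g1 : Agree lift s s1 := by
    constructor
    · intro x hx
      have hx' : x ≠ prio ∧ x ≠ old ∧ x ≠ new := by
        refine ⟨?_, ?_, ?_⟩ <;> rintro rfl <;> exact absurd hx (by decide)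
      simp [hs1, hx']
    · intro j _; rfl
  refine (wp_scan (s := s1) (L := L) (N := N) inv.static.sep (by omega) h6 (by omega) (by omega)
    (by omega)).mono ?_
  rintro s2 g2 ⟨q1, q2, q3, q4, q5⟩
  rw [p2] at q1 q3
  rw [p1] at q4
  rw [p1, p2] at q5
  have r1 : s2.reg vert = v := (g2.reg rfl).trans ((g1.reg rfl).trans hvert)
  have r2 : s2.reg prio = pr v := (g2.reg rfl).trans p1
  have r3 : s2.reg old = s.arr hi v := (g2.reg rfl).trans p2
  have r4 : s2.arr = s.arr := funext fun j => g2.arr rfl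
  have r5 : s2.arr even (pr v) = if Even (pr v) then 1 else 0 := by
    rw [r4]; exact inv.static.even _ hple
  have g12 : Agree lift s s2 :=
    g1.trans ⟨fun {x} hx => g2.reg (by
      have : x ≠ new := by rintro rfl; exact absurd hx (by decide)
      simp [Cmd.writes, this]), fun _ => g2.arr rfl⟩
  simp only [wp_store, wp_ite, Expr.ok_var, Expr.ok_arr, Expr.ok_zero, Expr.eval_var,
    Expr.eval_arr, Expr.eval_zero, State.setArr_reg, State.setArr_arr, reduceCtorEq, if_false,
    r1, r2, r5, true_and]
  refine ⟨by omega, fun hp => ?_, fun hp => ?_⟩ <;>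
    simp only [← wp_block_cons, r3, r1] at *
  · have hev : Even (pr v) := by by_contra h; simp [h] at hp
    refine D.wp_finishLift inv hv q1 q2 (key _ q5) q4 q5 ?_ (by simp; exact q3) ?_ ?_ ?_ ?_ ?_ ?_
      ?_ ?_
    · refine g12.trans ⟨fun _ => rfl, fun {j} hj => ?_⟩
      have : j ≠ hi ∧ j ≠ lo := by
        refine ⟨?_, ?_⟩ <;> rintro rfl <;> exact absurd hj (by decide)
      simp [this]
    · exact g12.reg rfl
    · exact (g2.reg rfl).trans (by simp [hs1])
    · simp [r4]
    · simp [r4]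
    · simp [r4]
    · exact (g2.reg rfl).trans ((g1.reg rfl).trans hvert)
    · simp [r4]
    · simp [r4, hev]
  · have hev : ¬ Even (pr v) := by intro h; simp [h] at hp
    refine D.wp_finishLift inv hv q1 q2 (key _ q5) q4 q5 ?_ (by simp; exact q3) ?_ ?_ ?_ ?_ ?_ ?_
      ?_ ?_
    · refine g12.trans ⟨fun _ => rfl, fun {j} hj => ?_⟩
      have : j ≠ hi ∧ j ≠ lo := by
        refine ⟨?_, ?_⟩ <;> rintro rfl <;> exact absurd hj (by decide)
      simp [this]
    · exact g12.reg rfl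
    · exact (g2.reg rfl).trans (by simp [hs1])
    · simp [r4]
    · simp [r4]
    · simp [r4]
    · exact (g2.reg rfl).trans ((g1.reg rfl).trans hvert)
    · simp [r4]
    · simp [r4, hev]

theorem Input.wp_solve (D : Input K n d m v₀ src tgt own pr N) {L : ℕ → ℕ} {Y : ℕ → ℕ}
    (hY : LiftBound L n m N src tgt own pr Y) (hL0 : d < L 0) (hL : d < L (N + 1))
    {s : State} (hs : Static L n d m N src tgt own s) (htail : s.reg tail = n)
    (hqueue : ∀ v < n, s.arr queue v = v)
    (hzero : ∀ i, s.arr lo i = 0 ∧ s.arr hi i = 0 ∧ s.arr flag i = 0 ∧ s.arr cnt i = 0) :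
    Wp K solve (fun s' => s'.time ≤ s.time + n + 2 * ((N + 1) * (m + m)) ∧ s'.reg leaves = N ∧
      (∀ v < n, IsBlock L (pr v) (s'.arr lo v) (s'.arr hi v)) ∧
      (∀ v < n, s'.arr hi v ≤ N + 1) ∧ (∀ v < n, s'.arr hi v ≤ Y v) ∧
      ∀ v < n, s'.arr hi v ≤ N →
        ¬ marked src (validBit src tgt (s'.arr lo) (s'.arr hi)) m v < threshold src own m v) s := by
  have h1 := D.lt_bound
  have hqb := D.queue_lt
  have hlb := D.leaves_lt
  have hT : ∀ s', SolveInv L n d m N src tgt own pr Y s.time (fun _ => False) s' →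
      s'.time ≤ s.time + n + 2 * ((N + 1) * (m + m)) := by
    intro s' inv
    have := inv.time
    have := inv.tail_le
    have := inv.head_le
    have := D.work_le inv.hi_le
    omega
  simp only [solve, wp_block_cons, wp_block_nil, wp_set]
  refine ⟨by simp; omega, ?_⟩
  refine wp_while (SolveInv L n d m N src tgt own pr Y s.time (fun _ => False)) _ ?_ hT ?_ ?_ ?_
  · have hw : work src tgt n m (s.arr hi) = 0 := by simp [work, hzero]
    refine ⟨⟨by simp [hs.leaves], hs.sep, hs.even, hs.base, hs.deg, hs.thr, hs.adj⟩, fun v hv => ?_,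
      ?_, ?_, ?_, ?_, ?_, fun i hi => ?_, fun u hu _ _ => ?_, ?_, ?_⟩
    · have := D.prio_le v hv
      simp only [State.setReg_arr, hzero]
      exact ⟨by omega, by omega, fun _ => rfl, fun _ => Or.inr ⟨rfl, rfl⟩, fun _ r _ h => by omega⟩
    · simp [hzero]
    · simp [hzero]
    · simp [hzero, validBit]
    · simp [hzero, marked]
    · simp
    · simp [htail] at hi ⊢; rw [hqueue i hi]; exact hi
    · exact Or.inr ⟨u, by simp, by simpa [htail] using hu, hqueue u hu⟩
    · simp [htail]
    · simp
  · rintro s' - -; exact ⟨trivial, trivial⟩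
  · rintro s' - inv hlt
    simp only [Expr.eval_var] at hlt
    have hvn := inv.queue_lt _ hlt
    have htl := inv.tail_le
    have hwl := D.work_le inv.hi_le
    have hle := inv.static.leaves
    set v := s'.arr queue (s'.reg head) with hvdef
    have hthr := inv.static.thr v hvn
    simp only [wp_block_cons, wp_block_nil, wp_set, wp_ite, wp_skip, Expr.ok_var, Expr.ok_arr,
      Expr.ok_add, Expr.ok_one, Expr.eval_var, Expr.eval_arr, Expr.eval_add, Expr.eval_one,
      State.setReg_reg, State.setReg_arr, State.tick_reg, State.tick_arr, reduceCtorEq, if_true,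
      if_false, ← hvdef, hle, hthr, true_and]
    set s1 := (s'.tick.setReg vert v).setReg head (s'.reg head + 1) with hs1
    have a1 : s1.arr = s'.arr := rfl
    have a2 : s1.reg head = s'.reg head + 1 := by simp [hs1]
    have a3 : s1.reg tail = s'.reg tail := by simp [hs1]
    have a4 : s1.time = s'.time + 1 := rfl
    have a5 : s1.reg vert = v := by simp [hs1]
    have inv1 : SolveInv L n d m N src tgt own pr Y s.time (· = v) s1 := by
      refine ⟨⟨by simp [hs1, hle], inv.static.sep, inv.static.even, inv.static.base, inv.static.deg,
        inv.static.thr, inv.static.adj⟩, inv.isBlock, inv.hi_le, inv.le_bound, inv.flag, inv.cnt,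
        by omega, by rw [a3]; exact inv.queue_lt, fun u hu h1 h2 => ?_, by rw [a3]; exact htl, ?_⟩
      · rcases inv.covers u hu h1 h2 with h | ⟨i, h3, h4, h5⟩
        · exact h.elim
        · rcases h3.lt_or_eq with h6 | rfl
          · exact Or.inr ⟨i, by omega, by omega, h5⟩
          · exact Or.inl h5.symm
      · have := inv.time
        rw [a4, a2, a1]; omega
    have done : ¬ (s'.arr hi v ≤ N ∧ s'.arr cnt v < threshold src own m v) →
        SolveInv L n d m N src tgt own pr Y s.time (fun _ => False) s1 := by
      intro h
      refine { inv1 with covers := fun u hu h1 h2 => ?_ }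
      rcases inv1.covers u hu h1 h2 with rfl | h3
      · exact absurd ⟨h1, h2⟩ h
      · exact Or.inr h3
    refine ⟨by omega, by omega, fun h2 => ⟨fun h3 => ?_, fun h3 => done fun h => h3 h.2⟩,
      fun h2 => done fun h => h2 (by omega)⟩
    exact D.wp_lift hY hL inv1 hvn a5 (by rw [a1]; omega) h3
  · rintro s' - inv hlt
    simp only [Expr.eval_var, not_lt] at hlt
    refine ⟨hT s' inv, inv.static.leaves, inv.isBlock, inv.hi_le, inv.le_bound,
      fun v hv h2 h3 => ?_⟩
    rw [← marked_congr fun e he _ => inv.flag e he, ← inv.cnt v hv] at h3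
    rcases inv.covers v hv h2 h3 with h | ⟨i, h4, h5, -⟩
    · exact h
    · omega

end Imp

/-! ### The complete algorithm -/

namespace Imp

open Cmd Var Arr

/-- The algorithm: all tables are set up, the value iteration is run, and the value of the initial
vertex is inspected. -/
def solver : Cmd := block [parityTable, computeLog, generate, layout, connect, solve, answer]

/-- The state in which all variables and all array entries are `0`. -/
def State.zero : State := ⟨fun _ => 0, fun _ _ => 0, 0⟩

variable {K : Context} {n d m v₀ N : ℕ} {src tgt own pr : ℕ → ℕ}

theorem Input.wp_solver (D : Input K n d m v₀ src tgt own pr N) (hd : Even d)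
    (hN : ParityGame.leaves (Nat.log 2 n) d = N) {Y : ℕ → ℕ}
    (hY : LiftBound (ParityGame.separators (Nat.log 2 n) d) n m N src tgt own pr Y) :
    Wp K solver (fun s => s.time ≤ d + 3 * n + m + 2 * N + 2 * ((N + 1) * (m + m)) ∧
      ∃ lo hi : ℕ → ℕ,
        (∀ v < n, IsBlock (ParityGame.separators (Nat.log 2 n) d) (pr v) (lo v) (hi v)) ∧
        (∀ v < n, hi v ≤ N + 1) ∧ (∀ v < n, hi v ≤ Y v) ∧
        (∀ v < n, hi v ≤ N →
          ¬ marked src (validBit src tgt lo hi) m v < threshold src own m v) ∧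
        s.reg out = if hi v₀ ≤ N then 1 else 0) State.zero := by
  have hL0 : d < ParityGame.separators (Nat.log 2 n) d 0 := by
    rw [ParityGame.separators_zero]; omega
  have hL : d < ParityGame.separators (Nat.log 2 n) d (N + 1) := by
    rw [← hN, ParityGame.separators_leaves_add_one]; omega
  have hlb := D.leaves_lt
  have hlt := D.lt_bound
  have hlen := D.len_eq
  have h3 := D.inp_three
  simp only [solver, wp_block_cons, wp_block_nil]
  refine D.wp_parityTable.mono fun s1 g1 ⟨t1, e1⟩ => D.wp_computeLog.mono fun s2 g2 ⟨t2, e2⟩ => ?_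
  have hlog : s2.reg log = Nat.log 2 n := (Nat.log_eq_of_pow_le_of_lt_pow e2.1 e2.2).symm
  refine (D.wp_generate hd (by rw [hlog, hN])).mono fun s3 g3 ⟨t3, e3, e3'⟩ => ?_
  refine (D.wp_layout ?_).mono fun s4 g4 ⟨t4, e4, e4', e4''⟩ => ?_
  · rw [g3.arr rfl, g2.arr rfl, g1.arr rfl]; rfl
  refine (D.wp_connect e4' (fun v => ?_) (fun v => ?_)).mono fun s5 g5 ⟨t5, e5, e5', e5''⟩ => ?_
  · rw [g4.arr rfl, g3.arr rfl, g2.arr rfl, g1.arr rfl]; rfl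
  · rw [g4.arr rfl, g3.arr rfl, g2.arr rfl, g1.arr rfl]; rfl
  refine (D.wp_solve hY hL0 hL ⟨?_, fun r hr => ?_, ?_, ?_, e5, e5', e5''⟩ ?_ ?_ fun i => ?_).mono
    fun s6 g6 ⟨t6, e6, b1, b2, b3, b4⟩ => ?_
  · rw [g5.reg rfl, g4.reg rfl, e3]
  · rw [g5.arr rfl, g4.arr rfl, e3' r hr, hlog]
  · rw [g5.arr rfl, g4.arr rfl, g3.arr rfl, g2.arr rfl]; exact e1
  · rw [g5.arr rfl]; exact e4'
  · rw [g5.reg rfl, e4]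
  · rw [g5.arr rfl]; exact e4''
  · refine ⟨?_, ?_, ?_, ?_⟩ <;>
    · rw [g5.arr rfl, g4.arr rfl, g3.arr rfl, g2.arr rfl, g1.arr rfl]; rfl
  have hT : s6.time ≤ d + 3 * n + m + 2 * N + 2 * ((N + 1) * (m + m)) := by
    have : State.zero.time = 0 := rfl
    omega
  simp only [answer, wp_ite, wp_set, Expr.ok_arr, Expr.ok_inp, Expr.ok_three, Expr.ok_add,
    Expr.ok_var, Expr.ok_one, Expr.ok_zero, Expr.eval_arr, Expr.eval_inp, Expr.eval_three,
    Expr.eval_add, Expr.eval_var, Expr.eval_one, Expr.eval_zero, h3, e6, State.setReg_time,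
    State.setReg_reg, if_true, true_and]
  refine ⟨by omega, by omega, fun h => ⟨by omega, hT, s6.arr .lo, s6.arr .hi, b1, b2, b3, b4, ?_⟩,
    fun h => ⟨by omega, hT, s6.arr .lo, s6.arr .hi, b1, b2, b3, b4, ?_⟩⟩
  · rw [if_pos (by omega)]
  · rw [if_neg (by omega)]

end Imp

/-! ### The algorithm decides the winner -/

namespace ParityGame

open Imp

variable {n d N : ℕ} {G : ParityGame (Fin n) d} {es : List (Fin n × Fin n)}
  {src tgt own pr : ℕ → ℕ}

/-- The functions `src`, `tgt`, `own`, `pr` on natural numbers describe the game `G` whose edges are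
listed by `es`. -/
structure Describes (G : ParityGame (Fin n) d) (es : List (Fin n × Fin n))
    (src tgt own pr : ℕ → ℕ) : Prop where
  mem_iff : ∀ e, e ∈ es ↔ e ∈ G.edges
  src_eq : ∀ e (h : e < es.length), src e = es[e].1
  tgt_eq : ∀ e (h : e < es.length), tgt e = es[e].2
  own_eq : ∀ v : Fin n, own v = if v ∈ G.eve then 1 else 0
  prio_eq : ∀ v : Fin n, pr v = G.prio v

theorem Describes.mem_edges_iff (h : G.Describes es src tgt own pr) {u w : Fin n} :
    (u, w) ∈ G.edges ↔ ∃ e < es.length, src e = u ∧ tgt e = w := by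
  rw [← h.mem_iff, List.mem_iff_getElem]
  constructor
  · rintro ⟨e, he, heq⟩
    exact ⟨e, he, by rw [h.src_eq e he, heq], by rw [h.tgt_eq e he, heq]⟩
  · rintro ⟨e, he, h1, h2⟩
    rw [h.src_eq e he] at h1
    rw [h.tgt_eq e he] at h2
    exact ⟨e, he, Prod.ext (Fin.ext h1) (Fin.ext h2)⟩

theorem Describes.forall_edges_iff (h : G.Describes es src tgt own pr) {u : Fin n} {P : ℕ → Prop} :
    (∀ w : Fin n, (u, w) ∈ G.edges → P w) ↔ ∀ e < es.length, src e = u → P (tgt e) := by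
  constructor
  · intro hP e he hu
    rw [h.tgt_eq e he]
    exact hP _ (h.mem_edges_iff.2 ⟨e, he, hu, h.tgt_eq e he⟩)
  · intro hP w hw
    obtain ⟨e, he, h1, h2⟩ := h.mem_edges_iff.1 hw
    exact h2 ▸ hP e he h1

/-- Counting the valid edges leaving `u` and comparing with the threshold detects the vertices which
need a lift. -/
theorem Describes.needsLift_iff (h : G.Describes es src tgt own pr) (lo hi : ℕ → ℕ) (u : Fin n) :
    G.NeedsLift N (fun v => lo v) (fun v => hi v) u ↔ hi u ≤ N ∧
      marked src (validBit src tgt lo hi) es.length u < threshold src own es.length u := by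
  have hbit : ∀ e, validBit src tgt lo hi e = 0 ↔ hi (src e) ≤ lo (tgt e) := by
    intro e; rw [validBit]; split_ifs <;> simp <;> omega
  have hle : ∀ e ∈ Finset.range es.length,
      (if src e = u then validBit src tgt lo hi e else 0) ≤ if src e = u then 1 else 0 := by
    intro e _
    have := validBit_le_one src tgt lo hi e
    split_ifs <;> omega
  rw [NeedsLift, and_congr_right_iff]
  intro _
  by_cases hu : u ∈ G.eve
  · obtain ⟨w, hw⟩ := G.exists_edge u
    obtain ⟨e₀, he₀, hsrc, -⟩ := h.mem_edges_iff.1 hw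
    have hpos : 1 ≤ marked src (fun _ => 1) es.length u := hsrc ▸ le_marked src (fun _ => 1) he₀
    have hthr : threshold src own es.length u = 1 := by
      rw [threshold, h.own_eq, if_pos hu, if_pos one_pos]; exact min_eq_left hpos
    simp only [hu, hthr, not_true, false_implies, and_true, true_implies, Nat.lt_one_iff]
    rw [h.forall_edges_iff (P := fun w => hi u ≤ lo w), marked, Finset.sum_eq_zero_iff]
    refine ⟨fun hP e he => ?_, fun hP e he hsrc => ?_⟩
    · rw [Finset.mem_range] at he
      split_ifs with hs
      · rw [hbit, hs]; exact hP e he hs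
      · rfl
    · have := hP e (Finset.mem_range.2 he)
      rwa [if_pos hsrc, hbit, hsrc] at this
  · have hthr : threshold src own es.length u = marked src (fun _ => 1) es.length u := by
      rw [threshold, h.own_eq, if_neg hu, if_neg (lt_irrefl 0)]
    simp only [hu, hthr, not_false_eq_true, false_implies, true_and, true_implies]
    rw [← not_iff_not, not_lt]
    push Not
    rw [h.forall_edges_iff (P := fun w => lo w < hi u)]
    have hsum : marked src (validBit src tgt lo hi) es.length u ≤
        marked src (fun _ => 1) es.length u :=
      Finset.sum_le_sum hle
    rw [hsum.ge_iff_eq, marked, marked, Finset.sum_eq_sum_iff_of_le hle]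
    refine ⟨fun hP e he => ?_, fun hP e he hsrc => ?_⟩
    · rw [Finset.mem_range] at he
      split_ifs with hs
      · rw [validBit, hs, if_pos (hP e he hs)]
      · rfl
    · have := hP e (Finset.mem_range.2 he)
      rw [if_pos hsrc, if_pos hsrc] at this
      by_contra hcon
      rw [not_lt, ← hsrc, ← hbit] at hcon
      omega

/-- A solution bounds the values during the whole iteration. -/
theorem Describes.liftBound_of_isSolution (h : G.Describes es src tgt own pr) {L : ℕ → ℕ}
    {lo' hi' : Fin n → ℕ} (hs : G.IsSolution L N lo' hi') :
    LiftBound L n es.length N src tgt own pr (fun v => if hv : v < n then hi' ⟨v, hv⟩ else 0) := by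
  intro lo hi hb hle v hv hN hneed z hz
  simp only [dif_pos hv]
  have hp : ∀ u : Fin n, pr u = G.prio u := h.prio_eq
  refine hs.next_le (lo := fun v : Fin n => lo v) (hi := fun v : Fin n => hi v) (u := ⟨v, hv⟩)
    (fun u => ?_) (fun u => ?_) ((h.needsLift_iff lo hi ⟨v, hv⟩).2 ⟨hN, hneed⟩) (fun r h1 h2 => ?_)
  · rw [← hp]; exact hb u u.2
  · simpa using hle u u.2
  · rw [← hp]; exact hz r h1 h2

theorem Describes.wp_solver (h : G.Describes es src tgt own pr) {K : Context} {v₀ : Fin n}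
    (D : Input K n d es.length v₀ src tgt own pr N) (hd : Even d)
    (hN : leaves (Nat.log 2 n) d = N) :
    Wp K solver (fun s =>
      s.time ≤ d + 3 * n + es.length + 2 * N + 2 * ((N + 1) * (es.length + es.length)) ∧
      (G.EveWins v₀ → s.reg .out = 1) ∧ (¬ G.EveWins v₀ → s.reg .out = 0)) State.zero := by
  have hp : ∀ u : Fin n, pr u = G.prio u := h.prio_eq
  have hcard : Fintype.card (Fin n) < 2 ^ (Nat.log 2 n + 1) := by
    rw [Fintype.card_fin]; exact Nat.lt_pow_succ_log_self one_lt_two n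
  -- If Eve wins, a solution bounds the iteration; otherwise the trivial bound suffices, as the
  -- final positions would yield a winning strategy.
  obtain ⟨Y, hY, hYv⟩ : ∃ Y : ℕ → ℕ,
      LiftBound (separators (Nat.log 2 n) d) n es.length N src tgt own pr Y ∧
        (G.EveWins v₀ → Y v₀ ≤ N) := by
    by_cases hwin : G.EveWins v₀
    · obtain ⟨lo', hi', hs, hv⟩ := hwin.exists_isSolution hd hcard
      rw [hN] at hs hv
      exact ⟨_, h.liftBound_of_isSolution hs, fun _ => by simpa using hv⟩
    · refine ⟨fun _ => N + 1, fun lo hi _ _ v hv hhi _ z hz => ?_, fun h => absurd h hwin⟩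
      by_contra! hcon
      refine hz (N + 1) (by omega) hcon ?_
      have := D.prio_le v hv
      rw [← hN, separators_leaves_add_one]; omega
  refine (D.wp_solver hd hN hY).mono fun s _ ⟨ht, lo, hi, b1, b2, b3, b4, hout⟩ => ⟨ht, ?_⟩
  have hs : G.IsSolution (separators (Nat.log 2 n) d) N (fun v => lo v) (fun v => hi v) :=
    ⟨fun u => hp u ▸ b1 u u.2, fun u => b2 u u.2, fun u hu =>
      b4 u u.2 hu.1 ((h.needsLift_iff lo hi u).1 hu).2⟩
  refine ⟨fun hwin => ?_, fun hwin => ?_⟩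
  · rw [hout, if_pos ((b3 v₀ v₀.2).trans (hYv hwin))]
  · rw [hout, if_neg fun hv => hwin (hs.eveWins ?_ ?_ hv)]
    · rw [separators_zero]; omega
    · rw [← hN, separators_leaves]; omega

end ParityGame

/-! ### Input words -/

theorem List.getD_flatMap_pair {α : Type*} (l : List α) (f g : α → ℕ) (i : ℕ) (h : i < l.length) :
    (l.flatMap fun x => [f x, g x]).getD (i + i) 0 = f l[i] ∧
      (l.flatMap fun x => [f x, g x]).getD (i + i + 1) 0 = g l[i] := by
  induction l generalizing i with
  | nil => simp at h
  | cons a l ih =>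
    rcases i with _ | i
    · simp
    · have := ih i (by simpa using h)
      simp only [List.getElem_cons_succ, ← this.1, ← this.2]
      rw [show i + 1 + (i + 1) = i + i + 2 by ring, show i + i + 2 + 1 = i + i + 1 + 2 by ring]
      constructor <;> rfl

theorem List.length_flatMap_pair {α : Type*} (l : List α) (f g : α → ℕ) :
    (l.flatMap fun x => [f x, g x]).length = l.length + l.length := by
  induction l with
  | nil => rfl
  | cons a l ih => simp only [List.flatMap_cons, List.length_append, ih, List.length_cons,
      List.length_nil]; omega

namespace ParityGame

variable {n d : ℕ} (G : ParityGame (Fin n) d) (es : List (Fin n × Fin n)) (v₀ : Fin n)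

theorem length_encode : (G.encode es v₀).length = 4 + n + n + es.length + es.length := by
  rw [encode, List.length_append, List.length_append, List.length_flatMap_pair,
    List.length_flatMap_pair, List.length_finRange]
  simp only [List.length_cons, List.length_nil]
  omega

theorem getD_encode_vertex (v : Fin n) :
    (G.encode es v₀).getD (4 + v + v) 0 = (if v ∈ G.eve then 1 else 0) ∧
      (G.encode es v₀).getD (5 + v + v) 0 = G.prio v := by
  have hv := v.2
  have h := List.getD_flatMap_pair (List.finRange n) (fun v => if v ∈ G.eve then 1 else 0) G.prio v
    (by simp)
  have hl := List.length_flatMap_pair (List.finRange n) (fun v => if v ∈ G.eve then 1 else 0) G.prio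
  rw [List.length_finRange] at hl
  simp only [List.getElem_finRange, Fin.cast_mk, Fin.eta] at h
  have e1 : 4 + v.val + v.val - 4 = v + v := by omega
  have e2 : 5 + v.val + v.val - 4 = v + v + 1 := by omega
  rw [encode, List.append_assoc]
  constructor
  · rw [List.getD_append_right _ _ _ _ (by simp; omega), List.getD_append _ _ _ _ (by
      rw [hl]; simp; omega)]
    simp only [List.length_cons, List.length_nil, zero_add, Nat.reduceAdd, e1]
    exact h.1
  · rw [List.getD_append_right _ _ _ _ (by simp; omega), List.getD_append _ _ _ _ (by
      rw [hl]; simp; omega)]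
    simp only [List.length_cons, List.length_nil, zero_add, Nat.reduceAdd, e2]
    exact h.2

theorem getD_encode_edge {e : ℕ} (he : e < es.length) :
    (G.encode es v₀).getD (4 + n + n + e + e) 0 = es[e].1 ∧
      (G.encode es v₀).getD (5 + n + n + e + e) 0 = es[e].2 := by
  have h := List.getD_flatMap_pair es (fun e => e.1.val) (fun e => e.2.val) e he
  have hl := List.length_flatMap_pair (List.finRange n) (fun v => if v ∈ G.eve then 1 else 0) G.prio
  rw [List.length_finRange] at hl
  have hl4 : ([n, d, es.length, v₀.val] ++ (List.finRange n).flatMap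
      (fun v => [if v ∈ G.eve then 1 else 0, G.prio v])).length = 4 + n + n := by
    rw [List.length_append, hl]; simp only [List.length_cons, List.length_nil]; omega
  have e1 : 4 + n + n + e + e - (4 + n + n) = e + e := by omega
  have e2 : 5 + n + n + e + e - (4 + n + n) = e + e + 1 := by omega
  rw [encode]
  constructor
  · rw [List.getD_append_right _ _ _ _ (by rw [hl4]; omega), hl4, e1]
    exact h.1
  · rw [List.getD_append_right _ _ _ _ (by rw [hl4]; omega), hl4, e2]
    exact h.2

theorem le_of_mem_encode {x : ℕ} (hx : x ∈ G.encode es v₀) : x ≤ n + d + es.length := by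
  have hv := v₀.2
  simp only [encode, List.mem_append, List.mem_cons, List.not_mem_nil, or_false,
    List.mem_flatMap] at hx
  rcases hx with ((rfl | rfl | rfl | rfl) | ⟨v, -, rfl | rfl⟩) | ⟨e, -, rfl | rfl⟩
  · omega
  · omega
  · omega
  · omega
  · split_ifs <;> omega
  · have := G.prio_le v; omega
  · have := e.1.2; omega
  · have := e.2.2; omega

end ParityGame

/-! ### The initial machine code -/

namespace Imp

/-- The machine code which computes the length `4 + 2 * n + 2 * m` of the input word and puts it
into register `1`, the base address of the arrays. -/
def prelude : RAM.Program :=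
  .seq (.instr (.load 3 3)) (.seq (.instr (.add 3 3 3)) (.seq (.instr (.const 5 2))
    (.seq (.instr (.load 5 5)) (.seq (.instr (.add 5 5 5)) (.seq (.instr (.add 3 3 5))
      (.seq (.instr (.const 1 4)) (.instr (.add 1 1 3))))))))

theorem reaches_prelude {K : Context} {w : List ℕ} (hlen : K.len = w.length)
    (hinp : ∀ a, K.inp a = w.getD a 0) (hw : w.length = 4 + 2 * w.getD 0 0 + 2 * w.getD 2 0)
    (h0 : 16 < K.bound) : Reaches prelude (8 * K.unit) (Sim K State.zero) (RAM.init w) := by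
  have hle := K.len_le
  rw [show 8 * K.unit = K.unit + (K.unit + (K.unit + (K.unit + (K.unit + (K.unit + (K.unit +
    K.unit)))))) by ring]
  rw [hlen, hw] at hle
  set σ := RAM.init w with hσ
  have m0 : σ.mem 0 = w.getD 0 0 := rfl
  have m2 : σ.mem 2 = w.getD 2 0 := rfl
  have r0 : ∀ r, σ.reg r = 0 := fun _ => rfl
  generalize w.getD 0 0 = x at *
  generalize w.getD 2 0 = y at *
  refine Reaches.seq (R := fun σ' => σ' = { σ with reg := Function.update σ.reg 3 x }) ?_ ?_
  · refine reaches_load ?_ ?_ ?_ <;> simp [r0, m0]; omega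
    omega
  rintro _ rfl
  refine Reaches.seq (R := fun σ' => σ' = { σ with reg := Function.update σ.reg 3 (x + x) }) ?_ ?_
  · refine reaches_add ?_ ?_ ?_ <;> simp <;> omega
  rintro _ rfl
  refine Reaches.seq (R := fun σ' => σ' = { σ with
    reg := Function.update (Function.update σ.reg 3 (x + x)) 5 2 }) ?_ ?_
  · exact reaches_const (by omega) rfl
  rintro _ rfl
  refine Reaches.seq (R := fun σ' => σ' = { σ with
    reg := Function.update (Function.update σ.reg 3 (x + x)) 5 y }) ?_ ?_
  · refine reaches_load ?_ ?_ ?_ <;> simp [m2] <;> omega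
  rintro _ rfl
  refine Reaches.seq (R := fun σ' => σ' = { σ with
    reg := Function.update (Function.update σ.reg 3 (x + x)) 5 (y + y) }) ?_ ?_
  · refine reaches_add ?_ ?_ ?_ <;> simp <;> omega
  rintro _ rfl
  refine Reaches.seq (R := fun σ' => σ' = { σ with
    reg := Function.update (Function.update σ.reg 5 (y + y)) 3 (x + x + (y + y)) }) ?_ ?_
  · refine reaches_add ?_ ?_ ?_
    · simp; omega
    · simp; omega
    · rw [Function.update_comm (by decide) _ _ σ.reg]; simp
  rintro _ rfl
  refine Reaches.seq (R := fun σ' => σ' = { σ with reg := Function.update (Function.update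
    (Function.update σ.reg 5 (y + y)) 3 (x + x + (y + y))) 1 4 }) ?_ ?_
  · exact reaches_const (by omega) rfl
  rintro _ rfl
  refine reaches_add ?_ ?_ ⟨fun v => ?_, ?_, fun j i => ?_, fun a ha => (hinp a).symm, fun _ => ?_,
    fun _ _ => ?_⟩
  · simp; omega
  · simp; omega
  · have h1 : 2 * v.code ≠ 1 := by omega
    have h3 : 2 * v.code ≠ 3 := by omega
    have h5 : 2 * v.code ≠ 5 := by omega
    simp [Function.update_of_ne, h1, h3, h5, r0, State.zero]
  · simp [hlen, hw]; omega
  · exact List.getD_eq_default _ _ (by rw [hlen]; omega)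
  · exact (Nat.zero_le _).trans_lt h0
  · exact (Nat.zero_le _).trans_lt h0

end Imp

/-! ### The numbers involved -/

theorem Nat.choose_add_le_pow (k h : ℕ) : (k + h).choose k ≤ (h + 1) ^ k := by
  induction h generalizing k with
  | zero => simp
  | succ h ih =>
    induction k with
    | zero => simp
    | succ k ihk =>
      have h1 := ih (k + 1)
      have h2 : (h + 1) ^ k ≤ (h + 1 + 1) ^ k := Nat.pow_le_pow_left (by omega) k
      rw [show k + 1 + (h + 1) = k + (h + 1) + 1 by ring, Nat.choose_succ_succ,
        show k + (h + 1) = k + 1 + h by ring]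
      rw [show k + (h + 1) = k + 1 + h by ring] at ihk
      calc _ ≤ (h + 1 + 1) ^ k + (h + 1) ^ (k + 1) := add_le_add ihk h1
        _ ≤ (h + 1 + 1) ^ k + (h + 1 + 1) ^ k * (h + 1) := by rw [pow_succ (h + 1)]; gcongr
        _ = (h + 1 + 1) ^ (k + 1) := by ring

namespace ParityGame

variable {n d : ℕ}

theorem le_card_edges (G : ParityGame (Fin n) d) : n ≤ G.edges.card := by
  choose f hf using G.exists_edge
  have := Finset.card_le_card_of_injOn (s := Finset.univ) (fun v => (v, f v)) (fun v _ => hf v)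
    (fun a _ b _ h => (Prod.ext_iff.1 h).1)
  simpa using this

theorem card_edges_le (G : ParityGame (Fin n) d) : G.edges.card ≤ n * n := by
  simpa using G.edges.card_le_univ

/-- A strict upper bound for all numbers the algorithm computes with. -/
def valueBound (n m d N : ℕ) : ℕ := 32 * (n * m * (N + d + 1))

theorem valueBound_spec {n m : ℕ} (hn : 0 < n) (hm : 0 < m) (d N : ℕ) :
    n + d + m + 10 < valueBound n m d N ∧ 4 + n + n + m + m < valueBound n m d N ∧
      N + 4 < valueBound n m d N ∧ n * (m + m) + m + m + 1 < valueBound n m d N ∧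
      n + (N + 1) * (m + m) + 1 < valueBound n m d N ∧ 16 < valueBound n m d N := by
  rw [valueBound]
  have h1 : n * m ≤ n * m * (N + d + 1) := Nat.le_mul_of_pos_right _ (by omega)
  have h2 : n ≤ n * m := Nat.le_mul_of_pos_right _ hm
  have h3 : m ≤ n * m := Nat.le_mul_of_pos_left _ hn
  have h4 : N + d + 1 ≤ n * m * (N + d + 1) := Nat.le_mul_of_pos_left _ (by positivity)
  have h5 : (N + 1) * m ≤ n * m * (N + d + 1) := by
    rw [mul_comm (N + 1)]
    exact Nat.mul_le_mul h3 (by omega)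
  have h6 : n * (m + m) = n * m + n * m := mul_add _ _ _
  have h7 : (N + 1) * (m + m) = (N + 1) * m + (N + 1) * m := mul_add _ _ _
  omega

/-- The context in which the algorithm runs on the given input. -/
def context (G : ParityGame (Fin n) d) (es : List (Fin n × Fin n)) (v₀ : Fin n) (N : ℕ)
    (hes : 0 < es.length) : Imp.Context where
  bound := valueBound n es.length d N
  len := (G.encode es v₀).length
  inp a := (G.encode es v₀).getD a 0
  len_le := by
    have := valueBound_spec v₀.pos hes d N
    rw [length_encode]
    omega
  inp_lt a ha := by
    have := valueBound_spec v₀.pos hes d N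
    rw [List.getD_eq_getElem _ _ ha]
    have := G.le_of_mem_encode es v₀ (List.getElem_mem ha)
    omega

theorem exists_describes (G : ParityGame (Fin n) d) {es : List (Fin n × Fin n)} (v₀ : Fin n)
    (N : ℕ) (hes : 0 < es.length) (hmem : ∀ e, e ∈ es ↔ e ∈ G.edges) :
    ∃ src tgt own pr : ℕ → ℕ, G.Describes es src tgt own pr ∧
      Imp.Input (G.context es v₀ N hes) n d es.length v₀ src tgt own pr N := by
  have hb := valueBound_spec v₀.pos hes d N
  have hsrc : ∀ e (h : e < es.length), (G.encode es v₀).getD (4 + n + n + e + e) 0 = es[e].1 :=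
    fun e h => (G.getD_encode_edge es v₀ h).1
  have htgt : ∀ e (h : e < es.length), (G.encode es v₀).getD (5 + n + n + e + e) 0 = es[e].2 :=
    fun e h => (G.getD_encode_edge es v₀ h).2
  have hprio : ∀ v : Fin n, (G.encode es v₀).getD (5 + v + v) 0 = G.prio v :=
    fun v => (G.getD_encode_vertex es v₀ v).2
  refine ⟨fun e => (G.encode es v₀).getD (4 + n + n + e + e) 0,
    fun e => (G.encode es v₀).getD (5 + n + n + e + e) 0,
    fun v => (G.encode es v₀).getD (4 + v + v) 0, fun v => (G.encode es v₀).getD (5 + v + v) 0,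
    ⟨hmem, hsrc, htgt, fun v => (G.getD_encode_vertex es v₀ v).1, hprio⟩,
    ⟨rfl, rfl, rfl, rfl, fun _ _ => rfl, fun _ _ => rfl, fun _ _ => rfl, fun _ _ => rfl,
      G.length_encode es v₀, v₀.2, fun v hv => ?_, fun e he => ?_, fun e he => ?_, fun v hv => ?_,
      ?_, ?_, ?_, ?_, ?_, ?_⟩⟩
  · exact (hprio ⟨v, hv⟩).trans_le (G.prio_le _)
  · simp only [hsrc e he, Fin.is_lt]
  · simp only [htgt e he, Fin.is_lt]
  · obtain ⟨w, hw⟩ := G.exists_edge ⟨v, hv⟩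
    obtain ⟨e, he, heq⟩ := List.mem_iff_getElem.1 ((hmem _).2 hw)
    exact ⟨e, he, by simp only [hsrc e he, heq]⟩
  all_goals
    simp only [context]
    omega

/-! ### The bound for the running time -/

open Imp

theorem leaves_le {h : ℕ} (hh : 0 < h) (k : ℕ) :
    leaves k (h + h) ≤ 2 ^ (k + 1) * (k + h - 1).choose k := by
  obtain ⟨h, rfl⟩ : ∃ h', h = h' + 1 := ⟨h - 1, by omega⟩
  rw [leaves, show (h + 1 + (h + 1)) / 2 = h + 1 by omega]
  exact length_sepSeq_le k h _

/-- The numbers occurring in the algorithm have `O(log n * log d)` digits. -/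
theorem size_valueBound_le {n m h : ℕ} (hn : 2 ≤ n) (hmn : m ≤ n * n) (hh : 0 < h) :
    Nat.size (valueBound n m (h + h) (leaves (Nat.log 2 n) (h + h))) ≤
      16 * (Nat.log 2 n * Nat.log 2 (h + h)) := by
  set k := Nat.log 2 n
  set l := Nat.log 2 (h + h)
  have hk : 1 ≤ k := Nat.log_pos one_lt_two hn
  have hl : 1 ≤ l := Nat.log_pos one_lt_two (by omega)
  have hnk : n < 2 ^ (k + 1) := Nat.lt_pow_succ_log_self one_lt_two n
  have hdl : h + h < 2 ^ (l + 1) := Nat.lt_pow_succ_log_self one_lt_two _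
  have hhl : h ≤ 2 ^ l := by rw [pow_succ] at hdl; omega
  -- Bounding the binomial coefficient by a power of `h` rather than of `k + h` is essential here:
  -- for small `d`, the logarithm of the latter would be too large.
  have hN : leaves k (h + h) ≤ 2 ^ (k + 1 + l * k) := by
    refine (leaves_le hh k).trans ?_
    rw [pow_add 2 (k + 1), pow_mul]
    refine Nat.mul_le_mul_left _ ?_
    obtain ⟨h, rfl⟩ : ∃ h', h = h' + 1 := ⟨h - 1, by omega⟩
    exact (Nat.choose_add_le_pow k h).trans (Nat.pow_le_pow_left hhl k)
  have hsum : leaves k (h + h) + (h + h) + 1 ≤ 2 ^ (k + 2 + l * k + l) := by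
    have h1 : 2 ^ (k + 1 + l * k) ≤ 2 ^ (k + 1 + l * k + l) :=
      Nat.pow_le_pow_right two_pos (by omega)
    have h2 : 2 ^ (l + 1) ≤ 2 ^ (k + 1 + l * k + l) := Nat.pow_le_pow_right two_pos (by
      have := Nat.zero_le (l * k); omega)
    rw [show k + 2 + l * k + l = k + 1 + l * k + l + 1 by ring, pow_succ]
    omega
  have hprod : valueBound n m (h + h) (leaves k (h + h)) <
      2 ^ (5 + ((k + 1) + ((k + 1) + (k + 1))) + (k + 2 + l * k + l)) := by
    rw [valueBound, pow_add _ _ (k + 2 + l * k + l), pow_add _ 5, pow_add _ (k + 1),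
      pow_add _ (k + 1), show 2 ^ 5 = 32 from rfl, mul_assoc 32]
    refine (Nat.mul_lt_mul_left (by decide : 0 < 32)).2 ?_
    refine Nat.mul_lt_mul_of_lt_of_le ?_ hsum (Nat.two_pow_pos _)
    exact Nat.mul_lt_mul_of_lt_of_le hnk (hmn.trans (Nat.mul_le_mul hnk.le hnk.le))
      (by positivity)
  rw [Nat.size_le]
  refine hprod.trans_le (Nat.pow_le_pow_right two_pos ?_)
  have h1 : k ≤ k * l := Nat.le_mul_of_pos_right _ hl
  have h2 : l ≤ k * l := Nat.le_mul_of_pos_left _ hk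
  rw [mul_comm l k]
  omega

/-- The complete machine code. -/
def solverCode : RAM.Program := .seq prelude solver.compile

/-- Correctness of the algorithm, and the bound for its running time in terms of integers. -/
theorem exec_solverCode (hd : Even d) (G : ParityGame (Fin n) d) (v₀ : Fin n)
    {es : List (Fin n × Fin n)} (hnd : es.Nodup) (hmem : ∀ e, e ∈ es ↔ e ∈ G.edges) :
    ∃ t s, RAM.Exec solverCode (RAM.init (G.encode es v₀)) t s ∧ (G.EveWins v₀ → s.reg 0 = 1) ∧
      (¬ G.EveWins v₀ → s.reg 0 = 0) ∧
      (2 ≤ n → t ≤ 43 * (8 + 23 * solver.size) * (G.edges.card * n * Nat.log 2 n * Nat.log 2 d *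
        (Nat.log 2 n + d / 2 - 1).choose (Nat.log 2 n))) := by
  have hcard : es.length = G.edges.card := by
    rw [← List.toFinset_card_of_nodup hnd]
    congr 1
    ext e
    rw [List.mem_toFinset, hmem]
  have hn : 0 < n := v₀.pos
  have hmn := G.le_card_edges
  have hmn' := G.card_edges_le
  have hd0 : 1 ≤ d := (G.one_le_prio v₀).trans (G.prio_le v₀)
  obtain ⟨h, rfl⟩ := hd
  have hh : 0 < h := by omega
  rw [← hcard] at hmn hmn' ⊢
  set m := es.length with hm
  have hm0 : 0 < m := hn.trans_le hmn
  obtain ⟨src, tgt, own, pr, hdesc, D⟩ :=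
    G.exists_describes v₀ (leaves (Nat.log 2 n) (h + h)) hm0 hmem
  obtain ⟨s, hrun, htime, hwin, hlose⟩ := hdesc.wp_solver D ⟨h, rfl⟩ rfl
  have hpre : Reaches prelude _ _ (RAM.init (G.encode es v₀)) :=
    reaches_prelude (K := G.context es v₀ _ hm0) rfl (fun _ => rfl) (by
      rw [length_encode]
      change _ = 4 + 2 * n + 2 * m
      omega) D.lt_bound
  obtain ⟨t, σ, hexec, ht, hsim⟩ := hpre.seq fun σ hσ => hrun.reaches_compile hσ
  refine ⟨t, σ, hexec, fun hw => (hsim.reg .out).trans (hwin hw),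
    fun hl => (hsim.reg .out).trans (hlose hl), fun hn2 => ht.trans ?_⟩
  have hunit := size_valueBound_le hn2 hmn' hh
  have hkl : 1 ≤ Nat.log 2 n * Nat.log 2 (h + h) :=
    Nat.mul_pos (Nat.log_pos one_lt_two hn2) (Nat.log_pos one_lt_two (by omega))
  have hN := leaves_le hh (Nat.log 2 n)
  have hpow : 2 ^ Nat.log 2 n ≤ n := Nat.pow_log_le_self 2 hn.ne'
  rw [show (h + h) / 2 = h by omega]
  have hhB : h ≤ (Nat.log 2 n + h - 1).choose (Nat.log 2 n) := by
    obtain ⟨k, hk⟩ : ∃ k, Nat.log 2 n = k + 1 :=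
      ⟨Nat.log 2 n - 1, by have := Nat.log_pos one_lt_two hn2; omega⟩
    obtain ⟨h, rfl⟩ : ∃ h', h = h' + 1 := ⟨h - 1, by omega⟩
    rw [hk, show k + 1 + (h + 1) - 1 = h + (k + 1) by omega, ← Nat.choose_symm_add]
    calc h + 1 = (h + 1).choose h := by simp
      _ ≤ _ := Nat.choose_le_choose h (by omega)
  set B := (Nat.log 2 n + h - 1).choose (Nat.log 2 n)
  set N := leaves (Nat.log 2 n) (h + h)
  set k := Nat.log 2 n
  set l := Nat.log 2 (h + h)
  have hB : 0 < B := hh.trans_le hhB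
  have hN2 : N ≤ 2 * (n * B) := by
    refine hN.trans ?_
    rw [pow_succ, mul_comm (2 ^ k), mul_assoc]
    gcongr
  have hu : (G.context es v₀ N hm0).unit ≤ 43 * (k * l) := by
    rw [Context.unit]
    change 11 + 2 * Nat.size (valueBound n m (h + h) N) ≤ _
    omega
  have hx : n * B ≤ m * n * B := Nat.mul_le_mul_right _ (Nat.le_mul_of_pos_left _ hm0)
  have hy : m ≤ m * n * B := (Nat.le_mul_of_pos_right _ hn).trans (Nat.le_mul_of_pos_right _ hB)
  have hz : B ≤ n * B := Nat.le_mul_of_pos_left _ hn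
  have hw : (N + 1) * (m + m) ≤ 4 * (m * n * B) + 2 * m := by
    calc (N + 1) * (m + m) ≤ (2 * (n * B) + 1) * (m + m) := by gcongr
      _ = _ := by ring
  change s.time ≤ h + h + 3 * n + m + 2 * N + 2 * ((N + 1) * (m + m)) at htime
  -- the sum of the terms of `htime`, each of which is bounded by a multiple of `m * n * B`
  have hT : s.time ≤ 22 * (m * n * B) := by omega
  have hone : 1 ≤ m * n * B := hm0.trans_le hy
  calc _ ≤ 8 * (43 * (k * l)) * (m * n * B) +
        solver.size * (23 * (m * n * B)) * (43 * (k * l)) := by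
        refine add_le_add ?_ ?_
        · exact (Nat.mul_le_mul_left 8 hu).trans (Nat.le_mul_of_pos_right _ hone)
        · gcongr
          omega
    _ = _ := by ring

end ParityGame

theorem mainTheorem5 :
    ∃ (P : RAM.Program) (C : ℝ), ∀ (n d : ℕ), Even d →
      ∀ (G : ParityGame (Fin n) d) (v₀ : Fin n) (es : List (Fin n × Fin n)),
        es.Nodup → (∀ e, e ∈ es ↔ e ∈ G.edges) →
        ∃ (t : ℕ) (s : RAM.State),
          RAM.Exec P (RAM.init (G.encode es v₀)) t s ∧
          (G.EveWins v₀ → s.reg 0 = 1) ∧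
          (¬ G.EveWins v₀ → s.reg 0 = 0) ∧
          (2 ≤ n →
            (t : ℝ) ≤ C * ((G.edges.card : ℝ) * (n : ℝ) * Real.logb 2 n * Real.logb 2 d *
              ((⌈Real.logb 2 n⌉₊ + d / 2 - 1).choose ⌈Real.logb 2 n⌉₊ : ℝ))) := by
  refine ⟨ParityGame.solverCode, 43 * (8 + 23 * Imp.solver.size), ?_⟩
  intro n d hd G v₀ es hnd hmem
  obtain ⟨t, s, hexec, hwin, hlose, ht⟩ := ParityGame.exec_solverCode hd G v₀ hnd hmem
  refine ⟨t, s, hexec, hwin, hlose, fun hn => ?_⟩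
  have hd2 : 2 ≤ d := by
    have := (G.one_le_prio v₀).trans (G.prio_le v₀)
    obtain ⟨h, rfl⟩ := hd
    omega
  have hlog : ∀ x : ℕ, 0 < x → (Nat.log 2 x : ℝ) ≤ Real.logb 2 x := fun x _ =>
    Real.natLog_le_logb x 2
  have hk : Nat.log 2 n ≤ ⌈Real.logb 2 n⌉₊ := by
    exact_mod_cast (hlog n (by omega)).trans (Nat.le_ceil _)
  have hchoose : (Nat.log 2 n + d / 2 - 1).choose (Nat.log 2 n) ≤
      (⌈Real.logb 2 n⌉₊ + d / 2 - 1).choose ⌈Real.logb 2 n⌉₊ := by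
    obtain ⟨h, hh⟩ : ∃ h, d / 2 = h + 1 := ⟨d / 2 - 1, by omega⟩
    rw [hh, ← add_assoc, ← add_assoc, Nat.add_sub_cancel, Nat.add_sub_cancel, Nat.choose_symm_add,
      Nat.choose_symm_add]
    exact Nat.choose_le_choose h (by omega)
  have h1 : (t : ℝ) ≤ 43 * (8 + 23 * Imp.solver.size) * (G.edges.card * n * Nat.log 2 n *
      Nat.log 2 d * (Nat.log 2 n + d / 2 - 1).choose (Nat.log 2 n)) := by
    exact_mod_cast ht hn
  refine h1.trans ?_
  have h2 := hlog n (by omega)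
  have h3 := hlog d (by omega)
  have h4 : (0 : ℝ) ≤ Real.logb 2 n := le_trans (Nat.cast_nonneg _) h2
  have h5 : (0 : ℝ) ≤ Real.logb 2 d := le_trans (Nat.cast_nonneg _) h3
  gcongr
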